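/- Let $k_o\subseteq K_o$ be an extension of fields of characteristic $0$, let $t=(t_1,\dots,t_l)$, and let $S_{k_o}\subseteq S_{K_o}$ be one of the pairs of rings of power series $k_o[\![t]\!]\subseteq K_o[\![t]\!]$ (formal), $k_o\langle t\rangle\subseteq K_o\langle t\rangle$ (power series algebraic over the polynomials), or $k_o\{t\}\subseteq K_o\{t\}$ (convergent; here $k_o,K_o$ are complete for non-trivial absolute values, that of $K_o$ extending that of $k_o$). Let $\mathfrak a\subset S_{k_o}$ be an ideal contained in $(t)$, and put $\Bbbk=S_{k_o}/\mathfrak a$, $\mathbb K=S_{K_o}/\mathfrak a S_{K_o}$. Give the variables $x=(x_1,\dots,x_n)$ and $y=(y_1,\dots,y_m)$ positive integer degrees, and let $J_X\subset k_o[x]$, $J_Y\subset k_o[y]$ be graded ideals. For a $k_o$-algebra $R$ put $\mathbb PX_R=\operatorname{Proj}(R[x]/(J_X))$ and $\mathbb PY_R=\operatorname{Proj}(R[y]/(J_Y))$. Let $f_t$ be a graded map over $\Bbbk$, i.e. a degree-preserving homomorphism of $\Bbbk$-algebras $\Bbbk[y]/(J_Y)\to\Bbbk[x]/(J_X)$,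 without base points, i.e. such that the irrelevant ideal of $\Bbbk[x]/(J_X)$ lies in the radical of the ideal generated by the image of the irrelevant ideal of $\Bbbk[y]/(J_Y)$. (Homogeneous forms $f_1,\dots,f_m$ of the same degree $d$ in variables of degree $1$ are the case $\deg y_j=d$.) It defines a family of projective morphisms $\mathbb Pf_t:\mathbb PX_\Bbbk\to\mathbb PY_\Bbbk$ over $\operatorname{Spec}\Bbbk$, with fibre $\mathbb Pf_o$ at $t=0$. Let $\mathcal G$ be one of the groups $\mathcal R$ (right), $\mathcal L$ (left), $\mathcal{LR}$ (left-right). For $R=\Bbbk$ or $R=\mathbb K$ call the family globally-$R$-trivial if there are automorphisms $\Phi_X$ of $\mathbb PX_R$ and $\Phi_Y$ of $\mathbb PY_R$, induced by graded $R$-algebra automorphisms of $R[x]/(J_X)$ and $R[y]/(J_Y)$, with $\Phi_Y=\mathrm{Id}$ if $\mathcal G=\mathcal R$ and $\Phi_X=\mathrm{Id}$ if $\mathcal G=\mathcal L$, such that $\Phi_Y\circ\mathbb P(f_t)_R\circ\Phi_X^{-1}=\mathbb P(f_o)_R$ as morphisms $\mathbb PX_R\to\mathbb PY_R$, where $(f_t)_R$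 is the base change of $f_t$ to $R$ and $(f_o)_R$ is the constant family with fibre $f_o$. If the family $\mathbb Pf_t$ is globally-$\mathbb K$-trivial, then it is globally-$\Bbbk$-trivial. -/

import Mathlib

universe u v

namespace GradedFamily

open AlgebraicGeometry CategoryTheory

section ProjMap
variable {A B σ τ : Type u} [CommRing A] [SetLike σ A] [AddSubgroupClass σ A]
  [CommRing B] [SetLike τ B] [AddSubgroupClass τ B]
  {𝒜 : ℕ → σ} {ℬ : ℕ → τ} [GradedRing 𝒜] [GradedRing ℬ]

/-- The common zero locus of the image of the irrelevant ideal is empty, i.e. the graded map defines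
a morphism (and not only a rational map) of projective schemes. -/
def NoBasePoints (f : 𝒜 →+*ᵍ ℬ) : Prop :=
  (HomogeneousIdeal.irrelevant ℬ).toIdeal ≤
    ((HomogeneousIdeal.irrelevant 𝒜).toIdeal.map (f : A →+* B)).radical

lemma NoBasePoints.exists_mem_basicOpen {f : 𝒜 →+*ᵍ ℬ} (hf : NoBasePoints f) (x : Proj ℬ) :
    ∃ s : Σ i : ℕ+, 𝒜 i, x ∈ Proj.basicOpen ℬ (f (s.2 : A)) := by
  classical
  by_contra! H
  refine x.not_irrelevant_le (hf.trans ?_)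
  have := x.isPrime
  rw [this.isRadical.radical_le_iff, Ideal.map_le_iff_le_comap]
  intro z hz
  rw [← DirectSum.sum_support_decompose 𝒜 z]
  refine Ideal.sum_mem _ fun c hc ↦ ?_
  rcases Nat.eq_zero_or_pos c with rfl | hc0
  · have h0 : (DirectSum.decompose 𝒜 z 0 : A) = 0 := hz
    rw [h0]
    exact Ideal.zero_mem _
  · have := H ⟨⟨c, hc0⟩, DirectSum.decompose 𝒜 z c⟩
    rw [Proj.mem_basicOpen, not_not] at this
    exact this

/-- The affine charts `D₊(f s)` of `Proj ℬ`. -/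
noncomputable def projMapCover (f : 𝒜 →+*ᵍ ℬ) (hf : NoBasePoints f) :
    (Proj ℬ).AffineOpenCover where
  I₀ := Σ i : ℕ+, 𝒜 i
  X s := .of (HomogeneousLocalization.Away ℬ (f (s.2 : A)))
  f s := Proj.awayι ℬ (f (s.2 : A)) (Graded.map_mem f s.2.2) s.1.pos
  idx x := (hf.exists_mem_basicOpen x).choose
  covers x := by
    change x ∈ (Proj.awayι ℬ _ _ _).opensRange
    rw [Proj.opensRange_awayι]
    exact (hf.exists_mem_basicOpen x).choose_spec

lemma awayMap_comp_map (f : 𝒜 →+*ᵍ ℬ) {i j : ℕ} {s t x : A} (hs : s ∈ 𝒜 i) (ht : t ∈ 𝒜 j)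
    (hx : x = s * t) (hx' : f x = f s * f t) :
    (HomogeneousLocalization.awayMap ℬ (Graded.map_mem f ht) hx').comp
      (HomogeneousLocalization.Away.map f s) =
    (HomogeneousLocalization.Away.map f x).comp
      (HomogeneousLocalization.awayMap 𝒜 ht hx) := by
  ext z
  obtain ⟨n, a, ha, rfl⟩ := z.mk_surjective _ hs
  subst hx
  simp only [RingHom.comp_apply]
  rw [HomogeneousLocalization.Away.map_mk, HomogeneousLocalization.awayMap_mk,
    HomogeneousLocalization.awayMap_mk, HomogeneousLocalization.Away.map_mk]
  simp [HomogeneousLocalization.Away.val_mk]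

/-- The morphism `Proj ℬ ⟶ Proj 𝒜` of a graded ring map `f : 𝒜 → ℬ` without base points, glued from
the maps `Spec ℬ_(f s) ⟶ Spec 𝒜_(s)`. -/
noncomputable def projMap (f : 𝒜 →+*ᵍ ℬ) (hf : NoBasePoints f) : Proj ℬ ⟶ Proj 𝒜 :=
  (projMapCover f hf).openCover.glueMorphisms
    (fun s ↦ Spec.map (CommRingCat.ofHom (HomogeneousLocalization.Away.map f (s.2 : A))) ≫
      Proj.awayι 𝒜 (s.2 : A) s.2.2 s.1.pos) <| by
  intro s t
  have key : ∀ (i j : ℕ) (hi : 0 < i) (hj : 0 < j) (s t : A) (hs : s ∈ 𝒜 i) (ht : t ∈ 𝒜 j),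
      Limits.pullback.fst (Proj.awayι ℬ (f s) (Graded.map_mem f hs) hi)
        (Proj.awayι ℬ (f t) (Graded.map_mem f ht) hj) ≫
        Spec.map (CommRingCat.ofHom (HomogeneousLocalization.Away.map f s)) ≫
          Proj.awayι 𝒜 s hs hi =
      Limits.pullback.snd (Proj.awayι ℬ (f s) (Graded.map_mem f hs) hi)
        (Proj.awayι ℬ (f t) (Graded.map_mem f ht) hj) ≫
        Spec.map (CommRingCat.ofHom (HomogeneousLocalization.Away.map f t)) ≫
          Proj.awayι 𝒜 t ht hj := by
    intro i j hi hj s t hs ht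
    have hst : f (s * t) = f s * f t := map_mul f s t
    have hst' : f (s * t) = f t * f s := by rw [hst, mul_comm]
    rw [← cancel_epi (Proj.pullbackAwayιIso ℬ (Graded.map_mem f hs) hi
      (Graded.map_mem f ht) hj hst).inv,
      Proj.pullbackAwayιIso_inv_fst_assoc, Proj.pullbackAwayιIso_inv_snd_assoc,
      ← Spec.map_comp_assoc, ← Spec.map_comp_assoc, ← CommRingCat.ofHom_comp,
      ← CommRingCat.ofHom_comp, awayMap_comp_map f hs ht rfl hst,
      awayMap_comp_map f ht hs (mul_comm s t) hst', CommRingCat.ofHom_comp, CommRingCat.ofHom_comp,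
      Spec.map_comp_assoc, Spec.map_comp_assoc, Proj.SpecMap_awayMap_awayι,
      Proj.SpecMap_awayMap_awayι]
    rfl
  exact key s.1 t.1 s.1.pos t.1.pos s.2 t.2 s.2.2 t.2.2

lemma awayι_projMap (f : 𝒜 →+*ᵍ ℬ) (hf : NoBasePoints f) (i : ℕ) (hi : 0 < i) (s : A)
    (hs : s ∈ 𝒜 i) :
    Proj.awayι ℬ (f s) (Graded.map_mem f hs) hi ≫ projMap f hf =
      Spec.map (CommRingCat.ofHom (HomogeneousLocalization.Away.map f s)) ≫
        Proj.awayι 𝒜 s hs hi :=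
  (projMapCover f hf).openCover.ι_glueMorphisms _ _ ⟨⟨i, hi⟩, ⟨s, hs⟩⟩
end ProjMap

attribute [local instance] MvPolynomial.weightedGradedAlgebra
open MvPolynomial

/-- Graded ideals of `F[x₁, …, xₙ]`, where `x_i` has degree `w i`. -/
abbrev GradedIdeal (F : Type u) [Field F] {n : ℕ} (w : Fin n → ℕ) : Type u :=
  HomogeneousIdeal (weightedHomogeneousSubmodule F w)

section CoordRing
variable {F : Type u} [Field F] {n : ℕ} {w : Fin n → ℕ}
  (J : GradedIdeal F w)
  (R : Type v) [CommRing R] [Algebra F R]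

/-- The ideal of `R[x]` generated by `J`. -/
noncomputable def extIdeal : Ideal (MvPolynomial (Fin n) R) :=
  J.toIdeal.map (MvPolynomial.map (algebraMap F R))

/-- The graded ring `R[x] / (J)`. -/
abbrev CoordRing : Type v := MvPolynomial (Fin n) R ⧸ extIdeal J R

/-- The degree `i` part of `R[x] / (J)`. -/
noncomputable def grading (i : ℕ) : Submodule R (CoordRing J R) :=
  (weightedHomogeneousSubmodule R w i).map (Ideal.Quotient.mkₐ R (extIdeal J R)).toLinearMap

lemma mk_mem_grading {i : ℕ} {p : MvPolynomial (Fin n) R} (hp : IsWeightedHomogeneous w p i) :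
    Ideal.Quotient.mk (extIdeal J R) p ∈ grading J R i := ⟨p, hp, rfl⟩

instance : SetLike.GradedMonoid (grading J R) where
  one_mem := mk_mem_grading J R (isWeightedHomogeneous_one R w)
  mul_mem := by
    rintro i j _ _ ⟨p, hp, rfl⟩ ⟨q, hq, rfl⟩
    exact mk_mem_grading J R (IsWeightedHomogeneous.mul hp hq)

noncomputable def componentMap (i : ℕ) : weightedHomogeneousSubmodule R w i →ₗ[R] grading J R i :=
  ((Ideal.Quotient.mkₐ R (extIdeal J R)).toLinearMap.domRestrict _).codRestrict _
    (fun p => mk_mem_grading J R p.2)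

noncomputable def sumMap : (DirectSum ℕ fun i => weightedHomogeneousSubmodule R w i) →ₐ[R]
    DirectSum ℕ fun i => grading J R i :=
  DirectSum.toAlgebra R (fun i => weightedHomogeneousSubmodule R w i)
    (fun i => (DirectSum.lof R ℕ (fun i => grading J R i) i).comp (componentMap J R i)) rfl (by
      intro i j p q
      simp only [LinearMap.comp_apply, DirectSum.lof_eq_of, DirectSum.of_mul_of]
      congr 1)

noncomputable def polyDecompose :
    MvPolynomial (Fin n) R →ₐ[R] DirectSum ℕ fun i => grading J R i :=
  (sumMap J R).comp (DirectSum.decomposeAlgEquiv (weightedHomogeneousSubmodule R w)).toAlgHom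

lemma polyDecompose_of_mem {i : ℕ} {p : MvPolynomial (Fin n) R}
    (hp : IsWeightedHomogeneous w p i) :
    polyDecompose J R p =
      DirectSum.of (fun i => grading J R i) i ⟨_, mk_mem_grading J R hp⟩ := by
  have h : DirectSum.decompose (weightedHomogeneousSubmodule R w) p =
      DirectSum.of (fun i => weightedHomogeneousSubmodule R w i) i ⟨p, hp⟩ :=
    DirectSum.decompose_of_mem _ hp
  have h' : polyDecompose J R p =
    sumMap J R (DirectSum.decompose (weightedHomogeneousSubmodule R w) p) := rfl
  rw [h', h]
  exact DirectSum.toAddMonoid_of (fun i => ((DirectSum.lof R ℕ (fun i => grading J R i) i).comp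
    (componentMap J R i)).toAddMonoidHom) i ⟨p, hp⟩

lemma polyDecompose_eq_zero (p : MvPolynomial (Fin n) R) (hp : p ∈ extIdeal J R) :
    polyDecompose J R p = 0 := by
  classical
  suffices h : extIdeal J R ≤ RingHom.ker (polyDecompose J R) from h hp
  refine Ideal.map_le_iff_le_comap.mpr ?_
  intro q hq
  rw [← DirectSum.sum_support_decompose (weightedHomogeneousSubmodule F w) q]
  refine Ideal.sum_mem _ fun i _ ↦ ?_
  have hi : IsWeightedHomogeneous w
      (DirectSum.decompose (weightedHomogeneousSubmodule F w) q i : MvPolynomial (Fin n) F) i :=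
    (DirectSum.decompose (weightedHomogeneousSubmodule F w) q i).2
  have hJ : (DirectSum.decompose (weightedHomogeneousSubmodule F w) q i :
      MvPolynomial (Fin n) F) ∈ J.toIdeal := J.isHomogeneous i hq
  rw [Ideal.mem_comap, RingHom.mem_ker, polyDecompose_of_mem J R (i := i)
    (p := MvPolynomial.map (algebraMap F R) _) (by
      intro d hd
      refine hi (d := d) fun h0 ↦ hd ?_
      rw [coeff_map, h0, map_zero])]
  convert map_zero (DirectSum.of (fun i => grading J R i) i)
  exact Ideal.Quotient.eq_zero_iff_mem.mpr (Ideal.mem_map_of_mem _ hJ)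

noncomputable instance : GradedAlgebra (grading J R) :=
  GradedAlgebra.ofAlgHom (grading J R)
    (Ideal.Quotient.liftₐ (extIdeal J R) (polyDecompose J R) (polyDecompose_eq_zero J R))
    (by
      refine Ideal.Quotient.algHom_ext _ ?_
      ext i
      have h := polyDecompose_of_mem J R (isWeightedHomogeneous_X R w i)
      exact (congrArg (DirectSum.coeAlgHom (grading J R)) h).trans
        (DirectSum.coeAlgHom_of _ _ _))
    (by
      rintro i ⟨_, p, hp, rfl⟩
      exact polyDecompose_of_mem J R hp)

end CoordRing

section GradedMorphism
variable {F : Type u} [Field F] {n m : ℕ} {w : Fin n → ℕ} {v : Fin m → ℕ}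

section extMap
variable (J : GradedIdeal F w)
  {R S : Type*} [CommRing R] [Algebra F R] [CommRing S] [Algebra F S]

lemma extIdeal_le_comap (φ : R →ₐ[F] S) :
    extIdeal J R ≤ (extIdeal J S).comap (MvPolynomial.map (φ : R →+* S)) := by
  refine Ideal.map_le_iff_le_comap.mpr fun q hq ↦ ?_
  have h : MvPolynomial.map (φ : R →+* S) (MvPolynomial.map (algebraMap F R) q) =
      MvPolynomial.map (algebraMap F S) q := by
    rw [MvPolynomial.map_map, AlgHom.comp_algebraMap]
  rw [Ideal.mem_comap, Ideal.mem_comap, h]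
  exact Ideal.mem_map_of_mem _ hq

/-- The map `R[x] / (J) → S[x] / (J)` induced by `R → S`. -/
noncomputable def extMap (φ : R →ₐ[F] S) : CoordRing J R →+* CoordRing J S :=
  Ideal.quotientMap _ (MvPolynomial.map (φ : R →+* S)) (extIdeal_le_comap J φ)

lemma extMap_mk (φ : R →ₐ[F] S) (p : MvPolynomial (Fin n) R) :
    extMap J φ (Ideal.Quotient.mk _ p) =
      Ideal.Quotient.mk _ (MvPolynomial.map (φ : R →+* S) p) := rfl

lemma extMap_mem (φ : R →ₐ[F] S) {i : ℕ} {x : CoordRing J R} (hx : x ∈ grading J R i) :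
    extMap J φ x ∈ grading J S i := by
  obtain ⟨p, hp, rfl⟩ := hx
  refine mk_mem_grading J S (p := MvPolynomial.map (φ : R →+* S) p) ?_
  intro d hd
  refine hp (d := d) fun h0 ↦ hd ?_
  rw [coeff_map, h0, map_zero]

lemma mem_irrelevant_of_mem {i : ℕ} (hi : 0 < i) {x : CoordRing J R}
    (hx : x ∈ grading J R i) :
    x ∈ (HomogeneousIdeal.irrelevant (grading J R)).toIdeal := by
  have : (DirectSum.decompose (grading J R) x 0 : CoordRing J R) = 0 :=
    DirectSum.decompose_of_mem_ne (grading J R) hx hi.ne'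
  exact this

lemma irrelevant_le {I : Ideal (CoordRing J R)}
    (h : ∀ i, 0 < i → ∀ x ∈ grading J R i, x ∈ I) :
    (HomogeneousIdeal.irrelevant (grading J R)).toIdeal ≤ I := by
  classical
  intro z hz
  rw [← DirectSum.sum_support_decompose (grading J R) z]
  refine Ideal.sum_mem _ fun c _ ↦ ?_
  rcases Nat.eq_zero_or_pos c with rfl | hc0
  · have h0 : (DirectSum.decompose (grading J R) z 0 : CoordRing J R) = 0 := hz
    rw [h0]
    exact Ideal.zero_mem _
  · exact h c hc0 _ (DirectSum.decompose (grading J R) z c).2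

lemma map_extMap_irrelevant_le (φ : R →ₐ[F] S) :
    (HomogeneousIdeal.irrelevant (grading J R)).toIdeal.map (extMap J φ) ≤
      (HomogeneousIdeal.irrelevant (grading J S)).toIdeal := by
  refine Ideal.map_le_iff_le_comap.mpr (irrelevant_le J fun i hi x hx ↦ ?_)
  exact mem_irrelevant_of_mem J hi (extMap_mem J φ hx)

lemma irrelevant_le_map_extMap (φ : R →ₐ[F] S) :
    (HomogeneousIdeal.irrelevant (grading J S)).toIdeal ≤
      (HomogeneousIdeal.irrelevant (grading J R)).toIdeal.map (extMap J φ) := by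
  refine irrelevant_le J fun i hi x hx ↦ ?_
  obtain ⟨p, hp, rfl⟩ := hx
  change Ideal.Quotient.mk _ p ∈ _
  rw [p.as_sum, map_sum]
  refine Ideal.sum_mem _ fun d hd ↦ ?_
  have hmon : (monomial d (p.coeff d) : MvPolynomial (Fin n) S) =
      C (p.coeff d) * MvPolynomial.map (φ : R →+* S) (monomial d 1) := by
    rw [map_monomial, map_one, C_mul_monomial, mul_one]
  rw [hmon, map_mul]
  refine Ideal.mul_mem_left _ _ (Ideal.mem_map_of_mem (extMap J φ)
    (x := Ideal.Quotient.mk _ (monomial d 1)) (mem_irrelevant_of_mem J hi ?_))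
  exact mk_mem_grading J R (isWeightedHomogeneous_monomial w d 1
    (hp (d := d) (by simpa using hd)))

end extMap

/-- A graded `R`-map `X_R → Y_R` whose projectivization is a morphism, given by the graded
`R`-algebra homomorphism `R[y] / (JY) → R[x] / (JX)`. -/
structure GradedMorphism (JX : GradedIdeal F w)
    (JY : GradedIdeal F v)
    (R : Type*) [CommRing R] [Algebra F R] where
  hom : grading JY R →ₐᵍ[R] grading JX R
  noBasePoints : NoBasePoints hom.toGradedRingHom

namespace GradedMorphism
variable {JX : GradedIdeal F w}
  {JY : GradedIdeal F v}
  {R S : Type*} [CommRing R] [Algebra F R] [CommRing S] [Algebra F S]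

/-- The projectivization `ℙf : ℙX_R ⟶ ℙY_R`. -/
noncomputable def proj (f : GradedMorphism JX JY R) :
    Proj (grading JX R) ⟶ Proj (grading JY R) :=
  projMap f.hom.toGradedRingHom f.noBasePoints

/-- The components of `f`, with coefficients extended along `φ : R → S`. -/
noncomputable def coord (φ : R →ₐ[F] S) (f : GradedMorphism JX JY R) (j : Fin m) :
    CoordRing JX S :=
  extMap JX φ (f.hom (Ideal.Quotient.mk _ (X j)))

lemma aeval_coord (φ : R →ₐ[F] S) (f : GradedMorphism JX JY R) (p : MvPolynomial (Fin m) R) :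
    aeval (f.coord φ) (MvPolynomial.map (φ : R →+* S) p) =
      extMap JX φ (f.hom (Ideal.Quotient.mk _ p)) := by
  have : ((aeval (f.coord φ) : MvPolynomial (Fin m) S →ₐ[S] CoordRing JX S) :
        MvPolynomial (Fin m) S →+* CoordRing JX S).comp (MvPolynomial.map (φ : R →+* S)) =
      ((extMap JX φ).comp (f.hom.toAlgHom : CoordRing JY R →+* CoordRing JX R)).comp
        (Ideal.Quotient.mk (extIdeal JY R)) := by
    refine MvPolynomial.ringHom_ext (fun r ↦ ?_) fun j ↦ ?_
    · have h : f.hom.toAlgHom (algebraMap R (CoordRing JY R) r) =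
          algebraMap R (CoordRing JX R) r := f.hom.toAlgHom.commutes r
      simp only [RingHom.comp_apply, MvPolynomial.map_C]
      refine (aeval_C _ _).trans ?_
      exact (congrArg (Ideal.Quotient.mk (extIdeal JX S))
        (MvPolynomial.map_C (φ : R →+* S) r)).symm.trans (congrArg (extMap JX φ) h).symm
    · simp only [RingHom.comp_apply, MvPolynomial.map_X]
      exact aeval_X _ _
  exact congrArg (fun g : MvPolynomial (Fin m) R →+* CoordRing JX S ↦ g p) this

lemma aeval_coord_eq_zero (φ : R →ₐ[F] S) (f : GradedMorphism JX JY R)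
    (p : MvPolynomial (Fin m) S) (hp : p ∈ extIdeal JY S) : aeval (f.coord φ) p = 0 := by
  suffices h : extIdeal JY S ≤ RingHom.ker
      (aeval (f.coord φ) : MvPolynomial (Fin m) S →ₐ[S] CoordRing JX S) from h hp
  refine Ideal.map_le_iff_le_comap.mpr fun q hq ↦ ?_
  have h : MvPolynomial.map (φ : R →+* S) (MvPolynomial.map (algebraMap F R) q) =
      MvPolynomial.map (algebraMap F S) q := by
    rw [MvPolynomial.map_map, AlgHom.comp_algebraMap]
  have h0 : Ideal.Quotient.mk (extIdeal JY R) (MvPolynomial.map (algebraMap F R) q) = 0 :=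
    Ideal.Quotient.eq_zero_iff_mem.mpr (Ideal.mem_map_of_mem _ hq)
  rw [Ideal.mem_comap, RingHom.mem_ker, ← h, aeval_coord, h0, map_zero, map_zero]

lemma aeval_coord_mem (φ : R →ₐ[F] S) (f : GradedMorphism JX JY R) {i : ℕ}
    {p : MvPolynomial (Fin m) S} (hp : IsWeightedHomogeneous v p i) :
    aeval (f.coord φ) p ∈ grading JX S i := by
  rw [aeval_def, eval₂_eq]
  refine Submodule.sum_mem _ fun d hd ↦ ?_
  rw [← Algebra.smul_def]
  refine Submodule.smul_mem _ _ ?_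
  have hdi : ∑ j, d j • v j = i := by
    have := hp (d := d) (by simpa using hd)
    rwa [Finsupp.weight_apply, Finsupp.sum_fintype _ _ (by simp)] at this
  have hprod : ∀ s : Finset (Fin m),
      ∏ j ∈ s, f.coord φ j ^ d j ∈ grading JX S (∑ j ∈ s, d j • v j) := by
    intro s
    refine SetLike.prod_mem_graded (A := grading JX S) (fun j ↦ d j • v j) (fun j ↦ f.coord φ j ^ d j)
      fun j _ ↦ SetLike.pow_mem_graded _ ?_
    exact extMap_mem JX φ (f.hom.map_mem (mk_mem_grading JY R (isWeightedHomogeneous_X R v j)))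
  have h2 : ∏ j ∈ d.support, f.coord φ j ^ d j = ∏ j, f.coord φ j ^ d j :=
    Finset.prod_subset (Finset.subset_univ _) fun j _ hj ↦ by
      rw [Finsupp.notMem_support_iff.mp hj, pow_zero]
  rw [h2, ← hdi]
  exact hprod Finset.univ

/-- The graded `S`-algebra homomorphism with the same components as `f`. -/
noncomputable def baseChangeHom (φ : R →ₐ[F] S) (f : GradedMorphism JX JY R) :
    grading JY S →ₐᵍ[S] grading JX S where
  __ := Ideal.Quotient.liftₐ (extIdeal JY S) (aeval (f.coord φ)) (f.aeval_coord_eq_zero φ)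
  map_mem := by
    rintro i _ ⟨p, hp, rfl⟩
    exact f.aeval_coord_mem φ hp

lemma baseChangeHom_extMap (φ : R →ₐ[F] S) (f : GradedMorphism JX JY R) (x : CoordRing JY R) :
    f.baseChangeHom φ (extMap JY φ x) = extMap JX φ (f.hom x) := by
  obtain ⟨p, rfl⟩ := Ideal.Quotient.mk_surjective x
  exact f.aeval_coord φ p

/-- The base change `f_S : X_S → Y_S` along `φ : R → S`. -/
noncomputable def baseChange (φ : R →ₐ[F] S) (f : GradedMorphism JX JY R) :
    GradedMorphism JX JY S where
  hom := f.baseChangeHom φ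
  noBasePoints := by
    have h : (extMap JX φ).comp (f.hom.toGradedRingHom : CoordRing JY R →+* CoordRing JX R) =
        ((f.baseChangeHom φ).toGradedRingHom : CoordRing JY S →+* CoordRing JX S).comp
          (extMap JY φ) :=
      RingHom.ext fun x ↦ (f.baseChangeHom_extMap φ x).symm
    refine (irrelevant_le_map_extMap JX φ).trans ((Ideal.map_mono f.noBasePoints).trans
      ((Ideal.map_radical_le _).trans (Ideal.radical_mono ?_)))
    rw [Ideal.map_map, h, ← Ideal.map_map]
    exact Ideal.map_mono (map_extMap_irrelevant_le JY φ)

end GradedMorphism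

/-- Graded `R`-automorphisms of `X_R`. -/
structure GradedAut (J : GradedIdeal F w)
    (R : Type*) [CommRing R] [Algebra F R] where
  toAlgEquiv : CoordRing J R ≃ₐ[R] CoordRing J R
  map_mem_iff : ∀ i x, toAlgEquiv x ∈ grading J R i ↔ x ∈ grading J R i

namespace GradedAut
variable {J : GradedIdeal F w}
  {R : Type*} [CommRing R] [Algebra F R]

/-- The identity. -/
noncomputable def refl : GradedAut J R := ⟨AlgEquiv.refl, fun _ _ ↦ Iff.rfl⟩

/-- A graded automorphism as a graded morphism; its projectivization is an automorphism of `ℙX_R`. -/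
noncomputable def toGradedMorphism (α : GradedAut J R) : GradedMorphism J J R where
  hom :=
    { (α.toAlgEquiv : CoordRing J R →ₐ[R] CoordRing J R) with
      map_mem := fun {_ _} hx ↦ (α.map_mem_iff _ _).mpr hx }
  noBasePoints := by
    refine irrelevant_le J fun i hi x hx ↦ Ideal.le_radical ?_
    obtain ⟨y, rfl⟩ := α.toAlgEquiv.surjective x
    exact Ideal.mem_map_of_mem _ (mem_irrelevant_of_mem J hi ((α.map_mem_iff _ _).mp hx))

end GradedAut

/-- The group of equivalences: right, left or left-right. -/
inductive EquivGroup
  | right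
  | left
  | leftRight

/-- The pairs (automorphism of the source, automorphism of the target) that belong to the group. -/
def EquivGroup.Mem {JX : GradedIdeal F w} {JY : GradedIdeal F v}
    {R : Type*} [CommRing R] [Algebra F R] :
    EquivGroup → GradedAut JX R → GradedAut JY R → Prop
  | right, _, β => β = GradedAut.refl
  | left, α, _ => α = GradedAut.refl
  | leftRight, _, _ => True

/-- The morphisms `ℙf, ℙg : ℙX_R ⟶ ℙY_R` are globally `𝒢`-equivalent over `R`:
`ℙβ ∘ ℙf ∘ ℙα = ℙg` for a pair of projective automorphisms in the group. -/
def GloballyEquivalent (𝒢 : EquivGroup) {JX : GradedIdeal F w} {JY : GradedIdeal F v}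
    {R : Type*} [CommRing R] [Algebra F R] (f g : GradedMorphism JX JY R) : Prop :=
  ∃ (α : GradedAut JX R) (β : GradedAut JY R), 𝒢.Mem α β ∧
    α.toGradedMorphism.proj ≫ f.proj ≫ β.toGradedMorphism.proj = g.proj

/-- A family `f` over `k`, with the point `o` of `Spec k`, is globally `𝒢`-trivial over the
`k`-algebra `R` (with structure map `φ`) if over `R` it is globally equivalent to the constant
family with fibre `f_o`. -/
def GloballyTrivial (𝒢 : EquivGroup) {JX : GradedIdeal F w} {JY : GradedIdeal F v}
    {k R : Type*} [CommRing k] [Algebra F k] [CommRing R] [Algebra F R]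
    (f : GradedMorphism JX JY k) (o : k →ₐ[F] F) (φ : k →ₐ[F] R) : Prop :=
  GloballyEquivalent 𝒢 (f.baseChange φ) ((f.baseChange o).baseChange (Algebra.ofId F R))

end GradedMorphism

section Series

/-- The algebraic (Nash) power series `F⟨t₁, …, t_l⟩`: the formal power series that are algebraic
over the polynomial ring `F[t]`. -/
noncomputable def nashSeries (F : Type u) [Field F] (l : ℕ) :
    Subalgebra F (MvPowerSeries (Fin l) F) :=
  (Subalgebra.algebraicClosure (MvPolynomial (Fin l) F) (MvPowerSeries (Fin l) F)).restrictScalars F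

/-- Absolute convergence on the polydisc of polyradius `(r, …, r)`, for the absolute value `a`. -/
def ConvergesAt {F : Type u} [Field F] (a : AbsoluteValue F ℝ) {l : ℕ} (r : ℝ)
    (p : MvPowerSeries (Fin l) F) : Prop :=
  Summable fun d : Fin l →₀ ℕ => a (MvPowerSeries.coeff d p) * r ^ d.degree

lemma ConvergesAt.mono {F : Type u} [Field F] {a : AbsoluteValue F ℝ} {l : ℕ} {r s : ℝ}
    (hr : 0 ≤ r) (hrs : r ≤ s) {p : MvPowerSeries (Fin l) F} (h : ConvergesAt a s p) :
    ConvergesAt a r p :=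
  Summable.of_nonneg_of_le (fun _ ↦ mul_nonneg (a.nonneg _) (pow_nonneg hr _))
    (fun _ ↦ mul_le_mul_of_nonneg_left (pow_le_pow_left₀ hr hrs _) (a.nonneg _)) h

lemma ConvergesAt.add {F : Type u} [Field F] {a : AbsoluteValue F ℝ} {l : ℕ} {r : ℝ}
    (hr : 0 ≤ r) {p q : MvPowerSeries (Fin l) F} (hp : ConvergesAt a r p)
    (hq : ConvergesAt a r q) : ConvergesAt a r (p + q) := by
  refine Summable.of_nonneg_of_le (fun _ ↦ mul_nonneg (a.nonneg _) (pow_nonneg hr _))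
    (fun d ↦ ?_) (Summable.add hp hq)
  rw [map_add, ← add_mul]
  exact mul_le_mul_of_nonneg_right (a.add_le _ _) (pow_nonneg hr _)

lemma summable_antidiagonal {M : Type*} [AddCommMonoid M] [Finset.HasAntidiagonal M] {f g : M → ℝ}
    (hf0 : ∀ x, 0 ≤ f x) (hg0 : ∀ x, 0 ≤ g x) (hf : Summable f) (hg : Summable g) :
    Summable fun d => ∑ x ∈ Finset.HasAntidiagonal.antidiagonal d, f x.1 * g x.2 :=
  summable_sum_mul_antidiagonal_of_summable_mul (f := f) (g := g)
    (Summable.mul_of_nonneg hf hg hf0 hg0)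

lemma ConvergesAt.mul {F : Type u} [Field F] {a : AbsoluteValue F ℝ} {l : ℕ} {r : ℝ}
    (hr : 0 ≤ r) {p q : MvPowerSeries (Fin l) F} (hp : ConvergesAt a r p)
    (hq : ConvergesAt a r q) : ConvergesAt a r (p * q) := by
  classical
  have h := summable_antidiagonal (f := fun d : Fin l →₀ ℕ => a (MvPowerSeries.coeff d p) * r ^ d.degree)
    (g := fun d : Fin l →₀ ℕ => a (MvPowerSeries.coeff d q) * r ^ d.degree)
    (fun _ ↦ mul_nonneg (a.nonneg _) (pow_nonneg hr _))
    (fun _ ↦ mul_nonneg (a.nonneg _) (pow_nonneg hr _)) hp hq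
  refine Summable.of_nonneg_of_le (fun _ ↦ mul_nonneg (a.nonneg _) (pow_nonneg hr _))
    (fun d ↦ ?_) h
  rw [MvPowerSeries.coeff_mul]
  refine (mul_le_mul_of_nonneg_right (a.sum_le _ _) (pow_nonneg hr _)).trans (le_of_eq ?_)
  rw [Finset.sum_mul]
  refine Finset.sum_congr rfl fun x hx ↦ ?_
  rw [← Finset.HasAntidiagonal.mem_antidiagonal.mp hx, map_mul, map_add, pow_add]
  ring

/-- The convergent power series `F{t₁, …, t_l}` over the field `F` with the absolute value `a`. -/
noncomputable def convergentSeries {F : Type u} [Field F] (a : AbsoluteValue F ℝ) (l : ℕ) :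
    Subalgebra F (MvPowerSeries (Fin l) F) where
  carrier := {p | ∃ r : ℝ, 0 < r ∧ ConvergesAt a r p}
  mul_mem' := by
    rintro p q ⟨r, hr, hp⟩ ⟨s, hs, hq⟩
    have h0 : 0 < min r s := lt_min hr hs
    exact ⟨min r s, h0, (hp.mono h0.le (min_le_left _ _)).mul h0.le
      (hq.mono h0.le (min_le_right _ _))⟩
  add_mem' := by
    rintro p q ⟨r, hr, hp⟩ ⟨s, hs, hq⟩
    have h0 : 0 < min r s := lt_min hr hs
    exact ⟨min r s, h0, (hp.mono h0.le (min_le_left _ _)).add h0.le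
      (hq.mono h0.le (min_le_right _ _))⟩
  algebraMap_mem' c := by
    classical
    refine ⟨1, one_pos, summable_of_ne_finset_zero (s := {0}) fun d hd ↦ ?_⟩
    rw [MvPowerSeries.algebraMap_apply, MvPowerSeries.coeff_C, if_neg (by simpa using hd),
      map_zero, zero_mul]

/-- The rings of power series `k₀[[t]] ⊆ K₀[[t]]`, `k₀⟨t⟩ ⊆ K₀⟨t⟩`, `k₀{t} ⊆ K₀{t}` attached to a field
extension `F = k₀ ⊆ E = K₀`. In the analytic case both fields are complete for a non-trivial
absolute value, and the absolute value of `E` extends that of `F`. -/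
inductive IsSeriesPair {F : Type u} {E : Type v} [Field F] [Field E] [Algebra F E] {l : ℕ} :
    Subalgebra F (MvPowerSeries (Fin l) F) → Subalgebra E (MvPowerSeries (Fin l) E) → Prop
  | formal : IsSeriesPair ⊤ ⊤
  | nash : IsSeriesPair (nashSeries F l) (nashSeries E l)
  | analytic (a : AbsoluteValue F ℝ) (b : AbsoluteValue E ℝ) (ha : a.IsNontrivial)
      (hab : ∀ x : F, b (algebraMap F E x) = a x)
      (ha' : CompleteSpace (WithAbs a)) (hb' : CompleteSpace (WithAbs b)) :
      IsSeriesPair (convergentSeries a l) (convergentSeries b l)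

variable {F : Type u} {E : Type v} [Field F] [Field E] [Algebra F E] {l : ℕ}
  {SF : Subalgebra F (MvPowerSeries (Fin l) F)} {SE : Subalgebra E (MvPowerSeries (Fin l) E)}

lemma IsSeriesPair.map_mem (h : IsSeriesPair SF SE) {p : MvPowerSeries (Fin l) F} (hp : p ∈ SF) :
    MvPowerSeries.map (algebraMap F E) p ∈ SE := by
  cases h with
  | formal => trivial
  | nash =>
    have hp' : IsAlgebraic (MvPolynomial (Fin l) F) p := hp
    refine hp'.ringHom_of_comp_eq (MvPolynomial.map (algebraMap F E))
      (MvPowerSeries.map (algebraMap F E))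
      (MvPolynomial.map_injective _ (algebraMap F E).injective) ?_
    ext x : 2 <;>
    simp [MvPowerSeries.algebraMap_apply']
  | analytic a b _ hab _ _ =>
    obtain ⟨r, hr, h⟩ := hp
    refine ⟨r, hr, ?_⟩
    simpa [ConvergesAt, MvPowerSeries.coeff_map, hab] using h

/-- The inclusion of the power series over `F` into those over `E`. -/
noncomputable def IsSeriesPair.map (h : IsSeriesPair SF SE) : SF →ₐ[F] SE where
  toFun p := ⟨MvPowerSeries.map (algebraMap F E) p.1, h.map_mem p.2⟩
  map_one' := Subtype.ext (map_one _)
  map_mul' p q := Subtype.ext (map_mul _ p.1 q.1)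
  map_zero' := Subtype.ext (map_zero _)
  map_add' p q := Subtype.ext (map_add _ p.1 q.1)
  commutes' c := Subtype.ext (by
    change MvPowerSeries.map (algebraMap F E) (algebraMap F (MvPowerSeries (Fin l) F) c) =
      algebraMap F (MvPowerSeries (Fin l) E) c
    rw [MvPowerSeries.algebraMap_apply, MvPowerSeries.algebraMap_apply, MvPowerSeries.map_C]
    rfl)

/-- The extension of base rings `k = S_F / I → K = S_E / I·S_E`. -/
noncomputable def IsSeriesPair.quotientMap (h : IsSeriesPair SF SE) (I : Ideal SF) :
    SF ⧸ I →ₐ[F] SE ⧸ I.map h.map :=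
  Ideal.quotientMapₐ (I.map h.map) h.map Ideal.le_comap_map

/-- The point `t = 0` of `Spec k`, for `k = S_F / I` with `I ⊆ (t)`. -/
noncomputable def valueAtZero (I : Ideal SF)
    (hI : ∀ p ∈ I, MvPowerSeries.constantCoeff (p : MvPowerSeries (Fin l) F) = 0) :
    SF ⧸ I →ₐ[F] F :=
  Ideal.Quotient.liftₐ I
    { (MvPowerSeries.constantCoeff (σ := Fin l) (R := F)).comp
        (SF.val : SF →+* MvPowerSeries (Fin l) F) with
      commutes' := fun c ↦ by
        change MvPowerSeries.constantCoeff (algebraMap F (MvPowerSeries (Fin l) F) c) = c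
        rw [MvPowerSeries.algebraMap_apply, MvPowerSeries.constantCoeff_C]
        rfl } hI

end Series
end GradedFamily

namespace GradedFamily
open AlgebraicGeometry CategoryTheory

/-! ### Equality and composition of morphisms of Proj, in terms of the graded ring maps. -/

section ProjMap
variable {A B σ τ : Type u} [CommRing A] [SetLike σ A] [AddSubgroupClass σ A]
  [CommRing B] [SetLike τ B] [AddSubgroupClass τ B]
  {𝒜 : ℕ → σ} {ℬ : ℕ → τ} [GradedRing 𝒜] [GradedRing ℬ]

/-! A trivialisation is a pair of degree-preserving substitutions `a` of `x` and `b` of `y`. As the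
variables have positive degrees, it has finitely many coefficients. Two graded maps define the same
morphism of Proj exactly when they are proportional on forms, modulo the saturation of `J_X`
(`proj_eq_of_parallel`, `parallel_of_proj_eq`). Since `J_X` and `J_Y` are defined over the field
`F`, membership in their extensions and saturations is tested by `F`-linear functionals
(`mem_map_iff_extFunctional`, `map_satIdeal`). Hence the trivialisations are the solutions of a
system of polynomial equations over the base ring `k = S_F / I` (`forall_mem_pointEquations`), and a
solution in `K = S_E / I S_E` has to be replaced by one in `k`.

In characteristic 0 the solution space has enough infinitesimal symmetries for this. A tangent
vector at the identity is a pair of derivations over `F`, and composing with the exponentials of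
nilpotent multiples of these derivations carries solutions to solutions (`IsPoint.exp`,
`IsPoint.exists_move`). Dividing the given solution over `K` by its value at `t = 0` makes it the
identity there (`exists_isPoint_of_globallyTrivial`), so modulo every power of the ideal of `t = 0`
there is a solution close to the identity. Choose equations whose differentials at the identity form
a maximal independent set, complete them by coordinates to a square system, and solve this system in
`k` by the implicit function theorem, with solution `z`. Order by order, the solutions over the
nilpotent thickenings can be moved along tangent vectors until they coincide with `z`; thus `z`
satisfies all equations in every thickening (`exists_solution_of_lifting`). The maps from `k` to the
thickenings of `K` are jointly injective, so `z` is a solution in `k`. By Nakayama's lemma its two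
substitutions are automorphisms (`exists_gradedAut`).

Two properties of `S_F` enter: the implicit function theorem (`HasImplicitSolutions`, obtained from
fixed points of contracting polynomial maps) and the closedness of ideals (`HasClosedIdeals`), which
together with an `F`-linear retraction of `E` onto `F` gives the joint injectivity. For convergent
series they come from norm estimates for the iterates and from division by a standard basis;
closedness for formal series is the case of the trivial absolute value. For Nash series they come
from the Jacobian criterion for algebraicity, and from Weierstrass division preserving algebraicity,
which gives the Noetherian property, combined with Krull's intersection theorem. -/

lemma awayι_mul_projMap (f : 𝒜 →+*ᵍ ℬ) (hf : NoBasePoints f) {i j : ℕ} (hi : 0 < i) {s : A}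
    (hs : s ∈ 𝒜 i) {t x : B} (ht : t ∈ ℬ j) (hx : x = f s * t) (hx' : x ∈ ℬ (i + j)) :
    Proj.awayι ℬ x hx' (by omega) ≫ projMap f hf =
      Spec.map (CommRingCat.ofHom ((HomogeneousLocalization.awayMap ℬ ht hx).comp
        (HomogeneousLocalization.Away.map f s))) ≫ Proj.awayι 𝒜 s hs hi := by
  rw [CommRingCat.ofHom_comp, Spec.map_comp_assoc, ← awayι_projMap f hf i hi s hs,
    Proj.SpecMap_awayMap_awayι_assoc ℬ (Graded.map_mem f hs) hi ht hx]

lemma awayMap_map_mk (f : 𝒜 →+*ᵍ ℬ) {i j : ℕ} {s : A} (hs : s ∈ 𝒜 i) {t x : B} (ht : t ∈ ℬ j)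
    (hx : x = f s * t) (n : ℕ) (a : A) (ha : a ∈ 𝒜 (n • i)) :
    (HomogeneousLocalization.awayMap ℬ ht hx (HomogeneousLocalization.Away.map f s
      (HomogeneousLocalization.Away.mk 𝒜 hs n a ha))).val =
      Localization.mk (f a * t ^ n) (⟨x ^ n, n, rfl⟩ : Submonoid.powers x) := by
  rw [HomogeneousLocalization.Away.map_mk, HomogeneousLocalization.awayMap_mk,
    HomogeneousLocalization.Away.val_mk]

/-- On the chart where both `f (s i)` and `g (s i)` are invertible, the two morphisms land in the
chart of `s i` and send `a / s^n` to `f a * g s^n` and `g a * f s^n` over the common denominator `(f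
s * g s)^n`. The hypotheses say that these charts cover and that the fractions agree. -/
theorem projMap_eq_projMap {f g : 𝒜 →+*ᵍ ℬ} (hf : NoBasePoints f) (hg : NoBasePoints g)
    (d : ℕ) (hd : 0 < d) {ι : Type*} (s : ι → A) (hs : ∀ i, s i ∈ 𝒜 d)
    (hcov : ∀ x : Proj ℬ, ∃ i, x ∈ Proj.basicOpen ℬ (f (s i) * g (s i)))
    (h : ∀ i n, ∀ a ∈ 𝒜 (n • d), ∃ N, (f (s i) * g (s i)) ^ N *
      (f a * g (s i) ^ n - g a * f (s i) ^ n) = 0) :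
    projMap f hf = projMap g hg := by
  let U : (Proj ℬ).AffineOpenCover :=
    { I₀ := ι
      X i := .of (HomogeneousLocalization.Away ℬ (f (s i) * g (s i)))
      f i := Proj.awayι ℬ (f (s i) * g (s i)) (SetLike.mul_mem_graded (Graded.map_mem f (hs i))
        (Graded.map_mem g (hs i))) (by omega)
      idx x := (hcov x).choose
      covers x := by
        change x ∈ (Proj.awayι ℬ _ _ _).opensRange
        rw [Proj.opensRange_awayι]
        exact (hcov x).choose_spec }
  refine U.openCover.hom_ext _ _ fun i ↦ ?_
  change Proj.awayι ℬ (f (s i) * g (s i)) _ _ ≫ _ = Proj.awayι ℬ (f (s i) * g (s i)) _ _ ≫ _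
  rw [awayι_mul_projMap f hf hd (hs i) (Graded.map_mem g (hs i)) rfl,
    awayι_mul_projMap g hg hd (hs i) (Graded.map_mem f (hs i)) (mul_comm _ _)]
  congr 3
  refine RingHom.ext fun z ↦ ?_
  obtain ⟨n, a, ha, rfl⟩ := z.mk_surjective _ (hs i)
  apply HomogeneousLocalization.val_injective
  rw [RingHom.comp_apply, RingHom.comp_apply, awayMap_map_mk, awayMap_map_mk,
    Localization.mk_eq_mk_iff, Localization.r_iff_exists]
  obtain ⟨N, hN⟩ := h i n a ha
  refine ⟨⟨_, N, rfl⟩, ?_⟩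
  simp only
  linear_combination ((f (s i) * g (s i)) ^ n) * hN

/-- The open immersion of the chart of `s` is a monomorphism and `Spec` is faithful, so equality of
the morphisms restricted to the chart of `f s * g s` is equality of the two ring maps, read off on
`a / s^n`. -/
theorem exists_pow_mul_eq_zero_of_projMap_eq {f g : 𝒜 →+*ᵍ ℬ} {hf : NoBasePoints f}
    {hg : NoBasePoints g} (h : projMap f hf = projMap g hg) {d : ℕ} (hd : 0 < d) {s : A}
    (hs : s ∈ 𝒜 d) (n : ℕ) {a : A} (ha : a ∈ 𝒜 (n • d)) :
    ∃ N, (f s * g s) ^ N * (f a * g s ^ n - g a * f s ^ n) = 0 := by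
  have hx := SetLike.mul_mem_graded (Graded.map_mem f hs) (Graded.map_mem g hs)
  have h1 := awayι_mul_projMap f hf hd hs (Graded.map_mem g hs) rfl hx
  have h2 := awayι_mul_projMap g hg hd hs (Graded.map_mem f hs) (mul_comm _ _) hx
  rw [h, h2, cancel_mono] at h1
  have h3 := congrArg CommRingCat.Hom.hom (Spec.map_injective h1)
  simp only [CommRingCat.hom_ofHom] at h3
  have h4 := congrArg HomogeneousLocalization.val (RingHom.congr_fun h3
    (HomogeneousLocalization.Away.mk 𝒜 hs n a ha))
  rw [RingHom.comp_apply, RingHom.comp_apply, awayMap_map_mk, awayMap_map_mk,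
    Localization.mk_eq_mk_iff, Localization.r_iff_exists] at h4
  obtain ⟨⟨_, N, rfl⟩, h5⟩ := h4
  -- Cross-multiplying two fractions with denominator `(f s * g s)^n` leaves one extra factor of
  -- this kind.
  refine ⟨N + n, ?_⟩
  simp only at h5
  rw [pow_add]
  linear_combination - h5

/-- Checked on the chart of some `f s'` containing `x`: there both basic opens are those of the
elements `s^i / s'^d` and `f(s)^i / f(s')^d`, and the local ring map sends one to the other. -/
lemma mem_basicOpen_map {f : 𝒜 →+*ᵍ ℬ} {hf : NoBasePoints f} {d : ℕ} (hd : 0 < d) {s : A}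
    (hs : s ∈ 𝒜 d) {x : Proj ℬ} :
    projMap f hf x ∈ Proj.basicOpen 𝒜 s ↔ x ∈ Proj.basicOpen ℬ (f s) := by
  obtain ⟨i, hi, s', hs', hx⟩ : ∃ (i : ℕ) (_ : 0 < i) (s' : A) (_ : s' ∈ 𝒜 i),
      x ∈ Proj.basicOpen ℬ (f s') :=
    let ⟨s', h⟩ := hf.exists_mem_basicOpen x
    ⟨s'.1, s'.1.pos, s'.2, s'.2.2, h⟩
  rw [← Proj.opensRange_awayι ℬ (f s') (Graded.map_mem f hs') hi] at hx
  obtain ⟨y, rfl⟩ := hx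
  have h1 : projMap f hf (Proj.awayι ℬ (f s') (Graded.map_mem f hs') hi y) =
      Proj.awayι 𝒜 s' hs' hi (Spec.map (CommRingCat.ofHom
        (HomogeneousLocalization.Away.map f s')) y) := by
    rw [← Scheme.Hom.comp_apply, ← Scheme.Hom.comp_apply, awayι_projMap]
  have h2 : Proj.awayι 𝒜 s' hs' hi (Spec.map (CommRingCat.ofHom
        (HomogeneousLocalization.Away.map f s')) y) ∈ Proj.basicOpen 𝒜 s ↔
      Spec.map (CommRingCat.ofHom (HomogeneousLocalization.Away.map f s')) y ∈
        Proj.awayι 𝒜 s' hs' hi ⁻¹ᵁ Proj.basicOpen 𝒜 s := Iff.rfl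
  have h3 : Proj.awayι ℬ (f s') (Graded.map_mem f hs') hi y ∈ Proj.basicOpen ℬ (f s) ↔
      y ∈ Proj.awayι ℬ (f s') (Graded.map_mem f hs') hi ⁻¹ᵁ Proj.basicOpen ℬ (f s) := Iff.rfl
  have h4 : HomogeneousLocalization.Away.map f s'
      (HomogeneousLocalization.Away.isLocalizationElem hs' hs) =
      HomogeneousLocalization.Away.isLocalizationElem (Graded.map_mem f hs')
        (Graded.map_mem f hs) := by
    apply HomogeneousLocalization.val_injective
    simp [HomogeneousLocalization.Away.isLocalizationElem, HomogeneousLocalization.Away.val_mk]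
  rw [h1, h2, h3, Proj.awayι_preimage_basicOpen (g_deg := hs) (hm' := hd),
    Proj.awayι_preimage_basicOpen (g_deg := Graded.map_mem f hs) (hm' := hd), ← h4]
  rfl

lemma _root_.PrimeSpectrum.isUnit_of_basicOpen_eq_top {R : Type*} [CommRing R] {r : R}
    (h : PrimeSpectrum.basicOpen r = ⊤) : IsUnit r := by
  by_contra hr
  obtain ⟨m, hm, hrm⟩ := exists_max_ideal_of_mem_nonunits hr
  have : (⟨m, hm.isPrime⟩ : PrimeSpectrum R) ∈ PrimeSpectrum.basicOpen r := h ▸ trivial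
  exact this hrm

/-- The basic opens of `f s` and `g s` are both the preimage of that of `s` under one morphism.
Hence `g s` is invertible on the chart of `f s`, which means that it divides a power of `f s`. -/
theorem exists_pow_mem_span_of_projMap_eq {f g : 𝒜 →+*ᵍ ℬ} {hf : NoBasePoints f}
    {hg : NoBasePoints g} (h : projMap f hf = projMap g hg) {d : ℕ} (hd : 0 < d) {s : A}
    (hs : s ∈ 𝒜 d) : ∃ N, f s ^ N ∈ Ideal.span {g s} := by
  have h1 : Proj.awayι ℬ (f s) (Graded.map_mem f hs) hd ⁻¹ᵁ Proj.basicOpen ℬ (g s) = ⊤ := by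
    rw [eq_top_iff]
    intro y _
    change Proj.awayι ℬ (f s) (Graded.map_mem f hs) hd y ∈ Proj.basicOpen ℬ (g s)
    rw [← mem_basicOpen_map (hf := hg) hd hs, ← h, mem_basicOpen_map hd hs,
      ← Proj.opensRange_awayι ℬ (f s) (Graded.map_mem f hs) hd]
    exact ⟨y, rfl⟩
  rw [Proj.awayι_preimage_basicOpen (g_deg := Graded.map_mem g hs) (hm' := hd)] at h1
  obtain ⟨b, hb⟩ := (PrimeSpectrum.isUnit_of_basicOpen_eq_top h1).exists_right_inv
  obtain ⟨n, b, hb', rfl⟩ := b.mk_surjective _ (Graded.map_mem f hs)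
  have h2 := congrArg HomogeneousLocalization.val hb
  rw [HomogeneousLocalization.val_mul, HomogeneousLocalization.Away.isLocalizationElem,
    HomogeneousLocalization.Away.val_mk, HomogeneousLocalization.Away.val_mk,
    HomogeneousLocalization.val_one, Localization.mk_mul, ← Localization.mk_one,
    Localization.mk_eq_mk_iff, Localization.r_iff_exists] at h2
  obtain ⟨⟨_, N, rfl⟩, h5⟩ := h2
  simp only [OneMemClass.coe_one, one_mul, Submonoid.coe_mul, mul_one, ← pow_add] at h5
  -- Here `d` comes from the unit `g(s)^d / f(s)^d`, `n` from the denominator of its inverse and `N`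
  -- from equality in the localization.
  refine ⟨N + (d + n), ?_⟩
  rw [← h5, Ideal.mem_span_singleton]
  exact Dvd.dvd.mul_left (Dvd.dvd.mul_right (dvd_pow_self _ hd.ne') _) _

section Comp
variable {C ψ : Type u} [CommRing C] [SetLike ψ C] [AddSubgroupClass ψ C] {𝒞 : ℕ → ψ}
  [GradedRing 𝒞]

theorem projMap_comp (f : 𝒜 →+*ᵍ ℬ) (hf : NoBasePoints f) (g : ℬ →+*ᵍ 𝒞) (hg : NoBasePoints g)
    (hgf : NoBasePoints (g.comp f)) :
    projMap g hg ≫ projMap f hf = projMap (g.comp f) hgf := by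
  have key (i : ℕ) (hi : 0 < i) (s : A) (hs : s ∈ 𝒜 i) :
      Proj.awayι 𝒞 (g (f s)) (Graded.map_mem (g.comp f) hs) hi ≫ projMap g hg ≫ projMap f hf =
      Proj.awayι 𝒞 ((g.comp f) s) (Graded.map_mem (g.comp f) hs) hi ≫ projMap (g.comp f) hgf := by
    rw [awayι_projMap (g.comp f) hgf i hi s hs, ← Category.assoc,
      awayι_projMap g hg i hi (f s) (Graded.map_mem f hs), Category.assoc,
      awayι_projMap f hf i hi s hs, ← Category.assoc, ← Spec.map_comp, ← CommRingCat.ofHom_comp,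
      HomogeneousLocalization.Away.map_comp]
    rfl
  exact (projMapCover (g.comp f) hgf).openCover.hom_ext _ _ fun s ↦ key s.1 s.1.pos s.2 s.2.2
end Comp
end ProjMap
end GradedFamily

namespace GradedFamily
open AlgebraicGeometry CategoryTheory
attribute [local instance] MvPolynomial.weightedGradedAlgebra
open MvPolynomial

/-! ### Ideals extended from a field, tested by linear functionals. -/

section ExtFunctional
variable {F : Type*} [Field F] {τ : Type*} {R S : Type*} [CommRing R] [Algebra F R]
  [CommRing S] [Algebra F S]

/-- The `R`-linear extension to `R[x]` of a linear functional on `F[x]`. -/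
noncomputable def extFunctional (R : Type*) [CommRing R] [Algebra F R]
    (ℓ : MvPolynomial τ F →ₗ[F] F) : MvPolynomial τ R →ₗ[R] R :=
  (basisMonomials τ R).constr R fun d ↦ algebraMap F R (ℓ (monomial d 1))

lemma extFunctional_monomial (ℓ : MvPolynomial τ F →ₗ[F] F) (d : τ →₀ ℕ) (r : R) :
    extFunctional R ℓ (monomial d r) = r * algebraMap F R (ℓ (monomial d 1)) := by
  have : monomial d r = r • basisMonomials τ R d := by
    rw [coe_basisMonomials, smul_monomial, smul_eq_mul, mul_one]
  rw [this, map_smul, extFunctional, Module.Basis.constr_basis, smul_eq_mul]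

lemma extFunctional_map (ℓ : MvPolynomial τ F →ₗ[F] F) (φ : R →ₐ[F] S) (p : MvPolynomial τ R) :
    extFunctional S ℓ (map (φ : R →+* S) p) = φ (extFunctional R ℓ p) := by
  induction p using MvPolynomial.induction_on' with
  | monomial d a => simp [extFunctional_monomial]
  | add p q hp hq => simp only [map_add, hp, hq]

lemma extFunctional_algebraMap (ℓ : MvPolynomial τ F →ₗ[F] F) (p : MvPolynomial τ F) :
    extFunctional R ℓ (map (algebraMap F R) p) = algebraMap F R (ℓ p) := by
  have h := extFunctional_map ℓ (Algebra.ofId F R) p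
  have h2 : extFunctional F ℓ p = ℓ p := by
    induction p using MvPolynomial.induction_on' with
    | monomial d a =>
      rw [extFunctional_monomial, Algebra.algebraMap_self, RingHom.id_apply, ← smul_eq_mul,
        ← map_smul, smul_monomial, smul_eq_mul, mul_one]
    | add p q hp hq =>
      rw [map_add, map_add, hp (extFunctional_map ..), hq (extFunctional_map ..)]
  rw [h2] at h
  exact h

/-- If `ℓ` vanishes on an ideal, so does `ℓ` precomposed with multiplication by `q`. This is how
multiplication by polynomials is absorbed into the functionals below. -/
lemma extFunctional_mul (ℓ : MvPolynomial τ F →ₗ[F] F) (q : MvPolynomial τ F)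
    (p : MvPolynomial τ R) :
    extFunctional R (ℓ ∘ₗ LinearMap.mulLeft F q) p =
      extFunctional R ℓ (map (algebraMap F R) q * p) := by
  induction p using MvPolynomial.induction_on' with
  | monomial d a =>
    have h : (monomial d a : MvPolynomial τ R) = a • map (algebraMap F R) (monomial d 1) := by
      rw [map_monomial, map_one, smul_monomial, smul_eq_mul, mul_one]
    rw [h, mul_smul_comm, ← _root_.map_mul, map_smul, map_smul, extFunctional_algebraMap,
      extFunctional_algebraMap]
    rfl
  | add p q hp hq => rw [map_add, mul_add, map_add, hp, hq]

lemma extFunctional_sum {ι : Type*} (s : Finset ι) (ℓ : ι → MvPolynomial τ F →ₗ[F] F) :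
    extFunctional R (∑ i ∈ s, ℓ i) = ∑ i ∈ s, extFunctional R (ℓ i) := by
  refine (basisMonomials τ R).ext fun d ↦ ?_
  simp [extFunctional_monomial]

/-- The ideal `J R[x]` of `R[x]` is cut out by the functionals that vanish on `J`. -/
theorem mem_map_iff_extFunctional (J : Ideal (MvPolynomial τ F)) (p : MvPolynomial τ R) :
    p ∈ J.map (map (algebraMap F R)) ↔
      ∀ ℓ : MvPolynomial τ F →ₗ[F] F, (∀ q ∈ J, ℓ q = 0) → extFunctional R ℓ p = 0 := by
  constructor
  · intro hp ℓ hℓ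
    induction hp using Submodule.span_induction generalizing ℓ with
    | mem x h =>
      obtain ⟨q, hq, rfl⟩ := h
      rw [extFunctional_algebraMap, hℓ q hq, map_zero]
    | zero => exact map_zero _
    | add x y _ _ hx hy => rw [map_add, hx ℓ hℓ, hy ℓ hℓ, add_zero]
    | smul a x _ hx =>
      rw [smul_eq_mul]
      induction a using MvPolynomial.induction_on' with
      | monomial d r =>
        have h : (monomial d r : MvPolynomial τ R) = r • map (algebraMap F R) (monomial d 1) := by
          rw [map_monomial, map_one, smul_monomial, smul_eq_mul, mul_one]
        rw [h, smul_mul_assoc, map_smul, ← extFunctional_mul, hx, smul_zero]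
        exact fun q hq ↦ hℓ _ (J.mul_mem_left _ hq)
      | add p q hp hq => rw [add_mul, map_add, hp, hq, add_zero]
  · intro h
    let W : Submodule F (MvPolynomial τ F) := J.restrictScalars F
    -- A linear section `s` of `F[x] → F[x] / J`: each polynomial is `s` of its class plus an
    -- element of `J`, and the coefficients of `s` of the class are functionals that vanish on `J`.
    obtain ⟨s, hs⟩ := W.mkQ.exists_rightInverse_of_surjective (Submodule.range_mkQ _)
    have hT (q : MvPolynomial τ F) : q - s (W.mkQ q) ∈ J := by
      have : W.mkQ (q - s (W.mkQ q)) = 0 := by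
        rw [map_sub, ← LinearMap.comp_apply, hs, LinearMap.id_apply, sub_self]
      rwa [Submodule.mkQ_apply, Submodule.Quotient.mk_eq_zero] at this
    have h0 : ∑ d ∈ p.support, p.coeff d • map (algebraMap F R) (s (W.mkQ (monomial d 1))) = 0 := by
      ext e
      have h1 := h (lcoeff F e ∘ₗ s ∘ₗ W.mkQ) fun q hq ↦ by
        have : W.mkQ q = 0 := (Submodule.Quotient.mk_eq_zero W).mpr hq
        simp only [LinearMap.comp_apply, this, map_zero]
      conv_lhs at h1 => rw [p.as_sum, map_sum]
      simp only [extFunctional_monomial] at h1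
      rw [coeff_sum, coeff_zero, ← h1]
      refine Finset.sum_congr rfl fun d _ ↦ ?_
      rw [coeff_smul, coeff_map, smul_eq_mul]
      rfl
    have h2 : p = ∑ d ∈ p.support, p.coeff d •
        map (algebraMap F R) (monomial d 1 - s (W.mkQ (monomial d 1))) := by
      simp only [map_sub, smul_sub, Finset.sum_sub_distrib, h0, sub_zero]
      conv_lhs => rw [p.as_sum]
      simp [map_monomial, smul_monomial]
    rw [h2]
    refine Ideal.sum_mem _ fun d _ ↦ ?_
    rw [smul_eq_C_mul]
    exact Ideal.mul_mem_left _ _ (Ideal.mem_map_of_mem _ (hT _))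

end ExtFunctional

/-! ### Saturation with respect to the variables. -/

section Saturation
variable {F : Type*} [Field F] {n : ℕ} {R : Type*} [CommRing R] [Algebra F R]

/-- The saturation of an ideal of `R[x]` with respect to the irrelevant ideal. -/
def satIdeal {R : Type*} [CommRing R] (J : Ideal (MvPolynomial (Fin n) R)) :
    Ideal (MvPolynomial (Fin n) R) where
  carrier := {q | ∃ N, ∀ i, X i ^ N * q ∈ J}
  zero_mem' := ⟨0, fun i ↦ by simp⟩
  add_mem' := by
    rintro p q ⟨N, hN⟩ ⟨N', hN'⟩
    refine ⟨N + N', fun i ↦ ?_⟩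
    rw [mul_add]
    refine J.add_mem ?_ ?_
    · rw [add_comm, pow_add, mul_assoc]; exact J.mul_mem_left _ (hN i)
    · rw [pow_add, mul_assoc]; exact J.mul_mem_left _ (hN' i)
  smul_mem' := by
    rintro c q ⟨N, hN⟩
    refine ⟨N, fun i ↦ ?_⟩
    rw [smul_eq_mul, mul_left_comm]
    exact J.mul_mem_left _ (hN i)

lemma le_satIdeal {R : Type*} [CommRing R] (J : Ideal (MvPolynomial (Fin n) R)) : J ≤ satIdeal J :=
  fun _ h ↦ ⟨0, fun _ ↦ J.mul_mem_left _ h⟩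

/-- Saturation commutes with the (flat) base change from a field. -/
theorem map_satIdeal (J : Ideal (MvPolynomial (Fin n) F)) :
    (satIdeal J).map (map (algebraMap F R)) = satIdeal (J.map (map (algebraMap F R))) := by
  apply le_antisymm
  · rw [Ideal.map_le_iff_le_comap]
    rintro q ⟨N, hN⟩
    refine ⟨N, fun i ↦ ?_⟩
    have := Ideal.mem_map_of_mem (map (algebraMap F R)) (hN i)
    rwa [_root_.map_mul, map_pow, map_X] at this
  · rintro z ⟨N, hN⟩
    rw [mem_map_iff_extFunctional]
    intro ℓ hℓ
    let W : Submodule F (MvPolynomial (Fin n) F) := J.restrictScalars F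
    -- The kernel of `Φ` consists of the `q` with all `X i ^ N * q` in `J`, hence lies in the
    -- saturation. A functional vanishing on it factors through `Φ`, so it is a sum of functionals
    -- `q ↦ ℓ_i (X i ^ N * q)` with `ℓ_i` zero on `J`, and each of these kills `z`.
    let Φ : MvPolynomial (Fin n) F →ₗ[F] (Fin n → MvPolynomial (Fin n) F ⧸ W) :=
      LinearMap.pi fun i ↦ W.mkQ ∘ₗ LinearMap.mulLeft F (X i ^ N)
    have hker : ℓ ∈ (LinearMap.ker Φ).dualAnnihilator := by
      rw [Submodule.mem_dualAnnihilator]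
      intro q hq
      refine hℓ q ⟨N, fun i ↦ ?_⟩
      have : W.mkQ (X i ^ N * q) = 0 := congrFun hq i
      rwa [Submodule.mkQ_apply, Submodule.Quotient.mk_eq_zero] at this
    rw [← LinearMap.range_dualMap_eq_dualAnnihilator_ker] at hker
    obtain ⟨ℓ', rfl⟩ := hker
    have hsum : Φ.dualMap ℓ' = ∑ i, (ℓ' ∘ₗ LinearMap.single F _ i ∘ₗ W.mkQ) ∘ₗ
        LinearMap.mulLeft F (X i ^ N) := by
      refine LinearMap.ext fun q ↦ ?_
      rw [LinearMap.dualMap_apply, LinearMap.sum_apply]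
      conv_lhs => rw [← Finset.univ_sum_single (Φ q), map_sum]
      rfl
    rw [hsum, extFunctional_sum, LinearMap.sum_apply]
    refine Finset.sum_eq_zero fun i _ ↦ ?_
    rw [extFunctional_mul, map_pow, map_X]
    refine (mem_map_iff_extFunctional J _).mp (hN i) _ fun q hq ↦ ?_
    have : W.mkQ q = 0 := (Submodule.Quotient.mk_eq_zero W).mpr hq
    simp only [LinearMap.comp_apply, this, map_zero]

/-- The multipliers that bring `z` into the saturation form an ideal. Its radical contains `J` and
all `c j`, hence all variables, and a saturated ideal absorbs powers of the variables. -/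
lemma mem_satIdeal_of_pow_mul_mem {R : Type*} [CommRing R] {J : Ideal (MvPolynomial (Fin n) R)}
    {ι : Type*} {c : ι → MvPolynomial (Fin n) R}
    (hc : ∀ i, X i ∈ (Ideal.span (Set.range c) ⊔ J).radical) {z : MvPolynomial (Fin n) R}
    (hz : ∀ j, ∃ N, c j ^ N * z ∈ satIdeal J) : z ∈ satIdeal J := by
  let 𝔞 : Ideal (MvPolynomial (Fin n) R) := 
    Submodule.comap (LinearMap.mulRight (MvPolynomial (Fin n) R) z) (satIdeal J)
  have h𝔞 : ∀ x, x ∈ 𝔞 ↔ x * z ∈ satIdeal J := fun x ↦ Iff.rfl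
  have h1 : Ideal.span (Set.range c) ⊔ J ≤ 𝔞.radical := by
    refine sup_le (Ideal.span_le.mpr ?_) ?_
    · rintro _ ⟨j, rfl⟩
      obtain ⟨N, hN⟩ := hz j
      exact ⟨N, hN⟩
    · intro x hx
      exact Ideal.le_radical ((h𝔞 x).mpr (Ideal.mul_mem_right _ _ (le_satIdeal J hx)))
  have h2 (i) : ∃ N, X i ^ N * z ∈ satIdeal J := by
    have := Ideal.radical_mono h1 (hc i)
    rw [Ideal.radical_idem] at this
    exact this
  choose N hN using h2
  choose N' hN' using hN
  -- One exponent for all variables; only the `i`-th summand is needed for `X i`.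
  refine ⟨∑ i, (N i + N' i), fun i ↦ ?_⟩
  rw [← Finset.add_sum_erase _ _ (Finset.mem_univ i), add_comm, pow_add, mul_assoc]
  refine J.mul_mem_left _ ?_
  rw [add_comm, pow_add, mul_assoc]
  exact hN' i i

end Saturation
end GradedFamily

namespace GradedFamily
open AlgebraicGeometry CategoryTheory
attribute [local instance] MvPolynomial.weightedGradedAlgebra
open MvPolynomial

/-! ### Equality of projectivizations as proportionality modulo the saturation. -/

section Criterion
variable {F : Type u} [Field F] {n m : ℕ} {w : Fin n → ℕ} {v : Fin m → ℕ}

lemma mem_span_X_of_isWeightedHomogeneous {R : Type*} [CommRing R] {p : MvPolynomial (Fin n) R}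
    {d : ℕ} (hp : IsWeightedHomogeneous w p d) (hd : d ≠ 0) :
    p ∈ Ideal.span (Set.range (X : Fin n → MvPolynomial (Fin n) R)) := by
  rw [p.as_sum]
  refine Ideal.sum_mem _ fun e he ↦ ?_
  have he' : e ≠ 0 := by
    rintro rfl
    exact hd ((hp (mem_support_iff.mp he)).symm.trans (map_zero _))
  obtain ⟨i, hi⟩ := Finsupp.ne_iff.mp he'
  have : (X i : MvPolynomial (Fin n) R) ∣ monomial e (coeff e p) :=
    X_dvd_monomial.mpr (Or.inr hi)
  exact Ideal.mem_of_dvd _ this (Ideal.subset_span ⟨i, rfl⟩)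

lemma exists_pow_mul_mem_of_mem_satIdeal {R : Type*} [CommRing R]
    {J : Ideal (MvPolynomial (Fin n) R)} {z q : MvPolynomial (Fin n) R} (hz : z ∈ satIdeal J)
    (hq : q ∈ Ideal.span (Set.range (X : Fin n → MvPolynomial (Fin n) R))) :
    ∃ N, q ^ N * z ∈ J := by
  let 𝔞 : Ideal (MvPolynomial (Fin n) R) :=
    Submodule.comap (LinearMap.mulRight (MvPolynomial (Fin n) R) z) J
  have h : Ideal.span (Set.range (X : Fin n → MvPolynomial (Fin n) R)) ≤ 𝔞.radical := by
    rw [Ideal.span_le]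
    rintro _ ⟨i, rfl⟩
    obtain ⟨N, hN⟩ := hz
    exact ⟨N, hN i⟩
  exact h hq

/-- Two linear maps `R[y] → R[x]` are parallel modulo an ideal of `R[x]` if they are proportional
on the forms whose degree is a given multiple of `M`. -/
def Parallel {R : Type*} [CommRing R] (J : Ideal (MvPolynomial (Fin n) R)) (v : Fin m → ℕ) (M : ℕ)
    (P Q : MvPolynomial (Fin m) R →ₗ[R] MvPolynomial (Fin n) R) : Prop :=
  ∀ e s s', IsWeightedHomogeneous v s (e * M) → IsWeightedHomogeneous v s' (e * M) →
    P s * Q s' - P s' * Q s ∈ J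

namespace GradedMorphism
variable {JX : GradedIdeal F w} {JY : GradedIdeal F v} {R : Type*} [CommRing R] [Algebra F R]

lemma exists_lift (φ : GradedMorphism JX JY R) : ∃ c : Fin m → MvPolynomial (Fin n) R,
    (∀ j, IsWeightedHomogeneous w (c j) (v j)) ∧
    ∀ j, Ideal.Quotient.mk (extIdeal JX R) (c j) = φ.hom (Ideal.Quotient.mk _ (X j)) := by
  have h (j) : φ.hom (Ideal.Quotient.mk _ (X j)) ∈ grading JX R (v j) :=
    φ.hom.map_mem (mk_mem_grading JY R (isWeightedHomogeneous_X R v j))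
  choose c hc using h
  exact ⟨c, fun j ↦ (hc j).1, fun j ↦ (hc j).2⟩

lemma mk_aeval_lift (φ : grading JY R →ₐᵍ[R] grading JX R) {c : Fin m → MvPolynomial (Fin n) R}
    (hc : ∀ j, Ideal.Quotient.mk (extIdeal JX R) (c j) = φ (Ideal.Quotient.mk _ (X j)))
    (s : MvPolynomial (Fin m) R) :
    Ideal.Quotient.mk (extIdeal JX R) (aeval c s) = φ (Ideal.Quotient.mk _ s) := by
  have : (Ideal.Quotient.mkₐ R (extIdeal JX R)).comp (aeval c) =
      φ.toAlgHom.comp (Ideal.Quotient.mkₐ R (extIdeal JY R)) :=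
    MvPolynomial.algHom_ext fun j ↦ by simpa using hc j
  exact DFunLike.congr_fun this s

/-- Absence of base points, restated for polynomials: a form of positive degree in `y` becomes,
after substitution, an element of the ideal of the components `c`, so some power of each `X i` lies
in that ideal modulo `J_X`. -/
lemma X_mem_radical (hw : ∀ i, 0 < w i) (φ : GradedMorphism JX JY R)
    {c : Fin m → MvPolynomial (Fin n) R}
    (hc : ∀ j, Ideal.Quotient.mk (extIdeal JX R) (c j) = φ.hom (Ideal.Quotient.mk _ (X j)))
    (i : Fin n) : X i ∈ (Ideal.span (Set.range c) ⊔ extIdeal JX R).radical := by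
  have h1 : Ideal.Quotient.mk (extIdeal JX R) (X i) ∈
      (HomogeneousIdeal.irrelevant (grading JX R)).toIdeal :=
    mem_irrelevant_of_mem JX (hw i) (mk_mem_grading JX R (isWeightedHomogeneous_X R w i))
  have h2 : (HomogeneousIdeal.irrelevant (grading JY R)).toIdeal.map
      (φ.hom.toGradedRingHom : CoordRing JY R →+* CoordRing JX R) ≤
      (Ideal.span (Set.range c)).map (Ideal.Quotient.mk (extIdeal JX R)) := by
    rw [Ideal.map_le_iff_le_comap]
    refine irrelevant_le JY fun d hd x hx ↦ ?_
    obtain ⟨p, hp, rfl⟩ := hx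
    rw [Ideal.mem_comap]
    have h3 : (φ.hom.toGradedRingHom : CoordRing JY R →+* CoordRing JX R)
      ((Ideal.Quotient.mkₐ R (extIdeal JY R)).toLinearMap p) =
      Ideal.Quotient.mk (extIdeal JX R) (aeval c p) := (mk_aeval_lift φ.hom hc p).symm
    rw [h3]
    refine Ideal.mem_map_of_mem _ ?_
    have h4 := Ideal.mem_map_of_mem (aeval c : MvPolynomial (Fin m) R →ₐ[R] _)
      (mem_span_X_of_isWeightedHomogeneous hp hd.ne')
    rw [Ideal.map_span, ← Set.range_comp] at h4
    convert h4 using 3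
    ext j
    simp
  obtain ⟨N, hN⟩ := φ.noBasePoints h1
  refine ⟨N, ?_⟩
  have h5 := h2 hN
  rw [← map_pow, ← Ideal.mem_comap, Ideal.comap_map_of_surjective' _ Ideal.Quotient.mk_surjective,
    Ideal.mk_ker] at h5
  exact h5

variable {φ ψ : GradedMorphism JX JY R} {c c' : Fin m → MvPolynomial (Fin n) R}

/-- The reason for working in degrees divisible by `∏ v`: every variable has a power of exactly that
degree, and these powers have no common zero. -/
lemma isWeightedHomogeneous_X_pow_div (j : Fin m) :
    IsWeightedHomogeneous v (X j ^ ((∏ i, v i) / v j) : MvPolynomial (Fin m) R) (∏ i, v i) := by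
  have h := (isWeightedHomogeneous_X R v j).pow ((∏ i, v i) / v j)
  rwa [smul_eq_mul, Nat.div_mul_cancel (Finset.dvd_prod_of_mem _ (Finset.mem_univ j))] at h

lemma isWeightedHomogeneous_aeval {R : Type*} [CommRing R] {c : Fin m → MvPolynomial (Fin n) R}
    (hc : ∀ j, IsWeightedHomogeneous w (c j) (v j)) {s : MvPolynomial (Fin m) R} {d : ℕ}
    (hs : IsWeightedHomogeneous v s d) : IsWeightedHomogeneous w (aeval c s) d := by
  rw [← mem_weightedHomogeneousSubmodule, s.as_sum, map_sum]
  refine Submodule.sum_mem _ fun e he ↦ ?_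
  rw [aeval_monomial, ← hs (mem_support_iff.mp he)]
  change IsWeightedHomogeneous w _ _
  rw [← zero_add (Finsupp.weight v e)]
  refine IsWeightedHomogeneous.mul (isWeightedHomogeneous_C w _) ?_
  rw [Finsupp.weight_apply]
  exact IsWeightedHomogeneous.prod _ _ _ fun j _ ↦ (hc j).pow _

/-- The criterion `projMap_eq_projMap` is applied to the powers `s j` of the variables.
Proportionality of `a` and `s j ^ e` gives the identity on each chart, because an element of the
saturation is killed by powers of forms of positive degree. -/
theorem proj_eq_of_parallel (hw : ∀ i, 0 < w i) (hv : ∀ j, 0 < v j)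
    (hc1 : ∀ j, IsWeightedHomogeneous w (c j) (v j))
    (hc : ∀ j, Ideal.Quotient.mk (extIdeal JX R) (c j) = φ.hom (Ideal.Quotient.mk _ (X j)))
    (hc' : ∀ j, Ideal.Quotient.mk (extIdeal JX R) (c' j) = ψ.hom (Ideal.Quotient.mk _ (X j)))
    (h : Parallel (satIdeal (extIdeal JX R)) v (∏ j, v j) (aeval c).toLinearMap
      (aeval c').toLinearMap) : φ.proj = ψ.proj := by
  have hM : 0 < ∏ j, v j := Finset.prod_pos fun i _ ↦ hv i
  have hvan (φ : GradedMorphism JX JY R) {c : Fin m → MvPolynomial (Fin n) R}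
      (hc : ∀ j, Ideal.Quotient.mk (extIdeal JX R) (c j) = φ.hom (Ideal.Quotient.mk _ (X j)))
      (x : Proj (grading JX R)) :
      ∃ j, Ideal.Quotient.mk (extIdeal JX R) (c j) ∉ x.asHomogeneousIdeal.toIdeal := by
    by_contra! H
    have := x.isPrime
    refine x.not_irrelevant_le (irrelevant_le JX fun d hd y hy ↦ ?_)
    obtain ⟨p, hp, rfl⟩ := hy
    have h1 : Ideal.span (Set.range (X : Fin n → MvPolynomial (Fin n) R)) ≤
        x.asHomogeneousIdeal.toIdeal.comap (Ideal.Quotient.mk (extIdeal JX R)) := by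
      rw [Ideal.span_le]
      rintro _ ⟨i, rfl⟩
      have h2 : (Ideal.span (Set.range c) ⊔ extIdeal JX R).radical ≤
          x.asHomogeneousIdeal.toIdeal.comap (Ideal.Quotient.mk (extIdeal JX R)) := by
        rw [(Ideal.comap_isPrime _ _).isRadical.radical_le_iff]
        refine sup_le (Ideal.span_le.mpr ?_) ?_
        · rintro _ ⟨j, rfl⟩
          exact H j
        · intro z hz
          rw [Ideal.mem_comap, Ideal.Quotient.eq_zero_iff_mem.mpr hz]
          exact Ideal.zero_mem _
      exact h2 (φ.X_mem_radical hw hc i)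
    exact h1 (mem_span_X_of_isWeightedHomogeneous hp hd.ne')
  have hX (x : Proj (grading JX R)) :
      ∃ i, Ideal.Quotient.mk (extIdeal JX R) (X i) ∉ x.asHomogeneousIdeal.toIdeal := by
    by_contra! H
    refine x.not_irrelevant_le (irrelevant_le JX fun d hd y hy ↦ ?_)
    obtain ⟨p, hp, rfl⟩ := hy
    have h1 : Ideal.span (Set.range (X : Fin n → MvPolynomial (Fin n) R)) ≤
        x.asHomogeneousIdeal.toIdeal.comap (Ideal.Quotient.mk (extIdeal JX R)) := by
      rw [Ideal.span_le]
      rintro _ ⟨i, rfl⟩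
      exact H i
    exact h1 (mem_span_X_of_isWeightedHomogeneous hp hd.ne')
  let s (j : Fin m) : MvPolynomial (Fin m) R := X j ^ ((∏ i, v i) / v j)
  have hs (j) : IsWeightedHomogeneous v (s j) (1 * ∏ i, v i) := by
    rw [one_mul]
    exact isWeightedHomogeneous_X_pow_div j
  have e1 (p) : φ.hom.toGradedRingHom (Ideal.Quotient.mk _ p) =
    Ideal.Quotient.mk (extIdeal JX R) (aeval c p) := (mk_aeval_lift φ.hom hc p).symm
  have e2 (p) : ψ.hom.toGradedRingHom (Ideal.Quotient.mk _ p) =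
    Ideal.Quotient.mk (extIdeal JX R) (aeval c' p) := (mk_aeval_lift ψ.hom hc' p).symm
  refine projMap_eq_projMap φ.noBasePoints ψ.noBasePoints (∏ j, v j) hM
    (fun j ↦ Ideal.Quotient.mk (extIdeal JY R) (s j))
    (fun j ↦ mk_mem_grading JY R (isWeightedHomogeneous_X_pow_div j)) ?_ ?_
  · intro x
    obtain ⟨j, hj⟩ := hvan φ hc x
    obtain ⟨j', hj'⟩ := hvan ψ hc' x
    obtain ⟨i, hi⟩ := hX x
    have hp := x.isPrime
    -- At the point `x`, `c` does not vanish on `s j` and `c'` does not vanish on `s j'`. By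
    -- proportionality the product of these values equals that of the two crossed values, so `c'`
    -- does not vanish on `s j` either: a single index serves both maps.
    obtain ⟨N, hN⟩ := h 1 (s j) (s j') (hs j) (hs j')
    have h1 : Ideal.Quotient.mk (extIdeal JX R) (X i) ^ N *
        Ideal.Quotient.mk (extIdeal JX R) (aeval c (s j) * aeval c' (s j') -
          aeval c (s j') * aeval c' (s j)) ∈ x.asHomogeneousIdeal.toIdeal := by
      rw [← map_pow, ← _root_.map_mul]
      have := Ideal.Quotient.eq_zero_iff_mem.mpr (hN i)
      refine (congrArg (· ∈ x.asHomogeneousIdeal.toIdeal) this).mpr (Ideal.zero_mem _)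
    have h2 := (hp.mem_or_mem h1).resolve_left fun h ↦ hi (hp.mem_of_pow_mem _ h)
    refine ⟨j, ?_⟩
    rw [Proj.mem_basicOpen, e1, e2]
    have h3 (c : Fin m → MvPolynomial (Fin n) R) (j) :
      Ideal.Quotient.mk (extIdeal JX R) (aeval c (s j)) =
        Ideal.Quotient.mk (extIdeal JX R) (c j) ^ ((∏ i, v i) / v j) := by simp [s]
    have h4 : Ideal.Quotient.mk (extIdeal JX R) (aeval c (s j)) ∉
        x.asHomogeneousIdeal.toIdeal := by
      rw [h3]; exact fun h ↦ hj (hp.mem_of_pow_mem _ h)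
    have h5 : Ideal.Quotient.mk (extIdeal JX R) (aeval c' (s j')) ∉
        x.asHomogeneousIdeal.toIdeal := by
      rw [h3]; exact fun h ↦ hj' (hp.mem_of_pow_mem _ h)
    intro h6
    have h7 := (hp.mem_or_mem h6).resolve_left h4
    rw [map_sub, _root_.map_mul, _root_.map_mul] at h2
    have h8 := Ideal.add_mem _ h2 (Ideal.mul_mem_left _
      (Ideal.Quotient.mk (extIdeal JX R) (aeval c (s j'))) h7)
    rw [sub_add_cancel] at h8
    exact (hp.mem_or_mem h8).elim h4 h5
  · intro j e a ha
    obtain ⟨p, hp, rfl⟩ := ha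
    have h1 := h e p (s j ^ e) hp ((isWeightedHomogeneous_X_pow_div j).pow e)
    have h2 : aeval c (s j) * aeval c' (s j) ∈
        Ideal.span (Set.range (X : Fin n → MvPolynomial (Fin n) R)) :=
      Ideal.mul_mem_right _ _ (mem_span_X_of_isWeightedHomogeneous
        (isWeightedHomogeneous_aeval hc1 (isWeightedHomogeneous_X_pow_div j)) hM.ne')
    obtain ⟨N, hN⟩ := exists_pow_mul_mem_of_mem_satIdeal h1 h2
    refine ⟨N, ?_⟩
    change _ * (φ.hom.toGradedRingHom (Ideal.Quotient.mk _ p) * _ -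
      ψ.hom.toGradedRingHom (Ideal.Quotient.mk _ p) * _) = _
    rw [e1, e2, e1, e2, ← Ideal.Quotient.eq_zero_iff_mem.mpr hN]
    simp only [_root_.map_mul, map_sub, map_pow, AlgHom.toLinearMap_apply]
    ring

/-- Dividing by a power of `y_j` shows that the two maps are proportional wherever both values of
that power are invertible. By equality of the preimages of basic opens this is the locus where `c j`
is invertible, and without base points such loci suffice for membership in the saturation. -/
theorem parallel_of_proj_eq (hw : ∀ i, 0 < w i) (hv : ∀ j, 0 < v j)
    (hc : ∀ j, Ideal.Quotient.mk (extIdeal JX R) (c j) = φ.hom (Ideal.Quotient.mk _ (X j)))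
    (hc' : ∀ j, Ideal.Quotient.mk (extIdeal JX R) (c' j) = ψ.hom (Ideal.Quotient.mk _ (X j)))
    (h : φ.proj = ψ.proj) :
    Parallel (satIdeal (extIdeal JX R)) v (∏ j, v j) (aeval c).toLinearMap
      (aeval c').toLinearMap := by
  have hM : 0 < ∏ j, v j := Finset.prod_pos fun i _ ↦ hv i
  intro e a b ha hb
  have e1 (p) : φ.hom.toGradedRingHom (Ideal.Quotient.mk _ p) =
    Ideal.Quotient.mk (extIdeal JX R) (aeval c p) := (mk_aeval_lift φ.hom hc p).symm
  have e2 (p) : ψ.hom.toGradedRingHom (Ideal.Quotient.mk _ p) =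
    Ideal.Quotient.mk (extIdeal JX R) (aeval c' p) := (mk_aeval_lift ψ.hom hc' p).symm
  refine mem_satIdeal_of_pow_mul_mem (φ.X_mem_radical hw hc) fun j ↦ ?_
  have hs := mk_mem_grading JY R (isWeightedHomogeneous_X_pow_div (R := R) j)
  obtain ⟨N₁, h₁⟩ := exists_pow_mul_eq_zero_of_projMap_eq h hM hs e
    (a := Ideal.Quotient.mk _ a) (mk_mem_grading JY R ha)
  obtain ⟨N₂, h₂⟩ := exists_pow_mul_eq_zero_of_projMap_eq h hM hs e
    (a := Ideal.Quotient.mk _ b) (mk_mem_grading JY R hb)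
  obtain ⟨N₃, h₃⟩ := exists_pow_mem_span_of_projMap_eq h hM hs
  rw [e1, e2, Ideal.mem_span_singleton] at h₃
  rw [e1, e2, e1, e2] at h₁ h₂
  obtain ⟨t, ht⟩ := h₃
  have hcs : aeval c ((X j : MvPolynomial (Fin m) R) ^ ((∏ i, v i) / v j)) =
      c j ^ ((∏ i, v i) / v j) := by rw [map_pow, aeval_X]
  set σ := Ideal.Quotient.mk (extIdeal JX R) (aeval c ((X j : MvPolynomial (Fin m) R) ^ ((∏ i, v i) / v j))) with hσ
  set σ' := Ideal.Quotient.mk (extIdeal JX R) (aeval c' ((X j : MvPolynomial (Fin m) R) ^ ((∏ i, v i) / v j)))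
  set α := Ideal.Quotient.mk (extIdeal JX R) (aeval c a) with hα
  set α' := Ideal.Quotient.mk (extIdeal JX R) (aeval c' a) with hα'
  set β := Ideal.Quotient.mk (extIdeal JX R) (aeval c b) with hβ
  set β' := Ideal.Quotient.mk (extIdeal JX R) (aeval c' b) with hβ'
  -- Eliminates `σ ^ e` between `α σ'^e = α' σ^e` and `β σ'^e = β' σ^e`, each valid up to a power of
  -- `σ σ'`.
  have key : (σ * σ') ^ (N₁ + N₂ + e) * (α * β' - β * α') = 0 := by
    rw [pow_add, pow_add, mul_pow _ _ e]
    linear_combination ((σ * σ') ^ N₂ * σ ^ e * β') * h₁ - ((σ * σ') ^ N₁ * σ ^ e * α') * h₂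
  -- Since `σ'` divides `σ ^ N₃`, the product `σ σ'` divides `σ ^ (N₃ + 1)`, and the annihilator can
  -- be taken to be a power of `σ` alone, thus of `c j`.
  have key2 : (σ ^ (N₃ + 1)) ^ (N₁ + N₂ + e) * (α * β' - β * α') = 0 := by
    rw [pow_succ, ht, mul_right_comm, mul_comm σ' σ, mul_pow, mul_right_comm, key, zero_mul]
  refine ⟨(∏ i, v i) / v j * ((N₃ + 1) * (N₁ + N₂ + e)), le_satIdeal _ ?_⟩
  rw [← Ideal.Quotient.eq_zero_iff_mem, ← key2, hσ, hcs]
  simp only [_root_.map_mul, map_sub, map_pow, AlgHom.toLinearMap_apply, ← pow_mul, mul_assoc, hα,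
    hα', hβ, hβ']

end GradedMorphism
end Criterion
end GradedFamily

namespace GradedFamily
open MvPolynomial

/-! ### Solving a system whose solutions can be moved in all tangent directions. -/

section Lifting
variable {F k : Type*} [Field F] [CommRing k] [Algebra F k]

/-- The differential at the point `p` of the reduction along `o` of a polynomial. -/
noncomputable def differentialAt (o : k →ₐ[F] F) {σ : Type*} (p : σ → F) (P : MvPolynomial σ k) :
    σ → F := fun j ↦ eval p (map (o : k →+* F) (pderiv j P))

/-- Square systems of polynomial equations over `k` with a solution along `o` at which the
Jacobian is invertible are solvable in `k`. -/
def HasImplicitSolutions (o : k →ₐ[F] F) : Prop :=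
  ∀ (N : ℕ) (Q : Fin N → MvPolynomial (Fin N) k) (p : Fin N → F),
    (∀ i, eval p (map (o : k →+* F) (Q i)) = 0) →
    LinearIndependent F (fun i ↦ differentialAt o p (Q i)) →
    ∃ z : Fin N → k, (∀ j, o (z j) = p j) ∧ ∀ i, eval z (Q i) = 0

variable {σ : Type*} [Fintype σ]

lemma HasImplicitSolutions.exists_solution {o : k →ₐ[F] F} (h : HasImplicitSolutions o)
    (Q : σ → MvPolynomial σ k) (p : σ → F) (hp : ∀ i, eval p (map (o : k →+* F) (Q i)) = 0)
    (hQ : LinearIndependent F (fun i ↦ differentialAt o p (Q i))) :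
    ∃ z : σ → k, (∀ j, o (z j) = p j) ∧ ∀ i, eval z (Q i) = 0 := by
  classical
  let e := Fintype.equivFin σ
  have hd (i) : differentialAt o (p ∘ e.symm) (rename e (Q i)) =
      LinearMap.funLeft F F e.symm (differentialAt o p (Q i)) := by
    funext j
    obtain ⟨j, rfl⟩ := e.surjective j
    simp only [differentialAt, LinearMap.funLeft_apply, Equiv.symm_apply_apply]
    rw [pderiv_rename e.injective, map_rename, eval_rename, Function.comp_assoc, e.symm_comp_self,
      Function.comp_id]
  obtain ⟨z, hz, hz'⟩ := h (Fintype.card σ) (fun i ↦ rename e (Q (e.symm i))) (p ∘ e.symm)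
    (fun i ↦ by
      rw [map_rename, eval_rename, Function.comp_assoc, e.symm_comp_self, Function.comp_id]
      exact hp _) (by
      simp only [hd]
      refine LinearIndependent.map' (hQ.comp e.symm e.symm.injective) (LinearMap.funLeft F F e.symm)
        (LinearMap.ker_eq_bot.mpr (LinearMap.funLeft_injective_of_surjective _ _ _
          e.symm.surjective)))
  refine ⟨z ∘ e, fun j ↦ by simp [hz], fun i ↦ ?_⟩
  have := hz' (e i)
  rwa [e.symm_apply_apply, eval_rename] at this

variable {R : Type*} [CommRing R] [Algebra F R]

/-- Taylor expansion of order zero: modulo `𝔫` both the coefficients and the argument reduce to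
their values in `F`. -/
lemma eval₂_sub_algebraMap_mem {σ : Type*} {o : k →ₐ[F] F} {ψ : k →ₐ[F] R} {𝔫 : Ideal R}
    (hψ : ∀ x, o x = 0 → ψ x ∈ 𝔫) {p : σ → F} {h : σ → R}
    (hh : ∀ j, h j - algebraMap F R (p j) ∈ 𝔫) (P : MvPolynomial σ k) :
    eval₂ (ψ : k →+* R) h P - algebraMap F R (eval p (map (o : k →+* F) P)) ∈ 𝔫 := by
  induction P using MvPolynomial.induction_on with
  | C a =>
    have := hψ (a - algebraMap F k (o a)) (by simp)
    simpa using this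
  | add P Q hP hQ =>
    have := 𝔫.add_mem hP hQ
    convert this using 1
    simp only [eval₂_add, map_add]
    ring
  | mul_X P i hP =>
    have := 𝔫.add_mem (𝔫.mul_mem_right (h i) hP)
      (𝔫.mul_mem_left (algebraMap F R (eval p (map (o : k →+* F) P))) (hh i))
    convert this using 1
    simp only [eval₂_mul, eval₂_X, _root_.map_mul, map_X, eval_X]
    ring

lemma map_eval_eq_eval₂ {σ : Type*} (ψ : k →+* R) (z : σ → k) (P : MvPolynomial σ k) :
    ψ (eval z P) = eval₂ ψ (fun j ↦ ψ (z j)) P := by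
  induction P using MvPolynomial.induction_on with
  | C a => simp
  | add P Q hP hQ => simp [hP, hQ]
  | mul_X P i hP => simp [hP]

/-- First order Taylor expansion. -/
lemma taylor_mem_mul {o : k →ₐ[F] F} {ψ : k →ₐ[F] R} {𝔮 𝔫 : Ideal R}
    (hψ : ∀ x, o x = 0 → ψ x ∈ 𝔫) {p : σ → F} {h z : σ → R}
    (hh : ∀ j, h j - algebraMap F R (p j) ∈ 𝔫) (hz : ∀ j, z j - algebraMap F R (p j) ∈ 𝔫)
    (hzh : ∀ j, z j - h j ∈ 𝔮) (P : MvPolynomial σ k) :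
    eval₂ (ψ : k →+* R) z P - eval₂ (ψ : k →+* R) h P -
      ∑ j, algebraMap F R (differentialAt o p P j) * (z j - h j) ∈ 𝔮 * 𝔫 := by
  classical
  induction P using MvPolynomial.induction_on with
  | C a => simp [differentialAt]
  | add P Q hP hQ =>
    have := (𝔮 * 𝔫).add_mem hP hQ
    convert this using 1
    simp only [eval₂_add, map_add, differentialAt, add_mul, Finset.sum_add_distrib]
    ring
  | mul_X P i hP =>
    set D := ∑ j, algebraMap F R (differentialAt o p P j) * (z j - h j) with hD
    have hDmem : D ∈ 𝔮 := Ideal.sum_mem _ fun j _ ↦ Ideal.mul_mem_left _ _ (hzh j)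
    -- Product rule. The differential may be taken at `p` rather than at `h`, because replacing `z
    -- i` and `P(h)` by their values at `p` changes the linear term only by products of `𝔮` with
    -- `𝔫`.
    have h1 := (𝔮 * 𝔫).mul_mem_right (z i) hP
    have h2 : D * (z i - algebraMap F R (p i)) ∈ 𝔮 * 𝔫 := Ideal.mul_mem_mul hDmem (hz i)
    have h3 : (z i - h i) * (eval₂ (ψ : k →+* R) h P -
        algebraMap F R (eval p (map (o : k →+* F) P))) ∈ 𝔮 * 𝔫 :=
      Ideal.mul_mem_mul (hzh i) (eval₂_sub_algebraMap_mem hψ hh P)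
    have h4 : ∑ j, algebraMap F R (differentialAt o p (P * X i) j) * (z j - h j) =
        D * algebraMap F R (p i) + algebraMap F R (eval p (map (o : k →+* F) P)) * (z i - h i) := by
      have : ∀ j, algebraMap F R (differentialAt o p (P * X i) j) * (z j - h j) =
          algebraMap F R (differentialAt o p P j) * (z j - h j) * algebraMap F R (p i) +
          if j = i then algebraMap F R (eval p (map (o : k →+* F) P)) * (z i - h i) else 0 := by
        intro j
        simp only [differentialAt, pderiv_mul, pderiv_X, map_add, _root_.map_mul, map_X, eval_X]
        split_ifs with hji
        · subst hji
          simp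
          ring
        · simp [Ne.symm hji]
          ring
      simp only [this, Finset.sum_add_distrib, ← Finset.sum_mul, Finset.sum_ite_eq',
        Finset.mem_univ, if_true, hD]
    rw [h4]
    convert (𝔮 * 𝔫).add_mem ((𝔮 * 𝔫).add_mem h1 h2) h3 using 1
    simp only [eval₂_mul, eval₂_X]
    ring

/-- First order Taylor expansion modulo `𝔫 ^ (N + 1)`. -/
lemma taylor_mem {o : k →ₐ[F] F} {ψ : k →ₐ[F] R} {𝔫 : Ideal R}
    (hψ : ∀ x, o x = 0 → ψ x ∈ 𝔫) {p : σ → F} {h z : σ → R}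
    (hh : ∀ j, h j - algebraMap F R (p j) ∈ 𝔫) (hz : ∀ j, z j - algebraMap F R (p j) ∈ 𝔫)
    {N : ℕ} (hzh : ∀ j, z j - h j ∈ 𝔫 ^ N) (P : MvPolynomial σ k) :
    eval₂ (ψ : k →+* R) z P - eval₂ (ψ : k →+* R) h P -
      ∑ j, algebraMap F R (differentialAt o p P j) * (z j - h j) ∈ 𝔫 ^ (N + 1) := by
  rw [pow_succ]
  exact taylor_mem_mul hψ hh hz hzh P

/-- A maximal independent set of differentials of the system, completed by coordinates. -/
lemma exists_regular_subsystem (o : k →ₐ[F] F) (𝒯 : Set (MvPolynomial σ k)) (p : σ → F)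
    (hp : ∀ P ∈ 𝒯, eval p (map (o : k →+* F) P) = 0) :
    ∃ Q : σ → MvPolynomial σ k, (∀ i, eval p (map (o : k →+* F) (Q i)) = 0) ∧
      LinearIndependent F (fun i ↦ differentialAt o p (Q i)) ∧
      ∀ P ∈ 𝒯, differentialAt o p P ∈
        Submodule.span F ((fun i ↦ differentialAt o p (Q i)) '' {i | Q i ∈ 𝒯}) := by
  classical
  -- The differentials of these equations are the standard basis, so those of `𝒯 ∪ 𝒬` span
  -- everything.
  let 𝒬 : Set (MvPolynomial σ k) := Set.range fun j ↦ X j - C (algebraMap F k (p j))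
  obtain ⟨s, hs, hsspan, hsli⟩ := exists_linearIndependent F (differentialAt o p '' 𝒯)
  obtain ⟨b, hbt, hsb, hbspan, hbli⟩ := exists_linearIndepOn_id_extension hsli
    (t := differentialAt o p '' (𝒯 ∪ 𝒬)) (hs.trans (Set.image_mono Set.subset_union_left))
  -- A covector of `s` must be represented by an equation of `𝒯`, even if it also belongs to a
  -- coordinate.
  have hst : ∀ x : b, ∃ P, P ∈ 𝒯 ∪ 𝒬 ∧ differentialAt o p P = x ∧ (x.1 ∈ s → P ∈ 𝒯) := by
    rintro ⟨x, hx⟩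
    by_cases hxs : x ∈ s
    · obtain ⟨P, hP, rfl⟩ := hs hxs
      exact ⟨P, Or.inl hP, rfl, fun _ ↦ hP⟩
    · obtain ⟨P, hP, rfl⟩ := hbt hx
      exact ⟨P, hP, rfl, fun h ↦ absurd h hxs⟩
  choose Q₀ hQ₀ hQ₀d hQ₀s using hst
  have htop : ⊤ ≤ Submodule.span F (Set.range ((↑) : b → σ → F)) := by
    rw [Subtype.range_coe]
    intro x _
    rw [pi_eq_sum_univ x]
    refine Submodule.sum_mem _ fun i _ ↦ Submodule.smul_mem _ _ (hbspan ?_)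
    refine ⟨X i - C (algebraMap F k (p i)), Or.inr ⟨i, rfl⟩, ?_⟩
    funext j
    rw [differentialAt, map_sub, pderiv_C, pderiv_X, sub_zero]
    by_cases h : i = j
    · subst h; simp
    · simp [h]
  let B : Module.Basis b F (σ → F) := Module.Basis.mk hbli htop
  have hfin : Fintype b := FiniteDimensional.fintypeBasisIndex B
  have hcard : Fintype.card σ = Fintype.card b := by
    rw [← Module.finrank_eq_card_basis B, Module.finrank_fintype_fun_eq_card]
  let e : σ ≃ b := Fintype.equivOfCardEq hcard
  refine ⟨fun i ↦ Q₀ (e i), fun i ↦ ?_, ?_, fun P hP ↦ ?_⟩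
  · rcases hQ₀ (e i) with h | ⟨j, hj⟩
    · exact hp _ h
    · change eval p (map (o : k →+* F) (Q₀ (e i))) = 0
      rw [← hj]
      simp
  · have : (fun i ↦ differentialAt o p (Q₀ (e i))) = ((↑) : b → σ → F) ∘ e := by
      funext i
      exact hQ₀d _
    rw [this]
    exact hbli.comp e e.injective
  · have h1 : differentialAt o p P ∈ Submodule.span F s := by
      rw [hsspan]
      exact Submodule.subset_span ⟨P, hP, rfl⟩
    refine Submodule.span_mono ?_ h1
    intro x hx
    refine ⟨e.symm ⟨x, hsb hx⟩, ?_, ?_⟩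
    · change Q₀ (e (e.symm _)) ∈ 𝒯
      rw [Equiv.apply_symm_apply]
      exact hQ₀s _ hx
    · simp [hQ₀d]

/-- A system of equations over `k` has a solution in `k` if its solutions in enough nilpotent
thickenings can be moved infinitesimally in all tangent directions. -/
theorem exists_solution_of_lifting {o : k →ₐ[F] F} (himp : HasImplicitSolutions o)
    (𝒯 : Set (MvPolynomial σ k)) (p : σ → F)
    (hp : ∀ P ∈ 𝒯, eval p (map (o : k →+* F) P) = 0)
    {ι : Type*} (R : ι → Type*) [∀ i, CommRing (R i)] [∀ i, Algebra F (R i)]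
    (ψ : ∀ i, k →ₐ[F] R i) (𝔫 : ∀ i, Ideal (R i)) (hnil : ∀ i, IsNilpotent (𝔫 i))
    (hψ : ∀ i x, o x = 0 → ψ i x ∈ 𝔫 i) (hsep : ∀ x, (∀ i, ψ i x = 0) → x = 0)
    (hpt : ∀ i, ∃ h : σ → R i, (∀ j, h j - algebraMap F (R i) (p j) ∈ 𝔫 i) ∧
      ∀ P ∈ 𝒯, eval₂ (ψ i : k →+* R i) h P = 0)
    (hlift : ∀ i N, 1 ≤ N → ∀ h : σ → R i, (∀ j, h j - algebraMap F (R i) (p j) ∈ 𝔫 i) →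
      (∀ P ∈ 𝒯, eval₂ (ψ i : k →+* R i) h P = 0) → ∀ u ∈ 𝔫 i ^ N, ∀ ξ : σ → F,
      (∀ P ∈ 𝒯, ∑ j, differentialAt o p P j * ξ j = 0) →
      ∃ h' : σ → R i, (∀ j, h' j - h j - u * algebraMap F (R i) (ξ j) ∈ 𝔫 i ^ (N + 1)) ∧
        ∀ P ∈ 𝒯, eval₂ (ψ i : k →+* R i) h' P = 0) :
    ∃ z : σ → k, (∀ j, o (z j) = p j) ∧ ∀ P ∈ 𝒯, eval z P = 0 := by
  classical
  obtain ⟨Q, hQ0, hQli, hQspan⟩ := exists_regular_subsystem o 𝒯 p hp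
  -- Only the square subsystem has been solved; the rest of the proof shows that `z` satisfies every
  -- equation of `𝒯` in each thickening.
  obtain ⟨z, hz, hzQ⟩ := himp.exists_solution Q p hQ0 hQli
  refine ⟨z, hz, fun P hP ↦ hsep _ fun i ↦ ?_⟩
  have hzn (j) : ψ i (z j) - algebraMap F (R i) (p j) ∈ 𝔫 i := by
    have := hψ i (z j - algebraMap F k (p j)) (by simp [hz])
    simpa using this
  let c : Matrix σ σ F := Matrix.of fun s ↦ differentialAt o p (Q s)
  have hc : IsUnit c := Matrix.linearIndependent_rows_iff_isUnit.mp hQli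
  have hcd : IsUnit c.det := (Matrix.isUnit_iff_isUnit_det _).mp hc
  have hBc : c⁻¹ * c = 1 := Matrix.nonsing_inv_mul c hcd
  have hcB : c * c⁻¹ = 1 := Matrix.mul_nonsing_inv c hcd
  -- Induction on the order of contact between `z` and a true solution `h`.
  have key : ∀ N, 1 ≤ N → ∃ h : σ → R i, (∀ j, ψ i (z j) - h j ∈ 𝔫 i ^ N) ∧
      ∀ P ∈ 𝒯, eval₂ (ψ i : k →+* R i) h P = 0 := by
    intro N hN
    induction N, hN using Nat.le_induction with
    | base =>
      obtain ⟨h, h1, h2⟩ := hpt i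
      refine ⟨h, fun j ↦ ?_, h2⟩
      rw [pow_one]
      convert (𝔫 i).sub_mem (hzn j) (h1 j) using 1
      ring
    | succ N hN ih =>
      obtain ⟨h, h1, h2⟩ := ih
      have hle : 𝔫 i ^ N ≤ 𝔫 i := Ideal.pow_le_self (by omega)
      have hhn (j) : h j - algebraMap F (R i) (p j) ∈ 𝔫 i := by
        convert (𝔫 i).sub_mem (hzn j) (hle (h1 j)) using 1
        ring
      -- The difference of `z` and `h` in the coordinates given by the differentials of the `Q s`.
      let δ (s : σ) : R i := ∑ j, algebraMap F (R i) (c s j) * (ψ i (z j) - h j)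
      have hδ (s) : δ s ∈ 𝔫 i ^ N := Ideal.sum_mem _ fun j _ ↦ Ideal.mul_mem_left _ _ (h1 j)
      -- Both `z` and `h` satisfy `Q s`, so by Taylor's formula the difference is tangent to `Q s`
      -- up to higher order.
      have hδ' (s) (hs : Q s ∈ 𝒯) : δ s ∈ 𝔫 i ^ (N + 1) := by
        have := taylor_mem (hψ i) hhn hzn h1 (Q s)
        rw [h2 _ hs] at this
        have h3 : eval₂ (ψ i : k →+* R i) (fun j ↦ ψ i (z j)) (Q s) = 0 := by
          rw [← map_zero (ψ i : k →+* R i), ← hzQ s]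
          exact (map_eval_eq_eval₂ (ψ i : k →+* R i) z (Q s)).symm
        rw [h3, sub_zero, zero_sub, neg_mem_iff] at this
        exact this
      have hdec (j) : ψ i (z j) - h j = ∑ s, algebraMap F (R i) (c⁻¹ j s) * δ s := by
        simp only [δ, Finset.mul_sum]
        rw [Finset.sum_comm]
        have : ∀ l, ∑ s, algebraMap F (R i) (c⁻¹ j s) * (algebraMap F (R i) (c s l) *
            (ψ i (z l) - h l)) = if j = l then ψ i (z l) - h l else 0 := by
          intro l
          simp only [← mul_assoc, ← _root_.map_mul, ← Finset.sum_mul, ← map_sum]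
          have := congrFun (congrFun hBc j) l
          rw [Matrix.mul_apply] at this
          rw [this, Matrix.one_apply]
          split_ifs <;> simp
        simp [this]
      -- The columns of `c⁻¹` are dual to the differentials of the `Q s`, and those with `Q s ∈ 𝒯`
      -- span all differentials of `𝒯`. A column with `Q s ∉ 𝒯` is therefore a tangent direction.
      have hξ (s) (hs : Q s ∉ 𝒯) : ∀ P ∈ 𝒯, ∑ j, differentialAt o p P j * c⁻¹ j s = 0 := by
        intro P hP
        have h4 := hQspan P hP
        generalize differentialAt o p P = x at h4
        induction h4 using Submodule.span_induction with
        | mem x hx =>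
          obtain ⟨s', hs', rfl⟩ := hx
          have := congrFun (congrFun hcB s') s
          rw [Matrix.mul_apply, Matrix.one_apply_ne (by rintro rfl; exact hs hs')] at this
          exact this
        | zero => simp
        | add x y _ _ hx hy => simp only [Pi.add_apply, add_mul, Finset.sum_add_distrib, hx, hy,
            add_zero]
        | smul a x _ hx => simp only [Pi.smul_apply, smul_eq_mul, mul_assoc, ← Finset.mul_sum, hx,
            mul_zero]
      -- The correction is a sum of multiples of tangent directions, and `hlift` performs one of
      -- them at a time.
      have step : ∀ S : Finset σ, (∀ s ∈ S, Q s ∉ 𝒯) → ∃ h' : σ → R i,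
          (∀ j, h' j - h j - ∑ s ∈ S, algebraMap F (R i) (c⁻¹ j s) * δ s ∈ 𝔫 i ^ (N + 1)) ∧
          ∀ P ∈ 𝒯, eval₂ (ψ i : k →+* R i) h' P = 0 := by
        intro S
        induction S using Finset.induction_on with
        | empty => exact fun _ ↦ ⟨h, fun j ↦ by simp, h2⟩
        | insert s S hsS ih =>
          intro hS
          obtain ⟨h', h3, h4⟩ := ih fun s hs ↦ hS s (Finset.mem_insert_of_mem hs)
          have h5 (j) : h' j - algebraMap F (R i) (p j) ∈ 𝔫 i := by
            have h6 : ∑ s ∈ S, algebraMap F (R i) (c⁻¹ j s) * δ s ∈ 𝔫 i :=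
              Ideal.sum_mem _ fun s _ ↦ Ideal.mul_mem_left _ _ (hle (hδ s))
            have h7 := Ideal.pow_le_self (Nat.succ_ne_zero N) (h3 j)
            convert (𝔫 i).add_mem ((𝔫 i).add_mem h7 h6) (hhn j) using 1
            ring
          obtain ⟨h'', h6, h7⟩ := hlift i N hN h' h5 h4 (δ s) (hδ s) (fun j ↦ c⁻¹ j s)
            (hξ s (hS s (Finset.mem_insert_self _ _)))
          refine ⟨h'', fun j ↦ ?_, h7⟩
          rw [Finset.sum_insert hsS]
          convert (𝔫 i ^ (N + 1)).add_mem (h6 j) (h3 j) using 1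
          ring
      obtain ⟨h', h3, h4⟩ := step (Finset.univ.filter fun s ↦ Q s ∉ 𝒯) fun s hs ↦ by simpa using hs
      refine ⟨h', fun j ↦ ?_, h4⟩
      have h5 : ∑ s ∈ Finset.univ.filter (fun s ↦ ¬ (Q s ∉ 𝒯)),
          algebraMap F (R i) (c⁻¹ j s) * δ s ∈ 𝔫 i ^ (N + 1) :=
        Ideal.sum_mem _ fun s hs ↦ Ideal.mul_mem_left _ _ (hδ' s (by simpa using hs))
      have h6 := hdec j
      rw [← Finset.sum_filter_add_sum_filter_not Finset.univ (fun s ↦ Q s ∉ 𝒯)] at h6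
      convert (𝔫 i ^ (N + 1)).sub_mem h5 (h3 j) using 1
      linear_combination h6
  obtain ⟨L, hL⟩ := hnil i
  -- Contact of order beyond the nilpotency exponent is equality; `L + 1` because `key` needs a
  -- positive order.
  obtain ⟨h, h1, h2⟩ := key (L + 1) (by omega)
  have h3 : (fun j ↦ ψ i (z j)) = h := by
    funext j
    have := h1 j
    rw [pow_succ, hL] at this
    have h0 : (0 : Ideal (R i)) * 𝔫 i = ⊥ := by rw [zero_mul]; rfl
    rw [h0, Ideal.mem_bot, sub_eq_zero] at this
    exact this
  have h4 := h2 P hP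
  rw [← h3] at h4
  rw [← h4]
  exact map_eval_eq_eval₂ (ψ i : k →+* R i) z P

end Lifting
end GradedFamily

namespace GradedFamily
open MvPolynomial

/-! ### Exponentials of nilpotent multiples of derivations. -/

section Exp
lemma isNilpotent_smul_end {R M : Type*} [CommRing R] [AddCommGroup M] [Module R M] {u : R} (hu : IsNilpotent u) (T : Module.End R M) :
    IsNilpotent (u • T) := by
  obtain ⟨L, hL⟩ := hu
  exact ⟨L, by rw [smul_pow, hL, zero_smul]⟩

variable {R M : Type*} [CommRing R] [AddCommGroup M] [Module R M] [Module ℚ M]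

/-- The exponential of a nilpotent operator is a polynomial in it with rational coefficients, and
these act through `R`. -/
lemma exp_mem [Algebra ℚ R] {T : Module.End R M} (hT : IsNilpotent T) (N : Submodule R M)
    (hN : ∀ x ∈ N, T x ∈ N) {x : M} (hx : x ∈ N) : IsNilpotent.exp T x ∈ N := by
  obtain ⟨L, hL⟩ := hT
  rw [IsNilpotent.exp_eq_sum hL, LinearMap.sum_apply]
  refine Submodule.sum_mem _ fun i hi ↦ ?_
  clear hi
  have h : (T ^ i) x ∈ N := by
    induction i with
    | zero => simpa using hx
    | succ i ih => rw [pow_succ', Module.End.mul_apply]; exact hN _ ih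
  rw [LinearMap.smul_apply, ← algebraMap_smul R ((i.factorial : ℚ)⁻¹) ((T ^ i) x)]
  exact N.smul_mem _ h

/-- The series grouped as its first two terms and a multiple of `u ^ 2`; the remainder will be
negligible modulo the next power of the nilpotent ideal. -/
lemma exp_smul_apply [Algebra ℚ R] {u : R} (hu : IsNilpotent u) (T : Module.End R M) (x : M) :
    ∃ y, IsNilpotent.exp (u • T) x = x + u • T x + u ^ 2 • y := by
  obtain ⟨L, hL⟩ := hu
  -- An exponent of at least 2, so that the terms of order 0 and 1 can be split off.
  have h : (u • T) ^ (L + 2) = 0 := by rw [smul_pow, pow_add, hL, zero_mul, zero_smul]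
  refine ⟨∑ i ∈ Finset.range L, algebraMap ℚ R (((i + 2).factorial : ℚ)⁻¹) • u ^ i •
    (T ^ (i + 2)) x, ?_⟩
  rw [IsNilpotent.exp_eq_sum h, Finset.sum_range_succ', Finset.sum_range_succ', LinearMap.add_apply,
    LinearMap.add_apply, LinearMap.sum_apply, Finset.smul_sum]
  simp only [zero_add, Nat.factorial_one, Nat.cast_one, inv_one, pow_one, one_smul,
    Nat.factorial_zero, pow_zero, Module.End.one_apply, LinearMap.smul_apply]
  rw [add_comm _ x, add_comm _ (u • T x), ← add_assoc]
  congr 1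
  refine Finset.sum_congr rfl fun i _ ↦ ?_
  rw [← algebraMap_smul R (((i + 1 + 1).factorial : ℚ)⁻¹), smul_pow, LinearMap.smul_apply,
    smul_comm (u ^ 2), ← mul_smul (u ^ 2), ← pow_add, add_comm 2 i]

variable {B : Type*} [CommRing B] [Algebra R B] [Module ℚ B]

/-- The exponential of a nilpotent multiple of a derivation is an algebra homomorphism. -/
noncomputable def expDerivation (D : Derivation R B B) {u : R} (hu : IsNilpotent u) : B →ₐ[R] B :=
  AlgHom.ofLinearMap (IsNilpotent.exp (u • (D : B →ₗ[R] B)))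
    (by
      obtain ⟨L, hL⟩ := hu
      have h : (u • (D : B →ₗ[R] B)) ^ (L + 1) = 0 := by
        rw [smul_pow, pow_add, hL, zero_mul, zero_smul]
      rw [IsNilpotent.exp_eq_sum h, Finset.sum_range_succ', LinearMap.add_apply,
        LinearMap.sum_apply, Finset.sum_eq_zero fun i _ ↦ ?_]
      · simp
      · rw [LinearMap.smul_apply, pow_succ, Module.End.mul_apply, LinearMap.smul_apply,
          Derivation.coeFn_coe, Derivation.map_one_eq_zero, smul_zero, map_zero, smul_zero])
    (Module.End.exp_mul_of_derivation R B _ (fun x y ↦ by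
      simp only [LinearMap.smul_apply, Derivation.coeFn_coe, Derivation.leibniz, smul_add,
        smul_eq_mul, mul_smul_comm, smul_mul_assoc]
      rw [mul_comm y]) (isNilpotent_smul_end hu _))

lemma expDerivation_apply (D : Derivation R B B) {u : R} (hu : IsNilpotent u) (x : B) :
    expDerivation D hu x = IsNilpotent.exp (u • (D : B →ₗ[R] B)) x := rfl

/-- The infinitesimal action on linear maps of a pair of endomorphisms. -/
noncomputable def bracketAction {R A C : Type*} [CommRing R] [AddCommGroup A] [Module R A]
    [AddCommGroup C] [Module R C] (S : Module.End R A) (T : Module.End R C) :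
    Module.End R (C →ₗ[R] A) where
  toFun P := S ∘ₗ P + P ∘ₗ T
  map_add' P Q := by rw [LinearMap.comp_add, LinearMap.add_comp]; abel
  map_smul' r P := by
    rw [LinearMap.comp_smul, LinearMap.smul_comp, RingHom.id_apply, smul_add]

lemma bracketAction_apply {R A C : Type*} [CommRing R] [AddCommGroup A] [Module R A]
    [AddCommGroup C] [Module R C] (S : Module.End R A) (T : Module.End R C) (P : C →ₗ[R] A)
    (x : C) : bracketAction S T P x = S (P x) + P (T x) := rfl

variable {A C : Type*} [AddCommGroup A] [Module R A] [Module ℚ A] [AddCommGroup C] [Module R C]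
    [Module ℚ C]

/-- Composition on the left and composition on the right commute, so the exponential of their sum is
the product of the exponentials. Integrating the infinitesimal action thus gives composition with
two flows. -/
theorem exp_bracketAction {u : R} (hu : IsNilpotent u) (S : Module.End R A) (T : Module.End R C)
    (P : C →ₗ[R] A) (x : C) :
    IsNilpotent.exp (u • bracketAction S T) P x =
      IsNilpotent.exp (u • S) (P (IsNilpotent.exp (u • T) x)) := by
  have hadd : u • bracketAction S T =
      u • bracketAction S (0 : Module.End R C) + u • bracketAction (0 : Module.End R A) T := by
    refine LinearMap.ext fun Q ↦ LinearMap.ext fun y ↦ ?_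
    simp [bracketAction_apply]
  have hcomm : Commute (u • bracketAction S (0 : Module.End R C))
      (u • bracketAction (0 : Module.End R A) T) := by
    refine LinearMap.ext fun Q ↦ LinearMap.ext fun y ↦ ?_
    simp [bracketAction_apply]
  rw [hadd, IsNilpotent.exp_add_of_commute hcomm (isNilpotent_smul_end hu _)
    (isNilpotent_smul_end hu _), Module.End.mul_apply]
  have h1 (Q : C →ₗ[R] A) (y : C) :
      IsNilpotent.exp (u • bracketAction S (0 : Module.End R C)) Q y =
        IsNilpotent.exp (u • S) (Q y) := by
    have := Module.End.commute_exp_left_of_commute (g := LinearMap.applyₗ (R := R) (M₂ := A) y)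
      (isNilpotent_smul_end hu (bracketAction S (0 : Module.End R C)))
      (isNilpotent_smul_end hu S) (by
        refine LinearMap.ext fun Q ↦ ?_
        simp [bracketAction_apply])
    exact (LinearMap.congr_fun this Q).symm
  rw [h1]
  congr 1
  obtain ⟨L, hL⟩ := hu
  have h2 : (u • bracketAction (0 : Module.End R A) T) ^ L = 0 := by
    rw [smul_pow, hL, zero_smul]
  have h3 : (u • T) ^ L = 0 := by rw [smul_pow, hL, zero_smul]
  have h4 (i : ℕ) : ((u • bracketAction (0 : Module.End R A) T) ^ i) P = P ∘ₗ (u • T) ^ i := by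
    induction i with
    | zero => rfl
    | succ i ih =>
      rw [pow_succ', Module.End.mul_apply, ih]
      refine LinearMap.ext fun y ↦ ?_
      simp only [LinearMap.smul_apply, bracketAction_apply, LinearMap.zero_apply, zero_add,
        LinearMap.comp_apply, pow_succ, Module.End.mul_apply, map_smul]
  rw [IsNilpotent.exp_eq_sum h2, IsNilpotent.exp_eq_sum h3, LinearMap.sum_apply,
    LinearMap.sum_apply, LinearMap.sum_apply, map_sum]
  refine Finset.sum_congr rfl fun i _ ↦ ?_
  rw [LinearMap.smul_apply, LinearMap.smul_apply, LinearMap.smul_apply, h4, LinearMap.comp_apply,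
    map_rat_smul]

end Exp

/-! ### Stability of saturation and proportionality under derivations. -/

section Flow
variable {n m : ℕ} {w : Fin n → ℕ} {v : Fin m → ℕ} {R : Type*} [CommRing R]

lemma isWeightedHomogeneous_mkDerivation {η : Fin n → MvPolynomial (Fin n) R}
    (hη : ∀ i, IsWeightedHomogeneous w (η i) (w i)) {p : MvPolynomial (Fin n) R} {d : ℕ}
    (hp : IsWeightedHomogeneous w p d) : IsWeightedHomogeneous w (mkDerivation R η p) d := by
  rw [← mem_weightedHomogeneousSubmodule, p.as_sum, map_sum]
  refine Submodule.sum_mem _ fun e he ↦ ?_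
  rw [mkDerivation_monomial]
  refine Submodule.smul_mem _ _ (Submodule.sum_mem _ fun i hi ↦ ?_)
  have hi' : 1 ≤ e i := Nat.one_le_iff_ne_zero.mpr (Finsupp.mem_support_iff.mp hi)
  have h1 : Finsupp.weight w (e - Finsupp.single i 1) + w i = d := by
    rw [← hp (mem_support_iff.mp he)]
    conv_rhs => rw [← tsub_add_cancel_of_le (Finsupp.single_le_iff.mpr hi'), map_add]
    rw [Finsupp.weight_single]
    simp
  rw [← h1]
  exact IsWeightedHomogeneous.mul (isWeightedHomogeneous_monomial w _ _ rfl) (hη i)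

/-- Apply `D` to `X i ^ (N + 1) * q`: one extra power of `X i` keeps the term where `D` hits the
variable inside `J`. -/
lemma derivation_mem_satIdeal {D : Derivation R (MvPolynomial (Fin n) R) (MvPolynomial (Fin n) R)}
    {J : Ideal (MvPolynomial (Fin n) R)} (hD : ∀ q ∈ J, D q ∈ J) {q : MvPolynomial (Fin n) R}
    (hq : q ∈ satIdeal J) : D q ∈ satIdeal J := by
  obtain ⟨N, hN⟩ := hq
  refine ⟨N + 1, fun i ↦ ?_⟩
  have h1 : X i ^ (N + 1) * q ∈ J := by
    rw [pow_succ', mul_assoc]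
    exact J.mul_mem_left _ (hN i)
  have h2 := hD _ h1
  rw [Derivation.leibniz, Derivation.leibniz_pow] at h2
  have h3 : q • (N + 1) • (X i : MvPolynomial (Fin n) R) ^ (N + 1 - 1) • D (X i) ∈ J := by
    have : q • (N + 1) • (X i : MvPolynomial (Fin n) R) ^ (N + 1 - 1) • D (X i) =
        (((N + 1 : ℕ) : MvPolynomial (Fin n) R) * D (X i)) * (X i ^ N * q) := by
      simp only [smul_eq_mul, nsmul_eq_mul, Nat.add_sub_cancel]
      ring
    rw [this]
    exact J.mul_mem_left _ (hN i)
  exact (Submodule.add_mem_iff_left _ h3).mp h2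

variable {J : Ideal (MvPolynomial (Fin n) R)}

/-- The linear maps parallel to a given one form a submodule. -/
def parallelSubmodule (J : Ideal (MvPolynomial (Fin n) R)) (v : Fin m → ℕ) (M : ℕ)
    (G : MvPolynomial (Fin m) R →ₗ[R] MvPolynomial (Fin n) R) :
    Submodule R (MvPolynomial (Fin m) R →ₗ[R] MvPolynomial (Fin n) R) where
  carrier := {P | Parallel J v M P G}
  zero_mem' e s s' _ _ := by simp
  add_mem' {P Q} hP hQ e s s' hs hs' := by
    convert J.add_mem (hP e s s' hs hs') (hQ e s s' hs hs') using 1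
    simp only [LinearMap.add_apply]
    ring
  smul_mem' r P hP e s s' hs hs' := by
    convert Submodule.smul_of_tower_mem J r (hP e s s' hs hs') using 1
    simp only [LinearMap.smul_apply, smul_sub, smul_mul_assoc]

/-- The cross product is bilinear, so only pairs of monomials matter; these make the condition a
family of polynomial equations in the coefficients. -/
lemma Parallel.of_monomials {P Q : MvPolynomial (Fin m) R →ₗ[R] MvPolynomial (Fin n) R} {M : ℕ}
    (h : ∀ e d d', Finsupp.weight v d = e * M → Finsupp.weight v d' = e * M →
      P (monomial d 1) * Q (monomial d' 1) - P (monomial d' 1) * Q (monomial d 1) ∈ J) :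
    Parallel J v M P Q := by
  intro e s s' hs hs'
  have hm (d : Fin m →₀ ℕ) (r : R) : (monomial d r : MvPolynomial (Fin m) R) = r • monomial d 1 := by
    rw [smul_monomial, smul_eq_mul, mul_one]
  rw [s.as_sum, s'.as_sum]
  simp only [map_sum, Finset.sum_mul_sum]
  rw [Finset.sum_comm (s := s'.support), ← Finset.sum_sub_distrib]
  refine Ideal.sum_mem _ fun d hd ↦ ?_
  rw [← Finset.sum_sub_distrib]
  refine Ideal.sum_mem _ fun d' hd' ↦ ?_
  have := Submodule.smul_of_tower_mem J (coeff d s * coeff d' s')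
    (h e d d' (hs (mem_support_iff.mp hd)) (hs' (mem_support_iff.mp hd')))
  rw [hm d, hm d']
  convert this using 1
  simp only [map_smul, smul_sub, smul_mul_smul_comm]
  rw [mul_comm (coeff d' s')]

/-- Being parallel is transitive, if the map in the middle has no base points. -/
lemma Parallel.trans_left {P Q : MvPolynomial (Fin m) R →ₗ[R] MvPolynomial (Fin n) R}
    {g : Fin m → MvPolynomial (Fin n) R}
    (hg : ∀ i, X i ∈ (Ideal.span (Set.range g) ⊔ J).radical)
    (hP : Parallel (satIdeal J) v (∏ j, v j) P (aeval g).toLinearMap)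
    (hQ : Parallel (satIdeal J) v (∏ j, v j) Q (aeval g).toLinearMap) :
    Parallel (satIdeal J) v (∏ j, v j) P Q := by
  intro e s s' hs hs'
  refine mem_satIdeal_of_pow_mul_mem hg fun j ↦ ⟨(∏ i, v i) / v j * e * 2, ?_⟩
  -- On the locus where `g j` is invertible, `g(t)` can serve as a common denominator for `P` and
  -- `Q`. The cross product of `P` and `Q` times `g(t)^2` is a combination of the four cross
  -- products with `g`.
  let t : MvPolynomial (Fin m) R := (X j ^ ((∏ i, v i) / v j)) ^ e
  have ht : IsWeightedHomogeneous v t (e * ∏ i, v i) :=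
    (GradedMorphism.isWeightedHomogeneous_X_pow_div j).pow e
  have hgt : g j ^ ((∏ i, v i) / v j * e * 2) = (aeval g t) ^ 2 := by
    simp only [t, map_pow, aeval_X, ← pow_mul]
  have h1 := hP e s t hs ht
  have h2 := hP e s' t hs' ht
  have h3 := hQ e s t hs ht
  have h4 := hQ e s' t hs' ht
  simp only [AlgHom.toLinearMap_apply] at h1 h2 h3 h4
  rw [hgt]
  have k1 := Ideal.mul_mem_left _ (aeval g t * Q s') h1
  have k2 := Ideal.mul_mem_left _ (aeval g t * Q s) h2
  have k3 := Ideal.mul_mem_left _ (P t * aeval g s') h3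
  have k4 := Ideal.mul_mem_left _ (P t * aeval g s) h4
  convert Ideal.sub_mem _ (Ideal.add_mem _ k1 k4) (Ideal.add_mem _ k2 k3) using 1
  ring

/-- The infinitesimal criterion: if the derivative of `g` along a pair of derivations is parallel
to `g`, then so is the derivative of any linear map parallel to `g`. -/
lemma Parallel.bracketAction {P : MvPolynomial (Fin m) R →ₗ[R] MvPolynomial (Fin n) R}
    {g : Fin m → MvPolynomial (Fin n) R}
    (hg : ∀ i, X i ∈ (Ideal.span (Set.range g) ⊔ J).radical)
    {D : Derivation R (MvPolynomial (Fin n) R) (MvPolynomial (Fin n) R)} (hD : ∀ q ∈ J, D q ∈ J)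
    {T : Module.End R (MvPolynomial (Fin m) R)}
    (hT : ∀ p d, IsWeightedHomogeneous v p d → IsWeightedHomogeneous v (T p) d)
    (hP : Parallel (satIdeal J) v (∏ j, v j) P (aeval g).toLinearMap)
    (hG : Parallel (satIdeal J) v (∏ j, v j)
      (bracketAction (D : Module.End R _) T (aeval g).toLinearMap) (aeval g).toLinearMap) :
    Parallel (satIdeal J) v (∏ j, v j) (GradedFamily.bracketAction (D : Module.End R _) T P)
      (aeval g).toLinearMap := by
  intro e s s' hs hs'
  -- Differentiating the relation between `P` and `g` and adding the relations with `T s` and `T s'`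
  -- yields the wanted one for the variation of `P`, plus the cross product of `P` with the
  -- variation of `g`, which vanishes by transitivity.
  have h0 := derivation_mem_satIdeal hD (hP e s s' hs hs')
  have h1 := hP e (T s) s' (hT _ _ hs) hs'
  have h2 := hP e s (T s') hs (hT _ _ hs')
  have h3 := Parallel.trans_left hg hP hG e s s' hs hs'
  simp only [bracketAction_apply, AlgHom.toLinearMap_apply, map_sub, Derivation.leibniz,
    Derivation.coeFn_coe, smul_eq_mul] at h0 h1 h2 h3 ⊢
  convert Ideal.sub_mem _ (Ideal.add_mem _ (Ideal.add_mem _ h0 h1) h2) h3 using 1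
  ring

end Flow
end GradedFamily

namespace GradedFamily
attribute [local instance] MvPolynomial.weightedGradedAlgebra
open MvPolynomial

/-! ### Trivialisations as points, and the flow of a tangent vector on them. -/

section Points
variable {F : Type*} [Field F] {n m : ℕ} {w : Fin n → ℕ} {v : Fin m → ℕ}

/-- The composite of the substitutions `b` of `y`, `f : y ↦ f(x)` and `a` of `x`. -/
noncomputable def compMap {R : Type*} [CommRing R] (f : Fin m → MvPolynomial (Fin n) R)
    (a : Fin n → MvPolynomial (Fin n) R) (b : Fin m → MvPolynomial (Fin m) R) :
    MvPolynomial (Fin m) R →ₗ[R] MvPolynomial (Fin n) R :=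
  ((aeval a).comp ((aeval f).comp (aeval b))).toLinearMap

lemma compMap_apply {R : Type*} [CommRing R] (f : Fin m → MvPolynomial (Fin n) R)
    (a : Fin n → MvPolynomial (Fin n) R) (b : Fin m → MvPolynomial (Fin m) R)
    (s : MvPolynomial (Fin m) R) : compMap f a b s = aeval a (aeval f (aeval b s)) := rfl

/-- The pairs of substitutions `a` of `x` and `b` of `y`, compatible with the ideals and in
the group, that carry the morphism with components `f` to the one with components `g`. -/
structure IsPoint (JX : GradedIdeal F w) (JY : GradedIdeal F v) (𝒢 : EquivGroup) {R : Type*}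
    [CommRing R] [Algebra F R] (f g : Fin m → MvPolynomial (Fin n) R)
    (a : Fin n → MvPolynomial (Fin n) R) (b : Fin m → MvPolynomial (Fin m) R) : Prop where
  mapX : ∀ q ∈ JX.toIdeal, aeval a (map (algebraMap F R) q) ∈ extIdeal JX R
  mapY : ∀ q ∈ JY.toIdeal, aeval b (map (algebraMap F R) q) ∈ extIdeal JY R
  parallel : Parallel (satIdeal (extIdeal JX R)) v (∏ j, v j) (compMap f a b) (aeval g).toLinearMap
  left : 𝒢 = .left → ∀ i, a i - X i ∈ extIdeal JX R
  right : 𝒢 = .right → ∀ j, b j - X j ∈ extIdeal JY R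

/-- The tangent vectors to the space of points at the identity, for `f = g`. -/
structure IsTangent (JX : GradedIdeal F w) (JY : GradedIdeal F v) (𝒢 : EquivGroup)
    (g : Fin m → MvPolynomial (Fin n) F)
    (a : Fin n → MvPolynomial (Fin n) F) (b : Fin m → MvPolynomial (Fin m) F) : Prop where
  mapX : ∀ q ∈ JX.toIdeal, mkDerivation F a q ∈ JX.toIdeal
  mapY : ∀ q ∈ JY.toIdeal, mkDerivation F b q ∈ JY.toIdeal
  parallel : ∀ e d d', Finsupp.weight v d = e * (∏ j, v j) → Finsupp.weight v d' = e * (∏ j, v j) →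
    bracketAction (mkDerivation F a : Module.End F _) (mkDerivation F b : Module.End F _)
      (aeval g).toLinearMap (monomial d (1 : F)) * aeval g (monomial d' (1 : F)) -
    bracketAction (mkDerivation F a : Module.End F _) (mkDerivation F b : Module.End F _)
      (aeval g).toLinearMap (monomial d' (1 : F)) * aeval g (monomial d (1 : F)) ∈ satIdeal JX.toIdeal
  left : 𝒢 = .left → ∀ i, a i ∈ JX.toIdeal
  right : 𝒢 = .right → ∀ j, b j ∈ JY.toIdeal

variable {R : Type*} [CommRing R] [Algebra F R]

lemma mkDerivation_map {τ : Type*} (η : τ → MvPolynomial τ F) (q : MvPolynomial τ F) :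
    mkDerivation R (fun i ↦ map (algebraMap F R) (η i)) (map (algebraMap F R) q) =
      map (algebraMap F R) (mkDerivation F η q) := by
  induction q using MvPolynomial.induction_on with
  | C a => simp
  | add p q hp hq => simp only [map_add, hp, hq]
  | mul_X p i hp =>
    simp only [_root_.map_mul, map_X, Derivation.leibniz, mkDerivation_X, hp, smul_eq_mul, map_add]

lemma aeval_map_algebraMap {τ τ' : Type*} (g : τ → MvPolynomial τ' F) (q : MvPolynomial τ F) :
    aeval (fun i ↦ map (algebraMap F R) (g i)) (map (algebraMap F R) q) =
      map (algebraMap F R) (aeval g q) :=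
  (map_bind₁ (algebraMap F R) g q).symm

lemma derivation_mem_map {τ : Type*} {J : Ideal (MvPolynomial τ F)} {η : τ → MvPolynomial τ F}
    (h : ∀ q ∈ J, mkDerivation F η q ∈ J) {q : MvPolynomial τ R}
    (hq : q ∈ J.map (map (algebraMap F R))) :
    mkDerivation R (fun i ↦ map (algebraMap F R) (η i)) q ∈ J.map (map (algebraMap F R)) := by
  induction hq using Submodule.span_induction with
  | mem x hx =>
    obtain ⟨q, hq, rfl⟩ := hx
    rw [mkDerivation_map]
    exact Ideal.mem_map_of_mem _ (h q hq)
  | zero => rw [map_zero]; exact Ideal.zero_mem _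
  | add x y _ _ hx hy => rw [map_add]; exact Ideal.add_mem _ hx hy
  | smul c x hx' hx =>
    rw [smul_eq_mul, Derivation.leibniz, smul_eq_mul, smul_eq_mul]
    exact Ideal.add_mem _ (Ideal.mul_mem_left _ _ hx) (Ideal.mul_mem_right _ _ hx')

lemma aeval_mem_map {τ : Type*} {J : Ideal (MvPolynomial τ F)} {a : τ → MvPolynomial τ R}
    (h : ∀ q ∈ J, aeval a (map (algebraMap F R) q) ∈ J.map (map (algebraMap F R)))
    {q : MvPolynomial τ R} (hq : q ∈ J.map (map (algebraMap F R))) :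
    aeval a q ∈ J.map (map (algebraMap F R)) := by
  have : J.map (map (algebraMap F R)) ≤ (J.map (map (algebraMap F R))).comap (aeval a) := by
    rw [Ideal.map_le_iff_le_comap]
    exact fun q hq ↦ h q hq
  exact this hq

lemma X_mem_radical_map {J : Ideal (MvPolynomial (Fin n) F)} {g : Fin m → MvPolynomial (Fin n) F}
    (hg : ∀ i, X i ∈ (Ideal.span (Set.range g) ⊔ J).radical) (i : Fin n) :
    X i ∈ (Ideal.span (Set.range fun j ↦ map (algebraMap F R) (g j)) ⊔
      J.map (map (algebraMap F R))).radical := by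
  obtain ⟨N, hN⟩ := hg i
  refine ⟨N, ?_⟩
  have := Ideal.mem_map_of_mem (map (algebraMap F R)) hN
  rw [map_pow, map_X, Ideal.map_sup, Ideal.map_span, ← Set.range_comp] at this
  exact this

variable {JX : GradedIdeal F w} {JY : GradedIdeal F v} {𝒢 : EquivGroup}
  {g : Fin m → MvPolynomial (Fin n) F} {ηa : Fin n → MvPolynomial (Fin n) F}
  {ηb : Fin m → MvPolynomial (Fin m) F}

lemma bracketAction_map (s : MvPolynomial (Fin m) F) :
    bracketAction (mkDerivation R fun i ↦ map (algebraMap F R) (ηa i) : Module.End R _)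
      (mkDerivation R fun i ↦ map (algebraMap F R) (ηb i) : Module.End R _)
      (aeval fun j ↦ map (algebraMap F R) (g j)).toLinearMap (map (algebraMap F R) s) =
    map (algebraMap F R) (bracketAction (mkDerivation F ηa : Module.End F _)
      (mkDerivation F ηb : Module.End F _) (aeval g).toLinearMap s) := by
  rw [bracketAction_apply, bracketAction_apply, map_add]
  simp only [AlgHom.toLinearMap_apply, Derivation.coeFn_coe]
  rw [mkDerivation_map, aeval_map_algebraMap, aeval_map_algebraMap, mkDerivation_map]

/-- Tangency is a condition over `F`, and it extends to `R` because saturation commutes with the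
base change. -/
lemma IsTangent.parallel_map (h : IsTangent JX JY 𝒢 g ηa ηb) :
    Parallel (satIdeal (extIdeal JX R)) v (∏ j, v j)
      (bracketAction (mkDerivation R fun i ↦ map (algebraMap F R) (ηa i) : Module.End R _)
        (mkDerivation R fun i ↦ map (algebraMap F R) (ηb i) : Module.End R _)
        (aeval fun j ↦ map (algebraMap F R) (g j)).toLinearMap)
      (aeval fun j ↦ map (algebraMap F R) (g j)).toLinearMap := by
  refine Parallel.of_monomials fun e d d' hd hd' ↦ ?_
  have hmon (d : Fin m →₀ ℕ) : (monomial d 1 : MvPolynomial (Fin m) R) =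
    map (algebraMap F R) (monomial d 1) := by simp
  have hmem := Ideal.mem_map_of_mem (map (algebraMap F R)) (h.parallel e d d' hd hd')
  rw [map_satIdeal, map_sub, _root_.map_mul, _root_.map_mul] at hmem
  rw [AlgHom.toLinearMap_apply, AlgHom.toLinearMap_apply, hmon, hmon, bracketAction_map,
    bracketAction_map, aeval_map_algebraMap, aeval_map_algebraMap]
  exact hmem

/-- Points can be moved by the flow of a tangent vector. -/
theorem IsPoint.exp [Algebra ℚ R] (ht : IsTangent JX JY 𝒢 g ηa ηb)
    (hηb : ∀ j, IsWeightedHomogeneous v (ηb j) (v j))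
    (hg : ∀ i, X i ∈ (Ideal.span (Set.range g) ⊔ JX.toIdeal).radical)
    {f : Fin m → MvPolynomial (Fin n) R}
    {a : Fin n → MvPolynomial (Fin n) R} {b : Fin m → MvPolynomial (Fin m) R}
    (h : IsPoint JX JY 𝒢 f (fun j ↦ map (algebraMap F R) (g j)) a b) {u : R}
    (hu : IsNilpotent u) :
    IsPoint JX JY 𝒢 f (fun j ↦ map (algebraMap F R) (g j))
      (fun i ↦ expDerivation (mkDerivation R fun i ↦ map (algebraMap F R) (ηa i)) hu (a i))
      (fun j ↦ aeval b
        (expDerivation (mkDerivation R fun i ↦ map (algebraMap F R) (ηb i)) hu (X j))) := by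
  set Da := mkDerivation R fun i ↦ map (algebraMap F R) (ηa i) with hDa
  set Db := mkDerivation R fun i ↦ map (algebraMap F R) (ηb i) with hDb
  have hexp {τ : Type} (D : Derivation R (MvPolynomial τ R) (MvPolynomial τ R))
      (J : Ideal (MvPolynomial τ R)) (hD : ∀ q ∈ J, D q ∈ J) (q) (hq : q ∈ J) :
      expDerivation D hu q ∈ J := by
    refine exp_mem (isNilpotent_smul_end hu _) (J.restrictScalars R) (fun x hx ↦ ?_) hq
    exact Submodule.smul_mem _ _ (hD x hx)
  -- If `D` has values in `J`, all terms of the exponential but the first lie in `J`. This keeps the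
  -- substitution that the group requires to be trivial trivial along the flow.
  have hexp' {τ : Type} (D : Derivation R (MvPolynomial τ R) (MvPolynomial τ R))
      (J : Ideal (MvPolynomial τ R)) (hD : ∀ q, D q ∈ J) (q) :
      expDerivation D hu q - q ∈ J := by
    have ⟨L, hL⟩ := id hu
    have hL' : (u • (D : Module.End R (MvPolynomial τ R))) ^ (L + 1) = 0 := by
      rw [smul_pow, pow_add, hL, zero_mul, zero_smul]
    rw [expDerivation_apply, IsNilpotent.exp_eq_sum hL', Finset.sum_range_succ',
      LinearMap.add_apply, LinearMap.sum_apply]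
    simp only [Nat.factorial_zero, Nat.cast_one, inv_one, pow_zero, one_smul,
      Module.End.one_apply, add_sub_cancel_right]
    refine Submodule.sum_mem _ fun i _ ↦ ?_
    rw [LinearMap.smul_apply, pow_succ', Module.End.mul_apply, LinearMap.smul_apply,
      ← algebraMap_smul R (((i + 1).factorial : ℚ)⁻¹)]
    exact Submodule.smul_of_tower_mem _ _ (Submodule.smul_of_tower_mem _ _ (hD _))
  have hDmem {τ : Type} {J : Ideal (MvPolynomial τ R)} {η : τ → MvPolynomial τ R}
      (hη : ∀ i, η i ∈ J) (q) : mkDerivation R η q ∈ J := by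
    induction q using MvPolynomial.induction_on with
    | C a => simp
    | add p q hp hq => rw [map_add]; exact J.add_mem hp hq
    | mul_X p i hp =>
      rw [Derivation.leibniz, mkDerivation_X]
      exact J.add_mem (J.mul_mem_left _ (hη i)) (J.mul_mem_left _ hp)
  have ha (q : MvPolynomial (Fin n) R) : aeval (fun i ↦ expDerivation Da hu (a i)) q =
      expDerivation Da hu (aeval a q) := (comp_aeval_apply _ _ _).symm
  have hb (q : MvPolynomial (Fin m) R) : aeval (fun j ↦ aeval b (expDerivation Db hu (X j))) q =
      aeval b (expDerivation Db hu q) := by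
    have : (aeval fun j ↦ aeval b (expDerivation Db hu (X j))) =
      (aeval b).comp (expDerivation Db hu) := MvPolynomial.algHom_ext fun j ↦ by simp
    rw [this]
    rfl
  refine ⟨fun q hq ↦ ?_, fun q hq ↦ ?_, ?_, fun hG i ↦ ?_, fun hG j ↦ ?_⟩
  · rw [ha]
    exact hexp _ _ (fun q hq ↦ derivation_mem_map ht.mapX hq) _ (h.mapX q hq)
  · rw [hb]
    exact aeval_mem_map h.mapY (hexp _ _ (fun q hq ↦ derivation_mem_map ht.mapY hq) _
      (Ideal.mem_map_of_mem _ hq))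
  -- Moving `a` and `b` by their flows exponentiates one linear operator on maps `R[y] → R[x]`. The
  -- maps parallel to `g` form a submodule, which this operator preserves by the infinitesimal
  -- criterion; so its exponential does too.
  · have hcomp : compMap f (fun i ↦ expDerivation Da hu (a i))
        (fun j ↦ aeval b (expDerivation Db hu (X j))) =
        IsNilpotent.exp (u • bracketAction (Da : Module.End R _) (Db : Module.End R _))
          (compMap f a b) := by
      refine LinearMap.ext fun s ↦ ?_
      rw [exp_bracketAction hu, compMap_apply, compMap_apply, ha, hb]
      rfl
    rw [hcomp]
    refine exp_mem (isNilpotent_smul_end hu _) (parallelSubmodule _ _ _ _) (fun P hP ↦ ?_)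
      h.parallel
    refine Submodule.smul_mem _ _ ?_
    refine Parallel.bracketAction (X_mem_radical_map hg)
      (fun q hq ↦ derivation_mem_map ht.mapX hq) (fun p d hp ↦ ?_) hP ht.parallel_map
    refine isWeightedHomogeneous_mkDerivation (fun j e he ↦ ?_) hp
    refine hηb j (d := e) fun h0 ↦ he ?_
    rw [coeff_map, h0, map_zero]
  · have h1 := hexp' Da (extIdeal JX R)
      (hDmem fun i ↦ Ideal.mem_map_of_mem _ (ht.left hG i)) (a i)
    simpa using Ideal.add_mem _ h1 (h.left hG i)
  · have h1 := hexp' Db (extIdeal JY R)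
      (hDmem fun i ↦ Ideal.mem_map_of_mem _ (ht.right hG i)) (X j)
    have h2 : _ ∈ extIdeal JY R := aeval_mem_map h.mapY h1
    rw [map_sub, aeval_X] at h2
    simpa using Ideal.add_mem _ h2 (h.right hG j)

end Points
end GradedFamily

namespace GradedFamily
attribute [local instance] MvPolynomial.weightedGradedAlgebra
open MvPolynomial

/-! ### Degree-preserving substitutions as finite tuples of coefficients. -/

section Coordinates
variable {n : ℕ} {w : Fin n → ℕ}

/-- The coefficients of a substitution that preserves the degrees. -/
abbrev Coord (w : Fin n → ℕ) : Type := Σ i, {d : Fin n →₀ ℕ // Finsupp.weight w d = w i}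

lemma finite_coord (hw : ∀ i, 0 < w i) : Finite (Coord w) := by
  have (i : Fin n) : Finite {d : Fin n →₀ ℕ // Finsupp.weight w d = w i} :=
    (Finsupp.finite_of_nat_weight_eq w (fun i ↦ (hw i).ne') (w i)).to_subtype
  infer_instance

variable {R S : Type*} [CommRing R] [CommRing S]

lemma ext_of_isWeightedHomogeneous {i : Fin n} {p q : MvPolynomial (Fin n) R}
    (hp : IsWeightedHomogeneous w p (w i)) (hq : IsWeightedHomogeneous w q (w i))
    (h : ∀ d, Finsupp.weight w d = w i → coeff d p = coeff d q) : p = q := by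
  ext d
  by_cases hd : Finsupp.weight w d = w i
  · exact h d hd
  · rw [hp.coeff_eq_zero _ hd, hq.coeff_eq_zero _ hd]

variable [Fintype (Coord w)]

/-- The substitution with given coefficients. -/
noncomputable def polyOf (z : Coord w → R) (i : Fin n) : MvPolynomial (Fin n) R :=
  ∑ c : Coord w, if c.1 = i then monomial c.2.1 (z c) else 0

lemma coeff_polyOf (z : Coord w → R) (c : Coord w) : coeff c.2.1 (polyOf z c.1) = z c := by
  classical
  rw [polyOf, coeff_sum, Finset.sum_eq_single c]
  · simp
  · rintro ⟨i, d⟩ - hb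
    obtain ⟨i', d'⟩ := c
    split_ifs with h
    · dsimp only at h
      subst h
      rw [coeff_monomial, if_neg]
      rintro h
      exact hb (congrArg _ (Subtype.ext h))
    · rw [coeff_zero]
  · simp

lemma isWeightedHomogeneous_polyOf (z : Coord w → R) (i : Fin n) :
    IsWeightedHomogeneous w (polyOf z i) (w i) := by
  refine Submodule.sum_mem (weightedHomogeneousSubmodule R w (w i)) fun c _ ↦ ?_
  split_ifs with h
  · exact isWeightedHomogeneous_monomial w _ _ (by rw [c.2.2, h])
  · exact Submodule.zero_mem _

lemma polyOf_coeff {a : Fin n → MvPolynomial (Fin n) R}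
    (ha : ∀ i, IsWeightedHomogeneous w (a i) (w i)) (i : Fin n) :
    polyOf (fun c : Coord w ↦ coeff c.2.1 (a c.1)) i = a i :=
  ext_of_isWeightedHomogeneous (isWeightedHomogeneous_polyOf _ i) (ha i) fun d hd ↦
    coeff_polyOf _ (⟨i, d, hd⟩ : Coord w)

lemma map_polyOf (φ : R →+* S) (z : Coord w → R) (i : Fin n) :
    map φ (polyOf z i) = polyOf (fun c ↦ φ (z c)) i := by
  simp only [polyOf, map_sum, apply_ite (map φ), map_monomial, map_zero]

lemma polyOf_add_mul (z ξ : Coord w → R) (u : R) (i : Fin n) :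
    polyOf (fun c ↦ z c + u * ξ c) i = polyOf z i + u • polyOf ξ i := by
  simp only [polyOf, Finset.smul_sum, ← Finset.sum_add_distrib]
  refine Finset.sum_congr rfl fun c _ ↦ ?_
  split_ifs
  · rw [smul_monomial, smul_eq_mul, map_add]
  · simp

lemma polyOf_sub_mem {𝔫 : Ideal R} {z z' : Coord w → R} (h : ∀ c, z c - z' c ∈ 𝔫) (i : Fin n) :
    polyOf z i - polyOf z' i ∈ 𝔫.map C := by
  rw [polyOf, polyOf, ← Finset.sum_sub_distrib]
  refine Ideal.sum_mem _ fun c _ ↦ ?_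
  split_ifs
  · rw [← map_sub, ← mul_one (z c - z' c), ← C_mul_monomial]
    exact Ideal.mul_mem_right _ _ (Ideal.mem_map_of_mem _ (h c))
  · simp

end Coordinates

/-! ### The polynomial equations that define the points. -/

section Equations
variable {F : Type*} [Field F] {n m : ℕ} {w : Fin n → ℕ} {v : Fin m → ℕ}

/-- The conditions of `IsPoint` that concern polynomials in `x`. -/
inductive XIndex (JX : GradedIdeal F w) (v : Fin m → ℕ) (𝒢 : EquivGroup)
  | map (q : JX.toIdeal)
  | parallel (e : ℕ) (d d' : Fin m →₀ ℕ) (hd : Finsupp.weight v d = e * ∏ j, v j)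
      (hd' : Finsupp.weight v d' = e * ∏ j, v j)
  | left (h : 𝒢 = .left) (i : Fin n)

/-- The conditions of `IsPoint` that concern polynomials in `y`. -/
inductive YIndex (JY : GradedIdeal F v) (𝒢 : EquivGroup)
  | map (q : JY.toIdeal)
  | right (h : 𝒢 = .right) (j : Fin m)

variable {JX : GradedIdeal F w} {JY : GradedIdeal F v} {𝒢 : EquivGroup}
  {R S : Type*} [CommRing R] [Algebra F R] [CommRing S] [Algebra F S]

/-- The ideal in which the element `XIndex.elem` should lie. -/
noncomputable def XIndex.ideal : XIndex JX v 𝒢 → Ideal (MvPolynomial (Fin n) F)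
  | map _ => JX.toIdeal
  | parallel .. => satIdeal JX.toIdeal
  | left .. => JX.toIdeal

/-- The element whose membership in an ideal is required. -/
noncomputable def XIndex.elem (f g : Fin m → MvPolynomial (Fin n) R)
    (a : Fin n → MvPolynomial (Fin n) R) (b : Fin m → MvPolynomial (Fin m) R) :
    XIndex JX v 𝒢 → MvPolynomial (Fin n) R
  | map q => aeval a (MvPolynomial.map (algebraMap F R) q.1)
  | parallel _ d d' _ _ => compMap f a b (monomial d 1) * aeval g (monomial d' (1 : R)) -
      compMap f a b (monomial d' 1) * aeval g (monomial d (1 : R))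
  | left _ i => a i - X i

/-- The element whose membership in an ideal is required. -/
noncomputable def YIndex.elem (b : Fin m → MvPolynomial (Fin m) R) :
    YIndex JY 𝒢 → MvPolynomial (Fin m) R
  | map q => aeval b (MvPolynomial.map (algebraMap F R) q.1)
  | right _ j => b j - X j

/-- Every condition becomes membership of an element in the extension of an ideal over `F`, the form
in which functionals can test it. The saturation of the extension is replaced by the extension of
the saturation. -/
lemma isPoint_iff {f g : Fin m → MvPolynomial (Fin n) R}
    {a : Fin n → MvPolynomial (Fin n) R} {b : Fin m → MvPolynomial (Fin m) R} :
    IsPoint JX JY 𝒢 f g a b ↔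
      (∀ x : XIndex JX v 𝒢, x.elem f g a b ∈ x.ideal.map (map (algebraMap F R))) ∧
      ∀ y : YIndex JY 𝒢, y.elem b ∈ JY.toIdeal.map (map (algebraMap F R)) := by
  constructor
  · intro h
    refine ⟨fun x ↦ ?_, fun y ↦ ?_⟩
    · cases x with
      | map q => exact h.mapX q.1 q.2
      | parallel e d d' hd hd' =>
        rw [XIndex.ideal, map_satIdeal]
        exact h.parallel e _ _ (isWeightedHomogeneous_monomial v d 1 hd)
          (isWeightedHomogeneous_monomial v d' 1 hd')
      | left hG i => exact h.left hG i
    · cases y with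
      | map q => exact h.mapY q.1 q.2
      | right hG j => exact h.right hG j
  · rintro ⟨hX, hY⟩
    refine ⟨fun q hq ↦ hX (.map ⟨q, hq⟩), fun q hq ↦ hY (.map ⟨q, hq⟩),
      Parallel.of_monomials fun e d d' hd hd' ↦ ?_, fun hG i ↦ hX (.left hG i),
      fun hG j ↦ hY (.right hG j)⟩
    have := hX (.parallel e d d' hd hd')
    rw [XIndex.ideal, map_satIdeal] at this
    exact this

lemma map_aeval_poly {τ τ' : Type*} (φ : R →+* S) (a : τ → MvPolynomial τ' R)
    (q : MvPolynomial τ R) : map φ (aeval a q) = aeval (fun i ↦ map φ (a i)) (map φ q) :=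
  map_bind₁ φ a q

lemma XIndex.map_elem (φ : R →ₐ[F] S) (f g : Fin m → MvPolynomial (Fin n) R)
    (a : Fin n → MvPolynomial (Fin n) R) (b : Fin m → MvPolynomial (Fin m) R)
    (x : XIndex JX v 𝒢) :
    MvPolynomial.map (φ : R →+* S) (x.elem f g a b) =
      x.elem (fun j ↦ MvPolynomial.map (φ : R →+* S) (f j))
        (fun j ↦ MvPolynomial.map (φ : R →+* S) (g j))
        (fun j ↦ MvPolynomial.map (φ : R →+* S) (a j))
        (fun j ↦ MvPolynomial.map (φ : R →+* S) (b j)) := by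
  cases x with
  | map q =>
    rw [elem, elem, map_aeval_poly, MvPolynomial.map_map, AlgHom.comp_algebraMap]
  | parallel e d d' hd hd' =>
    simp only [elem, map_sub, _root_.map_mul, compMap_apply, map_aeval_poly, map_monomial, map_one]
  | left hG i => simp [elem]

lemma YIndex.map_elem (φ : R →ₐ[F] S) (b : Fin m → MvPolynomial (Fin m) R)
    (y : YIndex JY 𝒢) :
    MvPolynomial.map (φ : R →+* S) (y.elem b) =
      y.elem (fun j ↦ MvPolynomial.map (φ : R →+* S) (b j)) := by
  cases y with
  | map q =>
    rw [elem, elem, map_aeval_poly, MvPolynomial.map_map, AlgHom.comp_algebraMap]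
  | right hG j => simp [elem]

lemma isPoint_X (g : Fin m → MvPolynomial (Fin n) R) : IsPoint JX JY 𝒢 g g X X := by
  refine ⟨fun q hq ↦ ?_, fun q hq ↦ ?_, fun e s s' _ _ ↦ ?_, fun _ i ↦ by simp, fun _ i ↦ by simp⟩
  · rw [aeval_X_left_apply]; exact Ideal.mem_map_of_mem _ hq
  · rw [aeval_X_left_apply]; exact Ideal.mem_map_of_mem _ hq
  · simp [compMap_apply, mul_comm]

variable {k : Type*} [CommRing k] [Algebra F k] [Fintype (Coord w)] [Fintype (Coord v)]

/-- The polynomial equations for the coefficients of a point. -/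
def pointEquations (JX : GradedIdeal F w) (JY : GradedIdeal F v) (𝒢 : EquivGroup)
    (f : Fin m → MvPolynomial (Fin n) k) (g : Fin m → MvPolynomial (Fin n) F) :
    Set (MvPolynomial (Coord w ⊕ Coord v) k) :=
  {P | ∃ (x : XIndex JX v 𝒢) (ℓ : MvPolynomial (Fin n) F →ₗ[F] F), (∀ q ∈ x.ideal, ℓ q = 0) ∧
    P = extFunctional _ ℓ (x.elem (fun j ↦ map C (f j)) (fun j ↦ map (algebraMap F _) (g j))
      (polyOf fun c ↦ X (.inl c)) (polyOf fun c ↦ X (.inr c)))} ∪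
  {P | ∃ (y : YIndex JY 𝒢) (ℓ : MvPolynomial (Fin m) F →ₗ[F] F), (∀ q ∈ JY.toIdeal, ℓ q = 0) ∧
    P = extFunctional _ ℓ (y.elem (polyOf fun c ↦ X (.inr c)))}

/-- Functionals are compatible with base change, so specialising an equation at `z` amounts to
applying the functional to the element built from the substitutions with coefficients `z`. Vanishing
for all functionals that kill the ideal is membership. -/
lemma forall_mem_pointEquations {f : Fin m → MvPolynomial (Fin n) k}
    {g : Fin m → MvPolynomial (Fin n) F} (ψ : k →ₐ[F] R) (z : Coord w ⊕ Coord v → R) :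
    (∀ P ∈ pointEquations JX JY 𝒢 f g, eval₂ (ψ : k →+* R) z P = 0) ↔
      IsPoint JX JY 𝒢 (fun j ↦ map (ψ : k →+* R) (f j)) (fun j ↦ map (algebraMap F R) (g j))
        (polyOf fun c ↦ z (.inl c)) (polyOf fun c ↦ z (.inr c)) := by
  have hev (P : MvPolynomial (Coord w ⊕ Coord v) k) :
    eval₂ (ψ : k →+* R) z P = aevalTower ψ z P := rfl
  have hC : ((aevalTower ψ z : MvPolynomial (Coord w ⊕ Coord v) k →ₐ[F] R) :
      MvPolynomial (Coord w ⊕ Coord v) k →+* R).comp C = ψ := by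
    ext r
    exact aevalTower_C _ _ r
  have hx (x : XIndex JX v 𝒢) (ℓ : MvPolynomial (Fin n) F →ₗ[F] F) : eval₂ (ψ : k →+* R) z (extFunctional _ ℓ
      (x.elem (fun j ↦ map C (f j)) (fun j ↦ map (algebraMap F _) (g j))
      (polyOf fun c ↦ X (.inl c)) (polyOf fun c ↦ X (.inr c)))) =
      extFunctional R ℓ (x.elem (fun j ↦ map (ψ : k →+* R) (f j))
        (fun j ↦ map (algebraMap F R) (g j))
        (polyOf fun c ↦ z (.inl c)) (polyOf fun c ↦ z (.inr c))) := by
    rw [hev, ← extFunctional_map, XIndex.map_elem]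
    simp only [MvPolynomial.map_map, hC, AlgHom.comp_algebraMap, map_polyOf]
    simp only [RingHom.coe_coe, aevalTower_X]
  have hy (y : YIndex JY 𝒢) (ℓ : MvPolynomial (Fin m) F →ₗ[F] F) : eval₂ (ψ : k →+* R) z (extFunctional _ ℓ
      (y.elem (polyOf fun c ↦ X (.inr c)))) =
      extFunctional R ℓ (y.elem (polyOf fun c ↦ z (.inr c))) := by
    rw [hev, ← extFunctional_map, YIndex.map_elem]
    simp only [map_polyOf]
    simp only [RingHom.coe_coe, aevalTower_X]
  rw [isPoint_iff]
  constructor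
  · intro h
    refine ⟨fun x ↦ (mem_map_iff_extFunctional _ _).mpr fun ℓ hℓ ↦ ?_,
      fun y ↦ (mem_map_iff_extFunctional _ _).mpr fun ℓ hℓ ↦ ?_⟩
    · rw [← hx]
      exact h _ (Or.inl ⟨x, ℓ, hℓ, rfl⟩)
    · rw [← hy]
      exact h _ (Or.inr ⟨y, ℓ, hℓ, rfl⟩)
  · rintro ⟨h1, h2⟩ P (⟨x, ℓ, hℓ, rfl⟩ | ⟨y, ℓ, hℓ, rfl⟩)
    · rw [hx]
      exact (mem_map_iff_extFunctional _ _).mp (h1 x) ℓ hℓ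
    · rw [hy]
      exact (mem_map_iff_extFunctional _ _).mp (h2 y) ℓ hℓ

end Equations
end GradedFamily

namespace GradedFamily
attribute [local instance] MvPolynomial.weightedGradedAlgebra
open MvPolynomial

/-! ### Tangent vectors at the identity and dual numbers. -/

section Tangent
variable {F : Type*} [Field F] {n m : ℕ} {w : Fin n → ℕ} {v : Fin m → ℕ}
  {R : Type*} [CommRing R] [Algebra F R]

lemma aeval_X_add_smul {τ : Type*} {u : R} (hu : u * u = 0) (η : τ → MvPolynomial τ F)
    (q : MvPolynomial τ F) :
    aeval (fun i ↦ X i + u • map (algebraMap F R) (η i)) (map (algebraMap F R) q) =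
      map (algebraMap F R) q + u • map (algebraMap F R) (mkDerivation F η q) := by
  induction q using MvPolynomial.induction_on with
  | C a => simp [algebraMap_eq]
  | add p q hp hq => simp only [map_add, hp, hq, smul_add]; abel
  | mul_X p i hp =>
    simp only [_root_.map_mul, map_X, Derivation.leibniz, mkDerivation_X, hp, smul_eq_mul, map_add,
      aeval_X, add_mul, mul_add, smul_add, smul_mul_assoc, mul_smul_comm, smul_smul, hu, zero_smul]
    rw [mul_comm (X i)]
    abel

/-- The `ε`-component of a functional that vanishes on the element is the functional on `q'`. -/
lemma mem_of_add_eps_smul_mem {τ : Type*} {J : Ideal (MvPolynomial τ F)} {q q' : MvPolynomial τ F}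
    (h : map (algebraMap F (DualNumber F)) q +
      (DualNumber.eps : DualNumber F) • map (algebraMap F (DualNumber F)) q' ∈
      J.map (map (algebraMap F (DualNumber F)))) : q' ∈ J := by
  have key : ∀ ℓ : MvPolynomial τ F →ₗ[F] F, (∀ q ∈ J, ℓ q = 0) → ℓ q' = 0 := by
    intro ℓ hℓ
    have := (mem_map_iff_extFunctional _ _).mp h ℓ hℓ
    rw [map_add, map_smul, extFunctional_algebraMap, extFunctional_algebraMap] at this
    simpa [TrivSqZeroExt.algebraMap_eq_inl] using congrArg TrivSqZeroExt.snd this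
  have h2 : q' ∈ J.map (map (algebraMap F F)) := by
    rw [mem_map_iff_extFunctional]
    intro ℓ hℓ
    have := extFunctional_algebraMap (R := F) ℓ q'
    rw [Algebra.algebraMap_self, MvPolynomial.map_id] at this
    exact this.trans (key ℓ hℓ)
  rw [Algebra.algebraMap_self] at h2
  have h3 : (map (RingHom.id F) : MvPolynomial τ F →+* _) = RingHom.id _ :=
    RingHom.ext fun x ↦ MvPolynomial.map_id x
  rwa [h3, Ideal.map_id] at h2

variable {JX : GradedIdeal F w} {JY : GradedIdeal F v} {𝒢 : EquivGroup}

/-- Tangent vectors are points over the dual numbers. -/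
lemma isTangent_of_isPoint {g : Fin m → MvPolynomial (Fin n) F}
    {ηa : Fin n → MvPolynomial (Fin n) F} {ηb : Fin m → MvPolynomial (Fin m) F}
    (h : IsPoint (R := DualNumber F) JX JY 𝒢 (fun j ↦ map (algebraMap F _) (g j))
      (fun j ↦ map (algebraMap F _) (g j))
      (fun i ↦ X i + (DualNumber.eps : DualNumber F) • map (algebraMap F _) (ηa i))
      (fun i ↦ X i + (DualNumber.eps : DualNumber F) • map (algebraMap F _) (ηb i))) :
    IsTangent JX JY 𝒢 g ηa ηb := by
  have hee : (DualNumber.eps : DualNumber F) * DualNumber.eps = 0 := DualNumber.eps_mul_eps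
  refine ⟨fun q hq ↦ ?_, fun q hq ↦ ?_, fun e d d' hd hd' ↦ ?_, fun hG i ↦ ?_, fun hG j ↦ ?_⟩
  · have := h.mapX q hq
    rw [aeval_X_add_smul hee] at this
    exact mem_of_add_eps_smul_mem this
  · have := h.mapY q hq
    rw [aeval_X_add_smul hee] at this
    exact mem_of_add_eps_smul_mem this
  · have hpar := h.parallel e _ _ (isWeightedHomogeneous_monomial v d 1 hd)
      (isWeightedHomogeneous_monomial v d' 1 hd')
    rw [extIdeal, ← map_satIdeal] at hpar
    have hmon (d : Fin m →₀ ℕ) : (monomial d 1 : MvPolynomial (Fin m) (DualNumber F)) =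
      map (algebraMap F (DualNumber F)) (monomial d 1) := by simp
    have hcomp (s : MvPolynomial (Fin m) F) :
        compMap (fun j ↦ map (algebraMap F (DualNumber F)) (g j))
          (fun i ↦ X i + (DualNumber.eps : DualNumber F) • map (algebraMap F _) (ηa i))
          (fun i ↦ X i + (DualNumber.eps : DualNumber F) • map (algebraMap F _) (ηb i))
          (map (algebraMap F _) s) = map (algebraMap F _) (aeval g s) +
          (DualNumber.eps : DualNumber F) • map (algebraMap F _) (bracketAction
            (mkDerivation F ηa : Module.End F _) (mkDerivation F ηb : Module.End F _)
            (aeval g).toLinearMap s) := by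
      rw [compMap_apply, aeval_X_add_smul hee, map_add, map_smul, aeval_map_algebraMap,
        aeval_map_algebraMap, map_add, map_smul, aeval_X_add_smul hee, aeval_X_add_smul hee,
        bracketAction_apply, smul_add, smul_smul, hee, zero_smul, add_zero, map_add, smul_add,
        add_assoc]
      rfl
    have hg (s : MvPolynomial (Fin m) F) :
        (aeval fun j ↦ map (algebraMap F (DualNumber F)) (g j)).toLinearMap
          (map (algebraMap F _) s) = map (algebraMap F _) (aeval g s) := aeval_map_algebraMap g s
    rw [hmon, hmon, hcomp, hcomp, hg, hg] at hpar
    refine mem_of_add_eps_smul_mem (q := 0) ?_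
    convert hpar using 1
    simp only [map_zero, map_sub, _root_.map_mul, add_mul, smul_mul_assoc, smul_sub]
    ring
  · have := h.left hG i
    rw [add_sub_cancel_left] at this
    refine mem_of_add_eps_smul_mem (q := 0) ?_
    rw [map_zero, zero_add]
    exact this
  · have := h.right hG j
    rw [add_sub_cancel_left] at this
    refine mem_of_add_eps_smul_mem (q := 0) ?_
    rw [map_zero, zero_add]
    exact this

variable {k : Type*} [CommRing k] [Algebra F k] [Fintype (Coord w)] [Fintype (Coord v)]

/-- The coefficients of the identity substitutions. -/
noncomputable def idCoord (R : Type*) [CommRing R] (w : Fin n → ℕ) (v : Fin m → ℕ) :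
    Coord w ⊕ Coord v → R :=
  Sum.elim (fun c ↦ coeff c.2.1 (X c.1)) (fun c ↦ coeff c.2.1 (X c.1))

lemma polyOf_coeff_X (i : Fin n) :
    polyOf (fun c : Coord w ↦ coeff c.2.1 (X c.1 : MvPolynomial (Fin n) R)) i = X i :=
  polyOf_coeff (fun i ↦ isWeightedHomogeneous_X R w i) i

/-- A vector killed by all differentials gives, by Taylor's formula, a solution over the dual
numbers infinitely near the identity. Expanding its point conditions in `ε` yields derivations
tangent to the trivialisations of the constant family. -/
lemma isTangent_of_differentialAt {o : k →ₐ[F] F} {f : Fin m → MvPolynomial (Fin n) k}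
    {ξ : Coord w ⊕ Coord v → F}
    (hξ : ∀ P ∈ pointEquations JX JY 𝒢 f (fun j ↦ map (o : k →+* F) (f j)),
      ∑ j, differentialAt o (idCoord F w v) P j * ξ j = 0) :
    IsTangent JX JY 𝒢 (fun j ↦ map (o : k →+* F) (f j)) (polyOf fun c ↦ ξ (.inl c))
      (polyOf fun c ↦ ξ (.inr c)) := by
  let A := DualNumber F
  let ε : A := DualNumber.eps
  have hee : ε * ε = 0 := DualNumber.eps_mul_eps
  let ψ : k →ₐ[F] A := (Algebra.ofId F A).comp o
  have hψ : (ψ : k →+* A) = (algebraMap F A).comp (o : k →+* F) := rfl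
  have hid (c) : algebraMap F A (idCoord F w v c) = idCoord A w v c := by
    rcases c with c | c <;> simp [idCoord, coeff_X, apply_ite (algebraMap F A)]
  let z : Coord w ⊕ Coord v → A := fun c ↦ idCoord A w v c + ε * algebraMap F A (ξ c)
  have h0 := (forall_mem_pointEquations (JX := JX) (JY := JY) (𝒢 := 𝒢) (f := f)
    (g := fun j ↦ map (o : k →+* F) (f j)) ψ (idCoord A w v)).mpr (by
      have : (fun j ↦ map (ψ : k →+* A) (f j)) =
          fun j ↦ map (algebraMap F A) (map (o : k →+* F) (f j)) := by
        ext1 j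
        rw [MvPolynomial.map_map, hψ]
      rw [this]
      convert isPoint_X (R := A) _
      · exact funext fun i ↦ polyOf_coeff_X (w := w) i
      · exact funext fun i ↦ polyOf_coeff_X (w := v) i)
  have h1 : ∀ P ∈ pointEquations JX JY 𝒢 f (fun j ↦ map (o : k →+* F) (f j)),
      eval₂ (ψ : k →+* A) z P = 0 := by
    intro P hP
    -- With `𝔫 = (ε)` and `N = 1` the error lies in `(ε)^2 = 0`, so Taylor's formula is exact.
    have := taylor_mem (R := A) (o := o) (ψ := ψ) (𝔫 := Ideal.span {ε}) (p := idCoord F w v)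
      (h := idCoord A w v) (z := z) (N := 1) (fun x hx ↦ by
        have : ψ x = algebraMap F A (o x) := rfl
        rw [this, hx, map_zero]; exact Ideal.zero_mem _) (fun c ↦ by simp [hid])
      (fun c ↦ by
        simp only [z, hid, add_sub_cancel_left]
        exact Ideal.mul_mem_right _ _ (Ideal.mem_span_singleton_self _))
      (fun c ↦ by
        simp only [z, add_sub_cancel_left, pow_one]
        exact Ideal.mul_mem_right _ _ (Ideal.mem_span_singleton_self _)) P
    rw [h0 P hP, Ideal.span_singleton_pow, one_add_one_eq_two, sq, hee,
      Ideal.span_singleton_eq_bot.mpr rfl, Ideal.mem_bot, sub_zero] at this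
    have h2 : ∑ j, algebraMap F A (differentialAt o (idCoord F w v) P j) * (z j - idCoord A w v j) =
        ε * algebraMap F A (∑ j, differentialAt o (idCoord F w v) P j * ξ j) := by
      rw [map_sum, Finset.mul_sum]
      refine Finset.sum_congr rfl fun j _ ↦ ?_
      simp only [z, add_sub_cancel_left, _root_.map_mul]
      ring
    rwa [h2, hξ P hP, map_zero, mul_zero, sub_zero] at this
  have h2 := (forall_mem_pointEquations (JX := JX) (JY := JY) (𝒢 := 𝒢) (f := f)
    (g := fun j ↦ map (o : k →+* F) (f j)) ψ z).mp h1
  refine isTangent_of_isPoint ?_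
  convert h2 using 2 with j i i
  · rw [MvPolynomial.map_map, hψ]
  · simp only [z]
    rw [polyOf_add_mul, map_polyOf]
    congr 1
    exact (polyOf_coeff_X _).symm
  · simp only [z]
    rw [polyOf_add_mul, map_polyOf]
    congr 1
    exact (polyOf_coeff_X _).symm

end Tangent
end GradedFamily

namespace GradedFamily
attribute [local instance] MvPolynomial.weightedGradedAlgebra
open MvPolynomial

/-! ### Existence of a point over the base ring. -/

section ExistsPoint
variable {F : Type*} [Field F] {n m : ℕ} {w : Fin n → ℕ} {v : Fin m → ℕ}
  {R : Type*} [CommRing R] [Algebra F R]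

lemma mkDerivation_mem_map_C {τ : Type*} {𝔫 : Ideal R} (η : τ → MvPolynomial τ R)
    {q : MvPolynomial τ R} (hq : q ∈ 𝔫.map C) : mkDerivation R η q ∈ 𝔫.map C := by
  induction hq using Submodule.span_induction with
  | mem x hx =>
    obtain ⟨r, -, rfl⟩ := hx
    simp
  | zero => simp
  | add x y _ _ hx hy => rw [map_add]; exact Ideal.add_mem _ hx hy
  | smul c x hx' hx =>
    rw [smul_eq_mul, Derivation.leibniz, smul_eq_mul, smul_eq_mul]
    exact Ideal.add_mem _ (Ideal.mul_mem_left _ _ hx) (Ideal.mul_mem_right _ _ hx')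

lemma aeval_sub_mem_of_sub_X_mem {τ : Type*} {𝔞 : Ideal (MvPolynomial τ R)}
    {b : τ → MvPolynomial τ R} (hb : ∀ j, b j - X j ∈ 𝔞) (q : MvPolynomial τ R) :
    aeval b q - q ∈ 𝔞 := by
  have : (Ideal.Quotient.mkₐ R 𝔞).comp (aeval b) = Ideal.Quotient.mkₐ R 𝔞 :=
    MvPolynomial.algHom_ext fun j ↦ by
      simpa using Ideal.Quotient.eq.mpr (hb j)
  exact Ideal.Quotient.eq.mp (DFunLike.congr_fun this q)

lemma isWeightedHomogeneous_map {τ S : Type*} [CommRing S] (φ : R →+* S) {w : τ → ℕ}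
    {p : MvPolynomial τ R} {d : ℕ} (hp : IsWeightedHomogeneous w p d) :
    IsWeightedHomogeneous w (map φ p) d := by
  intro e he
  refine hp (d := e) fun h0 ↦ he ?_
  rw [coeff_map, h0, map_zero]

variable {JX : GradedIdeal F w} {JY : GradedIdeal F v} {𝒢 : EquivGroup}
  {k : Type*} [CommRing k] [Algebra F k] [CharZero F]

/-- A point near the identity can be moved along a tangent vector at the identity. -/
lemma IsPoint.exists_move {g : Fin m → MvPolynomial (Fin n) F}
    (hg : ∀ i, X i ∈ (Ideal.span (Set.range g) ⊔ JX.toIdeal).radical)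
    {ηa : Fin n → MvPolynomial (Fin n) F} {ηb : Fin m → MvPolynomial (Fin m) F}
    (hηa : ∀ i, IsWeightedHomogeneous w (ηa i) (w i))
    (hηb : ∀ j, IsWeightedHomogeneous v (ηb j) (v j))
    (ht : IsTangent JX JY 𝒢 g ηa ηb) {f : Fin m → MvPolynomial (Fin n) R}
    {a : Fin n → MvPolynomial (Fin n) R} {b : Fin m → MvPolynomial (Fin m) R}
    (ha : ∀ i, IsWeightedHomogeneous w (a i) (w i))
    (hb : ∀ j, IsWeightedHomogeneous v (b j) (v j)) {𝔫 : Ideal R} (hnil : IsNilpotent 𝔫)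
    (ha' : ∀ i, a i - X i ∈ 𝔫.map C) (hb' : ∀ j, b j - X j ∈ 𝔫.map C)
    (h : IsPoint JX JY 𝒢 f (fun j ↦ map (algebraMap F R) (g j)) a b) {N : ℕ} (hN : 1 ≤ N)
    {u : R} (hu : u ∈ 𝔫 ^ N) :
    ∃ (a₁ : Fin n → MvPolynomial (Fin n) R) (b₁ : Fin m → MvPolynomial (Fin m) R),
      IsPoint JX JY 𝒢 f (fun j ↦ map (algebraMap F R) (g j)) a₁ b₁ ∧
      (∀ i, IsWeightedHomogeneous w (a₁ i) (w i)) ∧ (∀ j, IsWeightedHomogeneous v (b₁ j) (v j)) ∧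
      (∀ i d, coeff d (a₁ i) - coeff d (a i) - u * algebraMap F R (coeff d (ηa i)) ∈ 𝔫 ^ (N + 1)) ∧
      ∀ j d, coeff d (b₁ j) - coeff d (b j) - u * algebraMap F R (coeff d (ηb j)) ∈ 𝔫 ^ (N + 1) := by
  -- Characteristic 0 enters here: the exponentials need the rational numbers in `R`.
  let : Algebra ℚ R := ((algebraMap F R).comp (algebraMap ℚ F)).toAlgebra
  have hun : IsNilpotent u := by
    obtain ⟨L, hL⟩ := hnil
    refine ⟨L, ?_⟩
    have h1 := Ideal.pow_mem_pow hu L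
    rw [← pow_mul, mul_comm, pow_mul, hL] at h1
    have h2 : (0 : Ideal R) ^ N = ⊥ := by rw [zero_pow (by omega)]; rfl
    rwa [h2] at h1
  -- Since `2 N ≥ N + 1`, everything beyond the linear term of the flow is negligible.
  have hu2 : u ^ 2 ∈ 𝔫 ^ (N + 1) := by
    have := Ideal.pow_mem_pow hu 2
    rw [← pow_mul] at this
    exact Ideal.pow_le_pow_right (by omega) this
  -- The linear term is the vector field at the current point, which differs from the one at the
  -- identity by an element of `𝔫`; multiplied by `u` this is again of order `N + 1`.
  have hmem {τ : Type} {x y η z : MvPolynomial τ R} (hx : x = y + u • z + u ^ 2 • η)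
      {ζ : MvPolynomial τ F} (hz : z - map (algebraMap F R) ζ ∈ 𝔫.map C) (d : τ →₀ ℕ) :
      coeff d x - coeff d y - u * algebraMap F R (coeff d ζ) ∈ 𝔫 ^ (N + 1) := by
    have h1 := mem_map_C_iff.mp hz d
    have h2 := Ideal.mul_mem_mul hu h1
    rw [← pow_succ] at h2
    convert Ideal.add_mem _ h2 (Ideal.mul_mem_right (coeff d η) _ hu2) using 1
    rw [hx, coeff_add, coeff_add, coeff_smul, coeff_smul, coeff_sub, coeff_map, smul_eq_mul,
      smul_eq_mul]
    ring
  have hhom {l : ℕ} {w : Fin l → ℕ} {η : Fin l → MvPolynomial (Fin l) F}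
      (hη : ∀ i, IsWeightedHomogeneous w (η i) (w i)) {q : MvPolynomial (Fin l) R} {d : ℕ}
      (hq : IsWeightedHomogeneous w q d) : IsWeightedHomogeneous w
        (expDerivation (mkDerivation R fun i ↦ map (algebraMap F R) (η i)) hun q) d := by
    refine exp_mem (isNilpotent_smul_end hun _) (weightedHomogeneousSubmodule R w d)
      (fun x hx ↦ Submodule.smul_mem _ _ ?_) hq
    exact isWeightedHomogeneous_mkDerivation (fun j ↦ isWeightedHomogeneous_map _ (hη j)) hx
  refine ⟨_, _, h.exp ht hηb hg hun, fun i ↦ hhom hηa (ha i), fun j ↦ ?_, fun i d ↦ ?_,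
    fun j d ↦ ?_⟩
  · exact GradedMorphism.isWeightedHomogeneous_aeval hb (hhom hηb (isWeightedHomogeneous_X R v j))
  · obtain ⟨y, hy⟩ := exp_smul_apply hun
      (mkDerivation R fun i ↦ map (algebraMap F R) (ηa i) : Module.End R _) (a i)
    refine hmem hy ?_ d
    have := mkDerivation_mem_map_C (fun i ↦ map (algebraMap F R) (ηa i)) (ha' i)
    rw [map_sub, mkDerivation_X] at this
    exact this
  · obtain ⟨y, hy⟩ := exp_smul_apply hun
      (mkDerivation R fun i ↦ map (algebraMap F R) (ηb i) : Module.End R _)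
      (X j : MvPolynomial (Fin m) R)
    have hy' : aeval b (expDerivation (mkDerivation R fun i ↦ map (algebraMap F R) (ηb i)) hun
        (X j)) = b j + u • aeval b (map (algebraMap F R) (ηb j)) + u ^ 2 • aeval b y := by
      rw [expDerivation_apply]
      refine (congrArg (aeval b) hy).trans ?_
      rw [map_add, map_add, map_smul, map_smul, aeval_X, Derivation.coeFn_coe, mkDerivation_X]
    exact hmem hy' (aeval_sub_mem_of_sub_X_mem hb' _) d

/-- The space of points over `k` is nonempty if there are points near the identity over enough
nilpotent thickenings. -/
theorem exists_isPoint (hw : ∀ i, 0 < w i) (hv : ∀ j, 0 < v j) {o : k →ₐ[F] F}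
    (himp : HasImplicitSolutions o) {f : Fin m → MvPolynomial (Fin n) k}
    (hg : ∀ i, X i ∈
      (Ideal.span (Set.range fun j ↦ map (o : k →+* F) (f j)) ⊔ JX.toIdeal).radical)
    {ι : Type*} (R : ι → Type*) [∀ i, CommRing (R i)] [∀ i, Algebra F (R i)]
    (ψ : ∀ i, k →ₐ[F] R i) (𝔫 : ∀ i, Ideal (R i)) (hnil : ∀ i, IsNilpotent (𝔫 i))
    (hψ : ∀ i x, o x = 0 → ψ i x ∈ 𝔫 i) (hsep : ∀ x, (∀ i, ψ i x = 0) → x = 0)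
    (hpt : ∀ i, ∃ (a : Fin n → MvPolynomial (Fin n) (R i)) (b : Fin m → MvPolynomial (Fin m) (R i)),
      (∀ j, IsWeightedHomogeneous w (a j) (w j)) ∧ (∀ j, IsWeightedHomogeneous v (b j) (v j)) ∧
      (∀ j, a j - X j ∈ (𝔫 i).map C) ∧ (∀ j, b j - X j ∈ (𝔫 i).map C) ∧
      IsPoint JX JY 𝒢 (fun j ↦ map (ψ i : k →+* R i) (f j))
        (fun j ↦ map (algebraMap F (R i)) (map (o : k →+* F) (f j))) a b) :
    ∃ (a : Fin n → MvPolynomial (Fin n) k) (b : Fin m → MvPolynomial (Fin m) k),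
      (∀ j, IsWeightedHomogeneous w (a j) (w j)) ∧ (∀ j, IsWeightedHomogeneous v (b j) (v j)) ∧
      (∀ j, map (o : k →+* F) (a j) = X j) ∧ (∀ j, map (o : k →+* F) (b j) = X j) ∧
      IsPoint JX JY 𝒢 f (fun j ↦ map (algebraMap F k) (map (o : k →+* F) (f j))) a b := by
  have := finite_coord hw
  have := finite_coord hv
  let := Fintype.ofFinite (Coord w)
  let := Fintype.ofFinite (Coord v)
  have hid (S : Type _) [CommRing S] [Algebra F S] (c) :
      algebraMap F S (idCoord F w v c) = idCoord S w v c := by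
    rcases c with c | c <;> simp [idCoord, coeff_X, apply_ite (algebraMap F S)]
  obtain ⟨z, hz, hz'⟩ := exists_solution_of_lifting himp
    (pointEquations JX JY 𝒢 f fun j ↦ map (o : k →+* F) (f j)) (idCoord F w v)
    (fun P hP ↦ by
      rw [eval_map]
      refine (forall_mem_pointEquations o (idCoord F w v)).mpr ?_ P hP
      simp only [Algebra.algebraMap_self, MvPolynomial.map_id]
      convert isPoint_X (R := F) _
      · exact funext fun i ↦ polyOf_coeff_X (w := w) i
      · exact funext fun i ↦ polyOf_coeff_X (w := v) i)
    R ψ 𝔫 hnil hψ hsep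
    (fun i ↦ by
      obtain ⟨a, b, ha, hb, ha', hb', hab⟩ := hpt i
      refine ⟨Sum.elim (fun c ↦ coeff c.2.1 (a c.1)) (fun c ↦ coeff c.2.1 (b c.1)), ?_, ?_⟩
      · rintro (c | c)
        · have := mem_map_C_iff.mp (ha' c.1) c.2.1
          rw [hid]
          simpa [idCoord] using this
        · have := mem_map_C_iff.mp (hb' c.1) c.2.1
          rw [hid]
          simpa [idCoord] using this
      · refine (forall_mem_pointEquations _ _).mpr ?_
        convert hab
        · exact funext fun i ↦ polyOf_coeff ha i
        · exact funext fun i ↦ polyOf_coeff hb i)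
    -- The lifting hypothesis: a vector killed by the differentials integrates to a flow, and the
    -- flow moves the given point.
    (fun i N hN h hh hP u hu ξ hξ ↦ by
      have ht := isTangent_of_differentialAt hξ
      have hP' := (forall_mem_pointEquations _ _).mp hP
      have hX (j : Fin n) : polyOf (fun c ↦ h (.inl c)) j - X j ∈ (𝔫 i).map C := by
        rw [← polyOf_coeff_X (w := w) j]
        refine polyOf_sub_mem (fun c ↦ ?_) j
        have := hh (.inl c)
        rwa [hid] at this
      have hY (j : Fin m) : polyOf (fun c ↦ h (.inr c)) j - X j ∈ (𝔫 i).map C := by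
        rw [← polyOf_coeff_X (w := v) j]
        refine polyOf_sub_mem (fun c ↦ ?_) j
        have := hh (.inr c)
        rwa [hid] at this
      obtain ⟨a, b, hab, ha, hb, ha', hb'⟩ := hP'.exists_move hg
        (isWeightedHomogeneous_polyOf _) (isWeightedHomogeneous_polyOf _) ht
        (isWeightedHomogeneous_polyOf _) (isWeightedHomogeneous_polyOf _) (hnil i) hX hY hN hu
      refine ⟨Sum.elim (fun c ↦ coeff c.2.1 (a c.1)) (fun c ↦ coeff c.2.1 (b c.1)), ?_, ?_⟩
      · rintro (c | c)
        · simpa [coeff_polyOf] using ha' c.1 c.2.1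
        · simpa [coeff_polyOf] using hb' c.1 c.2.1
      · refine (forall_mem_pointEquations _ _).mpr ?_
        convert hab
        · exact funext fun i ↦ polyOf_coeff ha i
        · exact funext fun i ↦ polyOf_coeff hb i)
  refine ⟨polyOf fun c ↦ z (.inl c), polyOf fun c ↦ z (.inr c), isWeightedHomogeneous_polyOf _,
    isWeightedHomogeneous_polyOf _, fun j ↦ ?_, fun j ↦ ?_, ?_⟩
  · rw [map_polyOf]
    simp only [RingHom.coe_coe, hz]
    exact polyOf_coeff_X j
  · rw [map_polyOf]
    simp only [RingHom.coe_coe, hz]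
    exact polyOf_coeff_X j
  · have := (forall_mem_pointEquations (JX := JX) (JY := JY) (𝒢 := 𝒢) (f := f)
      (g := fun j ↦ map (o : k →+* F) (f j)) (AlgHom.id F k) z).mp hz'
    have hidk : ((AlgHom.id F k : k →ₐ[F] k) : k →+* k) = RingHom.id k := rfl
    simpa only [hidk, MvPolynomial.map_id] using this

end ExistsPoint
end GradedFamily

namespace GradedFamily
open AlgebraicGeometry CategoryTheory
attribute [local instance] MvPolynomial.weightedGradedAlgebra
open MvPolynomial

/-! ### Composition and base change of graded morphisms. -/

namespace GradedMorphism
variable {F : Type u} [Field F] {n m l : ℕ} {w : Fin n → ℕ} {v : Fin m → ℕ} {t : Fin l → ℕ}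
  {JX : GradedIdeal F w} {JY : GradedIdeal F v} {JZ : GradedIdeal F t}
  {R S T : Type*} [CommRing R] [Algebra F R] [CommRing S] [Algebra F S] [CommRing T] [Algebra F T]

lemma ext_X {φ ψ : GradedMorphism JX JY R}
    (h : ∀ j, φ.hom (Ideal.Quotient.mk _ (X j)) = ψ.hom (Ideal.Quotient.mk _ (X j))) : φ = ψ := by
  obtain ⟨c, -, hc⟩ := φ.exists_lift
  have h1 : φ.hom = ψ.hom := by
    refine DFunLike.ext _ _ fun x ↦ ?_
    obtain ⟨p, rfl⟩ := Ideal.Quotient.mk_surjective x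
    rw [← mk_aeval_lift φ.hom hc, ← mk_aeval_lift ψ.hom fun j ↦ (hc j).trans (h j)]
  cases φ
  cases ψ
  congr

/-- The composite `X → Y → Z`. -/
noncomputable def comp (φ : GradedMorphism JX JY R) (ψ : GradedMorphism JY JZ R) :
    GradedMorphism JX JZ R where
  hom := φ.hom.comp ψ.hom
  noBasePoints := by
    refine φ.noBasePoints.trans (Ideal.radical_le_radical_iff.mpr ?_)
    refine (Ideal.map_mono ψ.noBasePoints).trans ((Ideal.map_radical_le _).trans
      (Ideal.radical_mono ?_))
    rw [Ideal.map_map]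
    exact le_of_eq rfl

lemma comp_hom_apply (φ : GradedMorphism JX JY R) (ψ : GradedMorphism JY JZ R) (x) :
    (φ.comp ψ).hom x = φ.hom (ψ.hom x) := rfl

lemma proj_comp (φ : GradedMorphism JX JY R) (ψ : GradedMorphism JY JZ R) :
    φ.proj ≫ ψ.proj = (φ.comp ψ).proj :=
  projMap_comp ψ.hom.toGradedRingHom ψ.noBasePoints φ.hom.toGradedRingHom φ.noBasePoints
    (φ.comp ψ).noBasePoints

/-- The identity of `X`. -/
noncomputable def id (JX : GradedIdeal F w) (R : Type*) [CommRing R] [Algebra F R] :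
    GradedMorphism JX JX R := GradedAut.refl.toGradedMorphism

lemma id_hom_apply (x) : (id JX R).hom x = x := rfl

lemma id_comp (φ : GradedMorphism JX JY R) : (id JX R).comp φ = φ := ext_X fun _ ↦ rfl

lemma comp_id (φ : GradedMorphism JX JY R) : φ.comp (id JY R) = φ := ext_X fun _ ↦ rfl

lemma comp_assoc {r : ℕ} {s : Fin r → ℕ} {JW : GradedIdeal F s} (φ : GradedMorphism JX JY R)
    (ψ : GradedMorphism JY JZ R) (χ : GradedMorphism JZ JW R) :
    (φ.comp ψ).comp χ = φ.comp (ψ.comp χ) := ext_X fun _ ↦ rfl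

lemma baseChange_hom_mk_X (ρ : R →ₐ[F] S) (φ : GradedMorphism JX JY R) (j : Fin m) :
    (φ.baseChange ρ).hom (Ideal.Quotient.mk _ (X j)) =
      extMap JX ρ (φ.hom (Ideal.Quotient.mk _ (X j))) := by
  rw [← φ.baseChangeHom_extMap, extMap_mk, map_X]
  rfl

lemma baseChange_comp (ρ : R →ₐ[F] S) (φ : GradedMorphism JX JY R) (ψ : GradedMorphism JY JZ R) :
    (φ.comp ψ).baseChange ρ = (φ.baseChange ρ).comp (ψ.baseChange ρ) := by
  refine ext_X fun j ↦ ?_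
  rw [baseChange_hom_mk_X, comp_hom_apply, comp_hom_apply, baseChange_hom_mk_X]
  exact (φ.baseChangeHom_extMap ρ _).symm

lemma baseChange_id (ρ : R →ₐ[F] S) : (id JX R).baseChange ρ = id JX S := by
  refine ext_X fun j ↦ ?_
  rw [baseChange_hom_mk_X, id_hom_apply, id_hom_apply, extMap_mk, map_X]

lemma baseChange_baseChange (ρ : R →ₐ[F] S) (ρ' : S →ₐ[F] T) (φ : GradedMorphism JX JY R) :
    (φ.baseChange ρ).baseChange ρ' = φ.baseChange (ρ'.comp ρ) := by
  refine ext_X fun j ↦ ?_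
  obtain ⟨c, -, hc⟩ := φ.exists_lift
  rw [baseChange_hom_mk_X, baseChange_hom_mk_X, baseChange_hom_mk_X, ← hc, extMap_mk, extMap_mk,
    extMap_mk, MvPolynomial.map_map]
  rfl

lemma lift_baseChange {φ : GradedMorphism JX JY R} {c : Fin m → MvPolynomial (Fin n) R}
    (hc : ∀ j, Ideal.Quotient.mk (extIdeal JX R) (c j) = φ.hom (Ideal.Quotient.mk _ (X j)))
    (ρ : R →ₐ[F] S) (j : Fin m) :
    Ideal.Quotient.mk (extIdeal JX S) (map (ρ : R →+* S) (c j)) =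
      (φ.baseChange ρ).hom (Ideal.Quotient.mk _ (X j)) := by
  rw [baseChange_hom_mk_X, ← hc, extMap_mk]

lemma lift_comp {φ : GradedMorphism JX JY R} {ψ : GradedMorphism JY JZ R}
    {c : Fin m → MvPolynomial (Fin n) R} {c' : Fin l → MvPolynomial (Fin m) R}
    (hc : ∀ j, Ideal.Quotient.mk (extIdeal JX R) (c j) = φ.hom (Ideal.Quotient.mk _ (X j)))
    (hc' : ∀ j, Ideal.Quotient.mk (extIdeal JY R) (c' j) = ψ.hom (Ideal.Quotient.mk _ (X j)))
    (j : Fin l) :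
    Ideal.Quotient.mk (extIdeal JX R) (aeval c (c' j)) =
      (φ.comp ψ).hom (Ideal.Quotient.mk _ (X j)) := by
  rw [mk_aeval_lift φ.hom hc, hc', comp_hom_apply]

lemma aeval_mem_extIdeal {α : GradedMorphism JX JX R} {a : Fin n → MvPolynomial (Fin n) R}
    (ha : ∀ i, Ideal.Quotient.mk (extIdeal JX R) (a i) = α.hom (Ideal.Quotient.mk _ (X i)))
    {q : MvPolynomial (Fin n) R} (hq : q ∈ extIdeal JX R) : aeval a q ∈ extIdeal JX R := by
  rw [← Ideal.Quotient.eq_zero_iff_mem] at hq ⊢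
  rw [mk_aeval_lift α.hom ha, hq]
  exact map_zero α.hom.toAlgHom

lemma compMap_eq {R : Type*} [CommRing R] (f : Fin m → MvPolynomial (Fin n) R)
    (a : Fin n → MvPolynomial (Fin n) R) (b : Fin m → MvPolynomial (Fin m) R) :
    compMap f a b = (aeval fun j ↦ aeval a (aeval f (b j))).toLinearMap := by
  rw [compMap]
  congr 1
  exact MvPolynomial.algHom_ext fun j ↦ by simp

variable {α : GradedMorphism JX JX R} {β : GradedMorphism JY JY R} {f g : GradedMorphism JX JY R}
  {a : Fin n → MvPolynomial (Fin n) R} {b : Fin m → MvPolynomial (Fin m) R}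
  {fl gl : Fin m → MvPolynomial (Fin n) R} {𝒢 : EquivGroup}

/-- The composite is itself a graded morphism with components `aeval a (aeval f (b j))`, so the
proportionality criterion applies to it and `g`. -/
theorem isPoint_of_proj_eq (hw : ∀ i, 0 < w i) (hv : ∀ j, 0 < v j)
    (ha : ∀ j, Ideal.Quotient.mk (extIdeal JX R) (a j) = α.hom (Ideal.Quotient.mk _ (X j)))
    (hb : ∀ j, Ideal.Quotient.mk (extIdeal JY R) (b j) = β.hom (Ideal.Quotient.mk _ (X j)))
    (hf : ∀ j, Ideal.Quotient.mk (extIdeal JX R) (fl j) = f.hom (Ideal.Quotient.mk _ (X j)))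
    (hg : ∀ j, Ideal.Quotient.mk (extIdeal JX R) (gl j) = g.hom (Ideal.Quotient.mk _ (X j)))
    (hα : 𝒢 = .left → α = id JX R) (hβ : 𝒢 = .right → β = id JY R)
    (h : α.proj ≫ f.proj ≫ β.proj = g.proj) : IsPoint JX JY 𝒢 fl gl a b := by
  rw [proj_comp, proj_comp] at h
  refine ⟨fun q hq ↦ aeval_mem_extIdeal ha (Ideal.mem_map_of_mem _ hq),
    fun q hq ↦ aeval_mem_extIdeal hb (Ideal.mem_map_of_mem _ hq), ?_, fun hG i ↦ ?_,
    fun hG j ↦ ?_⟩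
  · rw [compMap_eq]
    exact parallel_of_proj_eq hw hv (lift_comp ha (lift_comp hf hb)) hg h
  · rw [← Ideal.Quotient.eq, ha, hα hG, id_hom_apply]
  · rw [← Ideal.Quotient.eq, hb, hβ hG, id_hom_apply]

theorem proj_eq_of_isPoint (hw : ∀ i, 0 < w i) (hv : ∀ j, 0 < v j)
    (ha1 : ∀ j, IsWeightedHomogeneous w (a j) (w j))
    (hb1 : ∀ j, IsWeightedHomogeneous v (b j) (v j))
    (hf1 : ∀ j, IsWeightedHomogeneous w (fl j) (v j))
    (ha : ∀ j, Ideal.Quotient.mk (extIdeal JX R) (a j) = α.hom (Ideal.Quotient.mk _ (X j)))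
    (hb : ∀ j, Ideal.Quotient.mk (extIdeal JY R) (b j) = β.hom (Ideal.Quotient.mk _ (X j)))
    (hf : ∀ j, Ideal.Quotient.mk (extIdeal JX R) (fl j) = f.hom (Ideal.Quotient.mk _ (X j)))
    (hg : ∀ j, Ideal.Quotient.mk (extIdeal JX R) (gl j) = g.hom (Ideal.Quotient.mk _ (X j)))
    (h : IsPoint JX JY 𝒢 fl gl a b) : α.proj ≫ f.proj ≫ β.proj = g.proj := by
  rw [proj_comp, proj_comp]
  refine proj_eq_of_parallel hw hv (fun j ↦ ?_) (lift_comp ha (lift_comp hf hb)) hg ?_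
  · exact isWeightedHomogeneous_aeval ha1 (isWeightedHomogeneous_aeval hf1 (hb1 j))
  · rw [← compMap_eq]
    exact h.parallel

end GradedMorphism

/-! ### Functoriality of points in the base ring. -/

section IsPointMap
variable {F : Type u} [Field F] {n m : ℕ} {w : Fin n → ℕ} {v : Fin m → ℕ}
  {JX : GradedIdeal F w} {JY : GradedIdeal F v} {𝒢 : EquivGroup}
  {R S : Type*} [CommRing R] [Algebra F R] [CommRing S] [Algebra F S]

lemma IsPoint.map {f g : Fin m → MvPolynomial (Fin n) R}
    {a : Fin n → MvPolynomial (Fin n) R} {b : Fin m → MvPolynomial (Fin m) R}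
    (h : IsPoint JX JY 𝒢 f g a b) (φ : R →ₐ[F] S) :
    IsPoint JX JY 𝒢 (fun j ↦ MvPolynomial.map (φ : R →+* S) (f j))
      (fun j ↦ MvPolynomial.map (φ : R →+* S) (g j))
      (fun j ↦ MvPolynomial.map (φ : R →+* S) (a j))
      (fun j ↦ MvPolynomial.map (φ : R →+* S) (b j)) := by
  have hmem {τ : Type} {J : Ideal (MvPolynomial τ F)} {q : MvPolynomial τ R}
      (hq : q ∈ J.map (MvPolynomial.map (algebraMap F R))) :
      MvPolynomial.map (φ : R →+* S) q ∈ J.map (MvPolynomial.map (algebraMap F S)) := by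
    have h1 := Ideal.mem_map_of_mem (MvPolynomial.map (φ : R →+* S)) hq
    have h2 : (MvPolynomial.map (φ : R →+* S)).comp (MvPolynomial.map (algebraMap F R)) =
        (MvPolynomial.map (algebraMap F S) : MvPolynomial τ F →+* _) := by
      refine RingHom.ext fun x ↦ ?_
      rw [RingHom.comp_apply, MvPolynomial.map_map, AlgHom.comp_algebraMap]
    rwa [Ideal.map_map, h2] at h1
  rw [isPoint_iff] at h ⊢
  refine ⟨fun x ↦ ?_, fun y ↦ ?_⟩
  · rw [← XIndex.map_elem]
    exact hmem (h.1 x)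
  · rw [← YIndex.map_elem]
    exact hmem (h.2 y)

end IsPointMap
end GradedFamily

namespace GradedFamily
open AlgebraicGeometry CategoryTheory
attribute [local instance] MvPolynomial.weightedGradedAlgebra
open MvPolynomial

/-! ### Automorphisms from substitutions close to the identity. -/

section Automorphism
variable {F : Type u} [Field F] {n : ℕ} {w : Fin n → ℕ} {J : GradedIdeal F w}
  {R : Type*} [CommRing R] [Algebra F R]

/-- A graded endomorphism that is the identity modulo an ideal in the radical is an automorphism. -/
theorem exists_gradedAut (hw : ∀ i, 0 < w i) {𝔪 : Ideal R} (h𝔪 : 𝔪 ≤ Ideal.jacobson ⊥)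
    {a : Fin n → MvPolynomial (Fin n) R} (ha : ∀ i, IsWeightedHomogeneous w (a i) (w i))
    (ha' : ∀ i, a i - X i ∈ 𝔪.map C)
    (hJ : ∀ q ∈ J.toIdeal, aeval a (map (algebraMap F R) q) ∈ extIdeal J R) :
    ∃ α : GradedAut J R, ∀ p, α.toAlgEquiv (Ideal.Quotient.mk _ p) =
      Ideal.Quotient.mk _ (aeval a p) := by
  classical
  let A : CoordRing J R →ₐ[R] CoordRing J R := Ideal.Quotient.liftₐ (extIdeal J R)
    ((Ideal.Quotient.mkₐ R (extIdeal J R)).comp (aeval a)) fun q hq ↦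
      Ideal.Quotient.eq_zero_iff_mem.mpr (aeval_mem_map hJ hq)
  have hA (p) : A (Ideal.Quotient.mk _ p) = Ideal.Quotient.mk _ (aeval a p) := rfl
  have hmem (d) (x) (hx : x ∈ grading J R d) : A x ∈ grading J R d := by
    obtain ⟨p, hp, rfl⟩ := hx
    exact mk_mem_grading J R (GradedMorphism.isWeightedHomogeneous_aeval ha hp)
  have hfg (d) : (grading J R d).FG := (weightedHomogeneousSubmodule_fg R w (fun i ↦ (hw i).ne') d).map _
  let T (d) : grading J R d →ₗ[R] grading J R d := A.toLinearMap.restrict (hmem d)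
  -- Nakayama's lemma in each degree: the graded pieces are finitely generated because the weights
  -- are positive, and `A` is the identity modulo `𝔪`.
  have hle (d) : grading J R d ≤ (grading J R d).map A.toLinearMap := by
    refine Submodule.le_of_le_smul_of_le_jacobson_bot (hfg d) h𝔪 ?_
    rintro _ ⟨p, hp, rfl⟩
    have h1 : aeval a p - p ∈ 𝔪 • weightedHomogeneousSubmodule R w d := by
      have h2 := aeval_sub_mem_of_sub_X_mem ha' p
      have h3 : IsWeightedHomogeneous w (aeval a p - p) d :=
        Submodule.sub_mem (weightedHomogeneousSubmodule R w d)
          (GradedMorphism.isWeightedHomogeneous_aeval ha hp) hp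
      rw [(aeval a p - p).as_sum]
      refine Submodule.sum_mem _ fun e he ↦ ?_
      rw [← mul_one (coeff e _), ← smul_eq_mul, ← smul_monomial]
      exact Submodule.smul_mem_smul (mem_map_C_iff.mp h2 e)
        (isWeightedHomogeneous_monomial w e 1 (h3 (mem_support_iff.mp he)))
    have h2 := Submodule.mem_map_of_mem (f := (Ideal.Quotient.mkₐ R (extIdeal J R)).toLinearMap) h1
    rw [Submodule.map_smul'', map_sub] at h2
    have h3 : (Ideal.Quotient.mkₐ R (extIdeal J R)).toLinearMap p =
        A.toLinearMap (Ideal.Quotient.mk _ p) -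
        ((Ideal.Quotient.mkₐ R (extIdeal J R)).toLinearMap (aeval a p) -
          (Ideal.Quotient.mkₐ R (extIdeal J R)).toLinearMap p) := (sub_sub_cancel _ _).symm
    rw [h3]
    exact Submodule.sub_mem _ (Submodule.mem_sup_left ⟨_, mk_mem_grading J R hp, rfl⟩)
      (Submodule.mem_sup_right h2)
  have hTsurj (d) : Function.Surjective (T d) := by
    rintro ⟨x, hx⟩
    obtain ⟨y, hy, hyx⟩ := hle d hx
    exact ⟨⟨y, hy⟩, Subtype.ext hyx⟩
  -- A surjective endomorphism of a finitely generated module over a commutative ring is injective.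
  have hTinj (d) : Function.Injective (T d) := by
    have := Module.Finite.iff_fg.mpr (hfg d)
    exact OrzechProperty.injective_of_surjective_endomorphism (T d) (hTsurj d)
  have hAinj0 (d) (x) (hx : x ∈ grading J R d) (h0 : A x = 0) : x = 0 := by
    have : (⟨x, hx⟩ : grading J R d) = 0 := hTinj d (Subtype.ext (h0.trans (by simp)))
    exact congrArg Subtype.val this
  have hdec (d) (x) : (DirectSum.decompose (grading J R) (A x) d : CoordRing J R) =
      A (DirectSum.decompose (grading J R) x d) := by
    induction x using DirectSum.Decomposition.inductionOn (grading J R) with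
    | zero => simp
    | @homogeneous i y =>
      by_cases hid : i = d
      · subst hid
        rw [DirectSum.decompose_of_mem_same _ (hmem i _ y.2), DirectSum.decompose_of_mem_same _ y.2]
      · rw [DirectSum.decompose_of_mem_ne _ (hmem i _ y.2) hid,
          DirectSum.decompose_of_mem_ne _ y.2 hid, map_zero]
    | add x y hx hy => simp only [map_add, DirectSum.decompose_add, DirectSum.add_apply,
        Submodule.coe_add, hx, hy]
  have hinj : Function.Injective A := by
    rw [injective_iff_map_eq_zero]
    intro x hx
    rw [← DirectSum.sum_support_decompose (grading J R) x]
    refine Finset.sum_eq_zero fun d _ ↦ hAinj0 d _ (DirectSum.decompose (grading J R) x d).2 ?_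
    rw [← hdec, hx]
    simp
  have hsurj : Function.Surjective A := by
    intro x
    rw [← DirectSum.sum_support_decompose (grading J R) x]
    have hy (d : ℕ) : ∃ y, A y = DirectSum.decompose (grading J R) x d := by
      obtain ⟨y, -, hy⟩ := hle d (DirectSum.decompose (grading J R) x d).2
      exact ⟨y, hy⟩
    choose y hy using hy
    exact ⟨∑ d ∈ (DirectSum.decompose (grading J R) x).support, y d, by
      rw [map_sum]; exact Finset.sum_congr rfl fun d _ ↦ hy d⟩
  refine ⟨⟨AlgEquiv.ofBijective A ⟨hinj, hsurj⟩, fun d x ↦ ⟨fun h ↦ ?_, hmem d x⟩⟩, hA⟩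
  have h1 : A x = A (DirectSum.decompose (grading J R) x d) := by
    rw [← hdec]
    exact (DirectSum.decompose_of_mem_same _ h).symm
  rw [hinj h1]
  exact (DirectSum.decompose (grading J R) x d).2

end Automorphism
end GradedFamily

namespace GradedFamily
open AlgebraicGeometry CategoryTheory
attribute [local instance] MvPolynomial.weightedGradedAlgebra
open MvPolynomial

/-! ### Descent of global triviality under abstract hypotheses on the base rings. -/

section Descent
variable {F : Type u} [Field F] {n m : ℕ} {w : Fin n → ℕ} {v : Fin m → ℕ}
  {JX : GradedIdeal F w} {JY : GradedIdeal F v} {𝒢 : EquivGroup}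

namespace GradedAut
variable {R S : Type*} [CommRing R] [Algebra F R] [CommRing S] [Algebra F S]

/-- The inverse automorphism. -/
noncomputable def symm (α : GradedAut JX R) : GradedAut JX R :=
  ⟨α.toAlgEquiv.symm, fun i x ↦ by rw [← α.map_mem_iff, AlgEquiv.apply_symm_apply]⟩

lemma symm_comp (α : GradedAut JX R) :
    α.symm.toGradedMorphism.comp α.toGradedMorphism = .id JX R :=
  GradedMorphism.ext_X fun _ ↦ α.toAlgEquiv.symm_apply_apply _

lemma comp_symm (α : GradedAut JX R) :
    α.toGradedMorphism.comp α.symm.toGradedMorphism = .id JX R :=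
  GradedMorphism.ext_X fun _ ↦ α.toAlgEquiv.apply_symm_apply _

lemma eq_refl {α : GradedAut JX R} {a : Fin n → MvPolynomial (Fin n) R}
    (hα : ∀ p, α.toAlgEquiv (Ideal.Quotient.mk _ p) = Ideal.Quotient.mk _ (aeval a p))
    (ha : ∀ i, a i - X i ∈ extIdeal JX R) : α = refl := by
  have : α.toAlgEquiv = AlgEquiv.refl := by
    refine AlgEquiv.ext fun x ↦ ?_
    obtain ⟨p, rfl⟩ := Ideal.Quotient.mk_surjective x
    rw [hα]
    exact Ideal.Quotient.eq.mpr (aeval_sub_mem_of_sub_X_mem ha p)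
  cases α
  subst this
  rfl

end GradedAut

variable {k K : Type*} [CommRing k] [Algebra F k] [CommRing K] [Algebra F K]

/-- An arbitrary lift `c` has `ρ(c) ≡ X` only modulo `J_X`. The lift `c - ρ(c) + X` represents the
same map, and idempotence of `ρ` puts its difference from `X` into `ker ρ` on the nose. -/
lemma GradedMorphism.exists_lift_of_baseChange_eq_id {ρ : K →ₐ[F] K} {α : GradedMorphism JX JX K}
    (hα : α.baseChange ρ = .id JX K) (hρ : ρ.comp ρ = ρ) :
    ∃ a : Fin n → MvPolynomial (Fin n) K, (∀ i, IsWeightedHomogeneous w (a i) (w i)) ∧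
      (∀ i, Ideal.Quotient.mk (extIdeal JX K) (a i) = α.hom (Ideal.Quotient.mk _ (X i))) ∧
      ∀ i, a i - X i ∈ (RingHom.ker ρ).map C := by
  obtain ⟨c, hc1, hc⟩ := α.exists_lift
  refine ⟨fun i ↦ c i - map (ρ : K →+* K) (c i) + X i, fun i ↦ ?_, fun i ↦ ?_, fun i ↦ ?_⟩
  · exact Submodule.add_mem (weightedHomogeneousSubmodule K w (w i)) (Submodule.sub_mem _ (hc1 i)
      (isWeightedHomogeneous_map _ (hc1 i))) (isWeightedHomogeneous_X K w i)
  · have := GradedMorphism.lift_baseChange hc ρ i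
    rw [hα, GradedMorphism.id_hom_apply] at this
    rw [map_add, map_sub, this, sub_add_cancel, hc]
  · rw [add_sub_cancel_right, mem_map_C_iff]
    intro d
    rw [RingHom.mem_ker, coeff_sub, coeff_map, map_sub]
    have := DFunLike.congr_fun hρ (coeff d (c i))
    exact sub_eq_zero.mpr this.symm

/-- Over `K` a family that is globally trivial is so by a pair of automorphisms that is the identity
over the retract `ρ(K)`. -/
lemma exists_isPoint_of_globallyTrivial (hw : ∀ i, 0 < w i) (hv : ∀ j, 0 < v j) {o : k →ₐ[F] F}
    {φ : k →ₐ[F] K} {ρ : K →ₐ[F] K} (hρ : ρ.comp ρ = ρ)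
    (hρφ : ρ.comp φ = (Algebra.ofId F K).comp o) {f : GradedMorphism JX JY k}
    {fl : Fin m → MvPolynomial (Fin n) k} (hfl1 : ∀ j, IsWeightedHomogeneous w (fl j) (v j))
    (hfl : ∀ j, Ideal.Quotient.mk (extIdeal JX k) (fl j) = f.hom (Ideal.Quotient.mk _ (X j)))
    (hK : GloballyTrivial 𝒢 f o φ) :
    ∃ (a : Fin n → MvPolynomial (Fin n) K) (b : Fin m → MvPolynomial (Fin m) K),
      (∀ j, IsWeightedHomogeneous w (a j) (w j)) ∧ (∀ j, IsWeightedHomogeneous v (b j) (v j)) ∧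
      (∀ j, a j - X j ∈ (RingHom.ker ρ).map C) ∧ (∀ j, b j - X j ∈ (RingHom.ker ρ).map C) ∧
      IsPoint JX JY 𝒢 (fun j ↦ map (φ : k →+* K) (fl j))
        (fun j ↦ map (algebraMap F K) (map (o : k →+* F) (fl j))) a b := by
  obtain ⟨α', β', hmem, heq⟩ := hK
  set fK := f.baseChange φ
  set gK := (f.baseChange o).baseChange (Algebra.ofId F K)
  -- The constant family is the base change of the family along the retraction `ρ`, and `ρ` leaves
  -- it unchanged.
  have hgK : gK = fK.baseChange ρ := by
    simp only [gK, fK, GradedMorphism.baseChange_baseChange, hρφ]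
  have hgKρ : gK.baseChange ρ = gK := by
    rw [hgK, GradedMorphism.baseChange_baseChange, hρ]
  have hgl (j) : Ideal.Quotient.mk (extIdeal JX K)
      (map (algebraMap F K) (map (o : k →+* F) (fl j))) = gK.hom (Ideal.Quotient.mk _ (X j)) :=
    GradedMorphism.lift_baseChange (GradedMorphism.lift_baseChange hfl o) (Algebra.ofId F K) j
  set α := α'.toGradedMorphism
  set β := β'.toGradedMorphism
  obtain ⟨a, ha1, ha⟩ := α.exists_lift
  obtain ⟨b, hb1, hb⟩ := β.exists_lift
  have hfK := GradedMorphism.lift_baseChange hfl φ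
  -- The value of the trivialisation at the special point preserves the constant family. Equality of
  -- morphisms is base changed through the algebraic description by points, for which the group
  -- `.leftRight` imposes nothing more.
  have h0 : (α.baseChange ρ).proj ≫ gK.proj ≫ (β.baseChange ρ).proj = gK.proj := by
    have hpt := (GradedMorphism.isPoint_of_proj_eq (𝒢 := .leftRight) hw hv ha hb hfK hgl
      (by simp) (by simp) heq).map ρ
    refine GradedMorphism.proj_eq_of_isPoint hw hv (fun j ↦ isWeightedHomogeneous_map _ (ha1 j))
      (fun j ↦ isWeightedHomogeneous_map _ (hb1 j))
      (fun j ↦ isWeightedHomogeneous_map _ (isWeightedHomogeneous_map _ (hfl1 j)))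
      (GradedMorphism.lift_baseChange ha ρ) (GradedMorphism.lift_baseChange hb ρ)
      (fun j ↦ ?_) (fun j ↦ ?_) hpt
    · rw [GradedMorphism.lift_baseChange hfK ρ, ← hgK]
    · rw [GradedMorphism.lift_baseChange hgl ρ, hgKρ]
  -- Correct the trivialisation by the inverse of its own value at the special point; the corrected
  -- pair reduces to the identity along `ρ`.
  set α₁ := (α'.symm.toGradedMorphism.baseChange ρ).comp α
  set β₁ := β.comp (β'.symm.toGradedMorphism.baseChange ρ)
  have h1 : α₁.proj ≫ fK.proj ≫ β₁.proj = gK.proj := by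
    have h2 : (α'.symm.toGradedMorphism.baseChange ρ).proj ≫ gK.proj ≫
        (β'.symm.toGradedMorphism.baseChange ρ).proj = gK.proj := by
      conv_lhs => rw [← h0]
      simp only [GradedMorphism.proj_comp]
      congr 1
      rw [GradedMorphism.comp_assoc, GradedMorphism.comp_assoc, ← GradedMorphism.comp_assoc]
      rw [← GradedMorphism.baseChange_comp, ← GradedMorphism.baseChange_comp, GradedAut.comp_symm,
        GradedAut.symm_comp, GradedMorphism.baseChange_id, GradedMorphism.baseChange_id,
        GradedMorphism.comp_id, GradedMorphism.id_comp]
    calc α₁.proj ≫ fK.proj ≫ β₁.proj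
        = (α'.symm.toGradedMorphism.baseChange ρ).proj ≫ (α.proj ≫ fK.proj ≫ β.proj) ≫
          (β'.symm.toGradedMorphism.baseChange ρ).proj := by
          simp only [Category.assoc, α₁, β₁, ← GradedMorphism.proj_comp]
      _ = gK.proj := by rw [heq, h2]
  have hα₁ : α₁.baseChange ρ = .id JX K := by
    rw [GradedMorphism.baseChange_comp, GradedMorphism.baseChange_baseChange, hρ,
      ← GradedMorphism.baseChange_comp, GradedAut.symm_comp, GradedMorphism.baseChange_id]
  have hβ₁ : β₁.baseChange ρ = .id JY K := by
    rw [GradedMorphism.baseChange_comp, GradedMorphism.baseChange_baseChange, hρ,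
      ← GradedMorphism.baseChange_comp, GradedAut.comp_symm, GradedMorphism.baseChange_id]
  obtain ⟨a₁, ha₁1, ha₁, ha₁'⟩ := GradedMorphism.exists_lift_of_baseChange_eq_id hα₁ hρ
  obtain ⟨b₁, hb₁1, hb₁, hb₁'⟩ := GradedMorphism.exists_lift_of_baseChange_eq_id hβ₁ hρ
  refine ⟨a₁, b₁, ha₁1, hb₁1, ha₁', hb₁', GradedMorphism.isPoint_of_proj_eq hw hv ha₁ hb₁ hfK hgl
    (fun hG ↦ ?_) (fun hG ↦ ?_) h1⟩
  · subst hG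
    have hα : α = .id JX K := congrArg GradedAut.toGradedMorphism (hmem : α' = GradedAut.refl)
    have h2 : α'.symm.toGradedMorphism.comp α = .id JX K := α'.symm_comp
    rw [hα, GradedMorphism.comp_id] at h2
    simp only [α₁]
    rw [h2, hα, GradedMorphism.comp_id, GradedMorphism.baseChange_id]
  · subst hG
    have hβ : β = .id JY K := congrArg GradedAut.toGradedMorphism (hmem : β' = GradedAut.refl)
    have h2 : β.comp β'.symm.toGradedMorphism = .id JY K := β'.comp_symm
    rw [hβ, GradedMorphism.id_comp] at h2
    simp only [β₁]
    rw [h2, hβ, GradedMorphism.id_comp, GradedMorphism.baseChange_id]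

/-- Descent of global triviality, for base rings with the implicit function theorem. -/
theorem globallyTrivial_descent [CharZero F] (hw : ∀ i, 0 < w i) (hv : ∀ j, 0 < v j)
    {o : k →ₐ[F] F} (himp : HasImplicitSolutions o) (hloc : RingHom.ker o ≤ Ideal.jacobson ⊥)
    {φ : k →ₐ[F] K} {ρ : K →ₐ[F] K} (hρ : ρ.comp ρ = ρ)
    (hρφ : ρ.comp φ = (Algebra.ofId F K).comp o)
    (hsep : ∀ x, (∀ L : ℕ, φ x ∈ RingHom.ker ρ ^ L) → x = 0) (f : GradedMorphism JX JY k)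
    (hK : GloballyTrivial 𝒢 f o φ) : GloballyTrivial 𝒢 f o (AlgHom.id F k) := by
  obtain ⟨fl, hfl1, hfl⟩ := f.exists_lift
  obtain ⟨a, b, ha, hb, ha', hb', hab⟩ :=
    exists_isPoint_of_globallyTrivial hw hv hρ hρφ hfl1 hfl hK
  have hgl := GradedMorphism.lift_baseChange hfl o
  -- The nilpotent thickenings are the quotients of `K` by the powers of `ker ρ`; the solution over
  -- `K` gives a point near the identity in each of them.
  let Q (L : ℕ) : K →ₐ[F] K ⧸ (RingHom.ker ρ ^ L) := Ideal.Quotient.mkₐ F _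
  have hQ (L : ℕ) {τ : Type} {p : MvPolynomial τ K} (i : τ) (hp : p - X i ∈ (RingHom.ker ρ).map C) :
      map (Q L : K →+* K ⧸ (RingHom.ker ρ ^ L)) p - X i ∈ ((RingHom.ker ρ).map (Q L : K →+* K ⧸ (RingHom.ker ρ ^ L))).map C := by
    have := Ideal.mem_map_of_mem (map (Q L : K →+* K ⧸ (RingHom.ker ρ ^ L))) hp
    have hC : (map (Q L : K →+* K ⧸ (RingHom.ker ρ ^ L)) : MvPolynomial τ K →+* _).comp C =
        C.comp (Q L : K →+* K ⧸ (RingHom.ker ρ ^ L)) := RingHom.ext fun x ↦ map_C _ _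
    rwa [map_sub, map_X, Ideal.map_map, hC, ← Ideal.map_map] at this
  obtain ⟨a₁, b₁, ha₁, hb₁, ha₁', hb₁', hab₁⟩ := exists_isPoint (JX := JX) (JY := JY) (𝒢 := 𝒢) hw hv
    himp (f := fl) (by
      intro i
      have := GradedMorphism.X_mem_radical hw (f.baseChange o) hgl i
      have hJ : extIdeal JX F = JX.toIdeal := by
        have h3 : (map (algebraMap F F) : MvPolynomial (Fin n) F →+* _) = RingHom.id _ :=
          RingHom.ext fun x ↦ MvPolynomial.map_id x
        rw [extIdeal, h3, Ideal.map_id]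
      rwa [hJ] at this) (fun L : ℕ ↦ K ⧸ (RingHom.ker ρ ^ L)) (fun L ↦ (Q L).comp φ)
    (fun L ↦ (RingHom.ker ρ).map (Q L : K →+* K ⧸ (RingHom.ker ρ ^ L)))
    (fun L ↦ ⟨L, by
      rw [← Ideal.map_pow]
      exact Ideal.map_quotient_self _⟩)
    (fun L x hx ↦ Ideal.mem_map_of_mem (Q L : K →+* K ⧸ (RingHom.ker ρ ^ L)) (by
      have := DFunLike.congr_fun hρφ x
      rw [AlgHom.comp_apply, AlgHom.comp_apply, hx, map_zero] at this
      exact this))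
    (fun x hx ↦ hsep x fun L ↦ Ideal.Quotient.eq_zero_iff_mem.mp (hx L))
    (fun L ↦ ⟨_, _, fun j ↦ isWeightedHomogeneous_map (Q L : K →+* K ⧸ (RingHom.ker ρ ^ L)) (ha j),
      fun j ↦ isWeightedHomogeneous_map (Q L : K →+* K ⧸ (RingHom.ker ρ ^ L)) (hb j), fun j ↦ hQ L j (ha' j),
      fun j ↦ hQ L j (hb' j), by
        convert hab.map (Q L) using 2 with j j
        · rw [MvPolynomial.map_map]; rfl
        · exact congrArg (fun φ ↦ MvPolynomial.map φ (MvPolynomial.map (o : k →+* F) (fl j)))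
            (AlgHom.comp_algebraMap (Q L)).symm |>.trans (MvPolynomial.map_map _ _ _).symm⟩)
  have hker {τ : Type} {p : MvPolynomial τ k} {i : τ} (hp : map (o : k →+* F) p = X i) :
      p - X i ∈ (RingHom.ker o).map C := by
    rw [mem_map_C_iff]
    intro d
    rw [RingHom.mem_ker]
    have := congrArg (coeff d) (sub_eq_zero.mpr hp)
    rwa [← map_X (o : k →+* F) i, ← map_sub, coeff_map, coeff_zero] at this
  obtain ⟨α, hα⟩ := exists_gradedAut (J := JX) hw hloc ha₁ (fun i ↦ hker (ha₁' i)) hab₁.mapX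
  obtain ⟨β, hβ⟩ := exists_gradedAut (J := JY) hv hloc hb₁ (fun i ↦ hker (hb₁' i)) hab₁.mapY
  refine ⟨α, β, ?_, GradedMorphism.proj_eq_of_isPoint hw hv ha₁ hb₁ hfl1 (fun i ↦ ?_) (fun i ↦ ?_)
    (fun j ↦ ?_) (GradedMorphism.lift_baseChange hgl (Algebra.ofId F k)) hab₁⟩
  · cases 𝒢 with
    | right => exact GradedAut.eq_refl hβ (hab₁.right rfl)
    | left => exact GradedAut.eq_refl hα (hab₁.left rfl)
    | leftRight => trivial
  · have := hα (X i)
    rw [aeval_X] at this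
    exact this.symm
  · have := hβ (X i)
    rw [aeval_X] at this
    exact this.symm
  · have := GradedMorphism.lift_baseChange hfl (AlgHom.id F k) j
    rw [← this]
    exact congrArg _ (MvPolynomial.map_id _).symm

end Descent
end GradedFamily

namespace GradedFamily
attribute [local instance] MvPolynomial.weightedGradedAlgebra
open MvPolynomial

/-! ### Implicit solutions: passage to quotients and to the Jacobson radical. -/

section Quotient
variable {F : Type*} [Field F] {k k' : Type*} [CommRing k] [Algebra F k] [CommRing k'] [Algebra F k']

/-- Lift the coefficients of the system: values and differentials at `p` depend only on the
reduction to `F`, so the lifted system has the same initial data. -/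
lemma HasImplicitSolutions.of_surjective {o : k →ₐ[F] F} (h : HasImplicitSolutions o)
    (π : k →ₐ[F] k') (hπ : Function.Surjective π) {o' : k' →ₐ[F] F} (ho : o'.comp π = o) :
    HasImplicitSolutions o' := by
  intro N Q p hp hli
  have hmap (P : MvPolynomial (Fin N) k) : map (o : k →+* F) P =
      map (o' : k' →+* F) (map (π : k →+* k') P) := by
    rw [MvPolynomial.map_map, ← ho]
    rfl
  choose Q' hQ' using fun i ↦ MvPolynomial.map_surjective (π : k →+* k') hπ (Q i)
  obtain ⟨z, hz, hz'⟩ := h N Q' p (fun i ↦ by rw [hmap, hQ', hp]) (by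
    convert hli using 2 with i
    funext j
    rw [differentialAt, differentialAt, hmap, ← hQ', pderiv_map])
  refine ⟨fun j ↦ π (z j), fun j ↦ by rw [← hz, ← ho]; rfl, fun i ↦ ?_⟩
  rw [← hQ', eval_map]
  refine (map_eval_eq_eval₂ (π : k →+* k') z (Q' i)).symm.trans ?_
  rw [hz', map_zero]

lemma HasImplicitSolutions.quotient {I : Ideal k} {o : k →ₐ[F] F} (h : HasImplicitSolutions o)
    (o' : k ⧸ I →ₐ[F] F) (ho : ∀ x, o' (Ideal.Quotient.mk I x) = o x) : HasImplicitSolutions o' :=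
  h.of_surjective (Ideal.Quotient.mkₐ F I) (Ideal.Quotient.mkₐ_surjective F I) (AlgHom.ext ho)

/-- Inverting `x * y + 1` is the one-variable system `(x * y + 1) X = 1`, which reduces to `X = 1`
with derivative 1. -/
lemma HasImplicitSolutions.ker_le_jacobson {o : k →ₐ[F] F} (h : HasImplicitSolutions o) :
    RingHom.ker o ≤ Ideal.jacobson ⊥ := by
  intro x hx
  rw [Ideal.mem_jacobson_bot]
  intro y
  have hxy : o (x * y + 1) = 1 := by rw [map_add, _root_.map_mul, (hx : o x = 0)]; simp
  obtain ⟨z, -, hz⟩ := h 1 (fun _ ↦ C (x * y + 1) * X 0 - 1) (fun _ ↦ 1)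
    (fun i ↦ by
      simp only [map_sub, _root_.map_mul, map_C, map_X, map_one, eval_C, eval_X, RingHom.coe_coe]
      rw [hxy]; simp)
    (by
      refine linearIndependent_unique_iff.mpr fun h0 ↦ ?_
      have := congrFun h0 0
      simp only [differentialAt, map_sub, pderiv_C_mul, pderiv_one, pderiv_X_self, sub_zero,
        map_C, mul_one, eval_C, RingHom.coe_coe, Pi.zero_apply] at this
      rw [hxy] at this
      simp at this)
  have h1 := hz 0
  rw [map_sub, _root_.map_mul, eval_C, eval_X, map_one, sub_eq_zero] at h1
  exact IsUnit.of_mul_eq_one _ h1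

end Quotient

lemma exists_mem_pow_of_mem_pow {A B : Type*} [CommRing A] [CommRing B] {q : A →+* B}
    (hq : Function.Surjective q) {𝔪 : Ideal A} {𝔠 : Ideal B} (h : 𝔠 ≤ 𝔪.map q) {y : B} {L : ℕ}
    (hy : y ∈ 𝔠 ^ L) : ∃ r ∈ 𝔪 ^ L, q r = y := by
  have h1 := Ideal.pow_right_mono h L hy
  rw [← Ideal.map_pow] at h1
  exact (Ideal.mem_map_iff_of_surjective _ hq).mp h1

/-! ### From closed ideals to joint injectivity of the thickenings. -/

section Closedness
variable {F : Type u} {E : Type v} [Field F] [Field E] [Algebra F E] {l : ℕ}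
  {SF : Subalgebra F (MvPowerSeries (Fin l) F)} {SE : Subalgebra E (MvPowerSeries (Fin l) E)}

/-- The value at `0` of the series in `S`. -/
noncomputable def constHom (S : Subalgebra F (MvPowerSeries (Fin l) F)) : S →ₐ[F] F where
  __ := (MvPowerSeries.constantCoeff (σ := Fin l) (R := F)).comp
        (S.val : S →+* MvPowerSeries (Fin l) F)
  commutes' c := by
    change MvPowerSeries.constantCoeff (algebraMap F (MvPowerSeries (Fin l) F) c) = c
    rw [MvPowerSeries.algebraMap_apply, MvPowerSeries.constantCoeff_C]
    rfl

/-- The ideals of `S` are closed in the topology of coefficientwise convergence. -/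
def HasClosedIdeals (S : Subalgebra F (MvPowerSeries (Fin l) F)) : Prop :=
  ∀ (I : Ideal S) (b : S), (∀ L : ℕ, ∃ a ∈ I, ∀ d : Fin l →₀ ℕ, d.degree < L →
    MvPowerSeries.coeff d (b : MvPowerSeries (Fin l) F) =
      MvPowerSeries.coeff d (a : MvPowerSeries (Fin l) F)) → b ∈ I

lemma coe_mem_nashSeries (p : MvPolynomial (Fin l) F) :
    (p : MvPowerSeries (Fin l) F) ∈ nashSeries F l :=
  isAlgebraic_algebraMap (A := MvPowerSeries (Fin l) F) p

lemma coe_mem_convergentSeries (a : AbsoluteValue F ℝ) (p : MvPolynomial (Fin l) F) :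
    (p : MvPowerSeries (Fin l) F) ∈ convergentSeries a l := by
  refine ⟨1, one_pos, summable_of_ne_finset_zero (s := p.support) fun d hd ↦ ?_⟩
  rw [MvPolynomial.coeff_coe, notMem_support_iff.mp hd, map_zero, zero_mul]

lemma IsSeriesPair.coe_mem (h : IsSeriesPair SF SE) (p : MvPolynomial (Fin l) F) :
    (p : MvPowerSeries (Fin l) F) ∈ SF := by
  cases h with
  | formal => trivial
  | nash => exact coe_mem_nashSeries p
  | analytic a _ _ _ _ _ => exact coe_mem_convergentSeries a p

/-- The series with the same coefficients of degree less than `L`. -/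
noncomputable def truncBelow (L : ℕ) (p : MvPowerSeries (Fin l) F) : MvPolynomial (Fin l) F :=
  MvPowerSeries.truncFinset F ((Finsupp.finite_of_degree_le (σ := Fin l) L).toFinset) p

lemma coeff_truncBelow {L : ℕ} (p : MvPowerSeries (Fin l) F) {d : Fin l →₀ ℕ} (hd : d.degree < L) :
    MvPowerSeries.coeff d (truncBelow L p : MvPowerSeries (Fin l) F) =
      MvPowerSeries.coeff d p := by
  rw [MvPolynomial.coeff_coe]
  exact MvPowerSeries.coeff_truncFinset_of_mem _ (by simpa using hd.le)

/-- Elements of `I S_E` are, after applying an `F`-linear retraction to the coefficients,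
approximated by elements of `I`. -/
lemma IsSeriesPair.exists_approx (h : IsSeriesPair SF SE) (π : E →ₗ[F] F)
    (I : Ideal SF) (L : ℕ) {x : SE} (hx : x ∈ I.map h.map) :
    ∃ a ∈ I, ∀ d : Fin l →₀ ℕ, d.degree < L →
      π (MvPowerSeries.coeff d (x : MvPowerSeries (Fin l) E)) =
        MvPowerSeries.coeff d (a : MvPowerSeries (Fin l) F) := by
  classical
  -- Strengthened by a multiplier `s`: the retraction `π` is only `F`-linear, so the statement for
  -- `x` alone does not pass to multiples.
  suffices H : ∀ s : SE, ∃ a ∈ I, ∀ d : Fin l →₀ ℕ, d.degree < L →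
      π (MvPowerSeries.coeff d ((s * x : SE) : MvPowerSeries (Fin l) E)) =
        MvPowerSeries.coeff d (a : MvPowerSeries (Fin l) F) by
    simpa using H 1
  induction hx using Submodule.span_induction with
  | mem x hx =>
    obtain ⟨a, ha, rfl⟩ := hx
    intro s
    -- Applying `π` coefficientwise turns `s * a` into `s' * a`. The series `s'` need not belong to
    -- `S_F`, but its truncation is a polynomial and agrees with it in the degrees considered.
    let s' : MvPowerSeries (Fin l) F := fun d ↦ π (MvPowerSeries.coeff d (s : MvPowerSeries _ E))
    refine ⟨⟨truncBelow L s', h.coe_mem _⟩ * a, I.mul_mem_left _ ha, fun d hd ↦ ?_⟩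
    have e1 : ((s * h.map a : SE) : MvPowerSeries (Fin l) E) =
      s * MvPowerSeries.map (algebraMap F E) (a : MvPowerSeries (Fin l) F) := rfl
    rw [e1, MvPowerSeries.coeff_mul, map_sum]
    change _ = MvPowerSeries.coeff d ((truncBelow L s' : MvPowerSeries (Fin l) F) *
      (a : MvPowerSeries (Fin l) F))
    rw [MvPowerSeries.coeff_mul]
    refine Finset.sum_congr rfl fun x hx ↦ ?_
    have hx1 : x.1.degree < L := by
      rw [← Finset.HasAntidiagonal.mem_antidiagonal.mp hx, map_add] at hd
      omega
    rw [coeff_truncBelow _ hx1, MvPowerSeries.coeff_map, mul_comm, ← Algebra.smul_def, map_smul,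
      smul_eq_mul, mul_comm]
    rfl
  | zero => exact fun s ↦ ⟨0, I.zero_mem, by simp⟩
  | add x y _ _ hx hy =>
    intro s
    obtain ⟨a, ha, ha'⟩ := hx s
    obtain ⟨b, hb, hb'⟩ := hy s
    refine ⟨a + b, I.add_mem ha hb, fun d hd ↦ ?_⟩
    have := congrArg₂ (· + ·) (ha' d hd) (hb' d hd)
    simp only [← map_add] at this
    rw [mul_add]
    exact this
  | smul c x _ hx =>
    intro s
    obtain ⟨a, ha, ha'⟩ := hx (s * c)
    exact ⟨a, ha, by rwa [smul_eq_mul, ← mul_assoc]⟩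

lemma coeff_eq_zero_of_mem_pow_ker {S : Subalgebra F (MvPowerSeries (Fin l) F)} {L : ℕ} {x : S}
    (hx : x ∈ RingHom.ker (constHom S) ^ L) {d : Fin l →₀ ℕ} (hd : d.degree < L) :
    MvPowerSeries.coeff d (x : MvPowerSeries (Fin l) F) = 0 := by
  let 𝔬 (L : ℕ) : Ideal S :=
    { carrier := {x | (L : ℕ∞) ≤ (x : MvPowerSeries (Fin l) F).order}
      zero_mem' := by simp
      add_mem' := fun {x y} hx hy ↦ (le_min hx hy).trans MvPowerSeries.min_order_le_add
      smul_mem' := fun c x hx ↦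
        ((hx : (L : ℕ∞) ≤ _).trans le_add_self).trans MvPowerSeries.le_order_mul }
  have h : ∀ L, RingHom.ker (constHom S) ^ L ≤ 𝔬 L := by
    intro L
    induction L with
    | zero => exact fun x _ ↦ (zero_le : ((0 : ℕ) : ℕ∞) ≤ _)
    | succ L ih =>
      rw [pow_succ, Ideal.mul_le]
      intro x hx y hy
      have h1 : (L : ℕ∞) ≤ (x : MvPowerSeries (Fin l) F).order := ih hx
      have h2 : 1 ≤ (y : MvPowerSeries (Fin l) F).order :=
        MvPowerSeries.one_le_order_iff_constCoeff_eq_zero.mpr hy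
      change ((L + 1 : ℕ) : ℕ∞) ≤ _
      rw [Nat.cast_add, Nat.cast_one]
      exact (add_le_add h1 h2).trans MvPowerSeries.le_order_mul
  exact MvPowerSeries.coeff_of_lt_order (lt_of_lt_of_le (by exact_mod_cast hd) (h L hx))

variable (h : IsSeriesPair SF SE) (I : Ideal SF)

lemma IsSeriesPair.constHom_eq_zero
    (hI : ∀ p ∈ I, MvPowerSeries.constantCoeff (p : MvPowerSeries (Fin l) F) = 0) {x : SE}
    (hx : x ∈ I.map h.map) : constHom SE x = 0 := by
  have : I.map h.map ≤ RingHom.ker (constHom SE) := by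
    rw [Ideal.map_le_iff_le_comap]
    intro p hp
    change MvPowerSeries.constantCoeff
      (MvPowerSeries.map (algebraMap F E) (p : MvPowerSeries (Fin l) F)) = 0
    rw [MvPowerSeries.constantCoeff_map, hI p hp, map_zero]
  exact this hx

/-- Evaluation at `0`, as an endomorphism of `S_E / I S_E`. -/
noncomputable def IsSeriesPair.retraction
    (hI : ∀ p ∈ I, MvPowerSeries.constantCoeff (p : MvPowerSeries (Fin l) F) = 0) :
    SE ⧸ I.map h.map →ₐ[F] SE ⧸ I.map h.map :=
  ((Algebra.ofId E (SE ⧸ I.map h.map)).comp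
    (Ideal.Quotient.liftₐ (I.map h.map) (constHom SE) fun _ hx ↦
      h.constHom_eq_zero I hI hx)).restrictScalars F

lemma IsSeriesPair.retraction_mk
    (hI : ∀ p ∈ I, MvPowerSeries.constantCoeff (p : MvPowerSeries (Fin l) F) = 0) (x : SE) :
    h.retraction I hI (Ideal.Quotient.mk _ x) =
      Ideal.Quotient.mk _ (algebraMap E SE (constHom SE x)) := rfl

/-- Global triviality descends if the implicit function theorem holds and ideals are closed. -/
theorem IsSeriesPair.globallyTrivial_descent [CharZero F]
    (hI : ∀ p ∈ I, MvPowerSeries.constantCoeff (p : MvPowerSeries (Fin l) F) = 0)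
    (himp : HasImplicitSolutions (constHom SF)) (hcl : HasClosedIdeals SF)
    {n m : ℕ} {w : Fin n → ℕ} {v : Fin m → ℕ} (hw : ∀ i, 0 < w i) (hv : ∀ j, 0 < v j)
    {JX : GradedIdeal F w} {JY : GradedIdeal F v} (f : GradedMorphism JX JY (SF ⧸ I))
    {𝒢 : EquivGroup} (hK : GloballyTrivial (R := SE ⧸ I.map h.map) 𝒢 f (valueAtZero I hI)
      (h.quotientMap I)) :
    GloballyTrivial (R := SF ⧸ I) 𝒢 f (valueAtZero I hI) (AlgHom.id F (SF ⧸ I)) := by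
  have himp' := himp.quotient (valueAtZero I hI) fun _ ↦ rfl
  refine GradedFamily.globallyTrivial_descent hw hv himp' himp'.ker_le_jacobson
    (ρ := h.retraction I hI) ?_ ?_ (fun x hx ↦ ?_) f hK
  · refine AlgHom.ext fun x ↦ ?_
    obtain ⟨p, rfl⟩ := Ideal.Quotient.mk_surjective x
    rw [AlgHom.comp_apply, h.retraction_mk, h.retraction_mk, AlgHom.commutes]
    rfl
  · refine AlgHom.ext fun x ↦ ?_
    obtain ⟨p, rfl⟩ := Ideal.Quotient.mk_surjective x
    have h1 : constHom SE (h.map p) = algebraMap F E (constHom SF p) :=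
      MvPowerSeries.constantCoeff_map _ _
    change h.retraction I hI (Ideal.Quotient.mk _ (h.map p)) = _
    rw [h.retraction_mk, h1, ← IsScalarTower.algebraMap_apply F E SE]
    rfl
  · obtain ⟨b, rfl⟩ := Ideal.Quotient.mk_surjective x
    rw [Ideal.Quotient.eq_zero_iff_mem]
    -- A linear retraction of `E` onto `F`, which brings information over `E` back to `F`.
    obtain ⟨π, hπ⟩ := (Algebra.linearMap F E).exists_leftInverse_of_injective
      (LinearMap.ker_eq_bot.mpr (algebraMap F E).injective)
    have hπ' (c : F) : π (algebraMap F E c) = c := DFunLike.congr_fun hπ c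
    refine hcl I b fun L ↦ ?_
    have hker : RingHom.ker (h.retraction I hI) ≤
        (RingHom.ker (constHom SE)).map (Ideal.Quotient.mk (I.map h.map)) := by
      intro y hy
      obtain ⟨p, rfl⟩ := Ideal.Quotient.mk_surjective y
      rw [RingHom.mem_ker, h.retraction_mk, Ideal.Quotient.eq_zero_iff_mem] at hy
      have := h.constHom_eq_zero I hI hy
      rw [AlgHom.commutes] at this
      exact Ideal.mem_map_of_mem _ this
    -- Thus `b` is an element of `I S_E` plus a series `r` of order at least `L`. The retraction
    -- makes `b` agree with an element of `I` below degree `L`, and closedness concludes.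
    obtain ⟨r, hr, hr'⟩ := exists_mem_pow_of_mem_pow Ideal.Quotient.mk_surjective hker (hx L)
    have h2 : h.map b - r ∈ I.map h.map := Ideal.Quotient.eq.mp hr'.symm
    obtain ⟨a, ha, ha'⟩ := h.exists_approx π I L h2
    refine ⟨a, ha, fun d hd ↦ ?_⟩
    rw [← ha' d hd]
    have h3 : ((h.map b - r : SE) : MvPowerSeries (Fin l) E) =
      MvPowerSeries.map (algebraMap F E) (b : MvPowerSeries (Fin l) F) - r := rfl
    rw [h3, map_sub, coeff_eq_zero_of_mem_pow_ker hr hd, sub_zero, MvPowerSeries.coeff_map, hπ']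

end Closedness
end GradedFamily

namespace GradedFamily
open MvPolynomial

/-! ### The implicit function theorem from fixed points. -/

section FixedPoints
variable {F : Type*} [Field F] {k : Type*} [CommRing k] [Algebra F k]

/-- Polynomial maps over `k` that vanish to second order along `o` at the origin have a fixed
point. -/
def HasFixedPoints (o : k →ₐ[F] F) : Prop :=
  ∀ (N : ℕ) (H : Fin N → MvPolynomial (Fin N) k),
    (∀ i, eval 0 (map (o : k →+* F) (H i)) = 0) → (∀ i, differentialAt o 0 (H i) = 0) →
    ∃ y : Fin N → k, (∀ j, o (y j) = 0) ∧ ∀ i, eval y (H i) = y i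

lemma pderiv_translate {σ : Type*} (p : σ → F) (j : σ) (P : MvPolynomial σ F) :
    pderiv j (aeval (fun i ↦ X i + C (p i)) P) = aeval (fun i ↦ X i + C (p i)) (pderiv j P) := by
  classical
  induction P using MvPolynomial.induction_on with
  | C a => simp [algebraMap_eq]
  | add P Q hP hQ => simp only [map_add, hP, hQ]
  | mul_X P i hP =>
    simp only [_root_.map_mul, aeval_X, pderiv_mul, hP, map_add, pderiv_C, add_zero, pderiv_X]
    by_cases h : i = j
    · subst h; simp
    · simp [h]

/-- Newton's method with a constant matrix: after translating `p` to the origin and multiplying by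
the inverse `c⁻¹` of the Jacobian, the solutions are the fixed points of `X - c⁻¹ Q(X + p)`, whose
value and differential at the origin vanish along `o`. -/
lemma HasFixedPoints.hasImplicitSolutions {o : k →ₐ[F] F} (h : HasFixedPoints o) :
    HasImplicitSolutions o := by
  classical
  intro N Q p hp hli
  let c : Matrix (Fin N) (Fin N) F := Matrix.of fun s ↦ differentialAt o p (Q s)
  have hcd : IsUnit c.det := (Matrix.isUnit_iff_isUnit_det _).mp
    (Matrix.linearIndependent_rows_iff_isUnit.mp hli)
  have hBc : c⁻¹ * c = 1 := Matrix.nonsing_inv_mul c hcd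
  have hcB : c * c⁻¹ = 1 := Matrix.mul_nonsing_inv c hcd
  let tr (s : Fin N) : MvPolynomial (Fin N) k :=
    aeval (fun j ↦ X j + C (algebraMap F k (p j))) (Q s)
  let H (i : Fin N) : MvPolynomial (Fin N) k := X i - ∑ s, C (algebraMap F k (c⁻¹ i s)) * tr s
  have hmaptr (s) : map (o : k →+* F) (tr s) =
      aeval (fun i ↦ X i + C (p i)) (map (o : k →+* F) (Q s)) := by
    simp only [tr, map_aeval_poly, map_add, map_X, map_C, RingHom.coe_coe, AlgHom.commutes]
    rfl
  have hev0 (P : MvPolynomial (Fin N) F) : eval 0 (aeval (fun i ↦ X i + C (p i)) P) = eval p P := by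
    induction P using MvPolynomial.induction_on with
    | C a => simp [algebraMap_eq]
    | add P Q hP hQ => simp only [map_add, hP, hQ]
    | mul_X P i hP => simp only [_root_.map_mul, hP, aeval_X, map_add, eval_X, eval_C]; simp
  have hmapH (i) : map (o : k →+* F) (H i) = X i - ∑ s, C (c⁻¹ i s) *
      aeval (fun i ↦ X i + C (p i)) (map (o : k →+* F) (Q s)) := by
    simp only [H, map_sub, map_sum, _root_.map_mul, map_X, map_C, hmaptr, RingHom.coe_coe,
      AlgHom.commutes]
    rfl
  obtain ⟨y, hy, hy'⟩ := h N H (fun i ↦ by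
      rw [hmapH, map_sub, map_sum, eval_X]
      simp only [_root_.map_mul, eval_C, hev0, hp]
      simp) (fun i ↦ by
      funext j
      rw [differentialAt, ← pderiv_map, hmapH, map_sub, map_sum, map_sub, map_sum]
      simp only [pderiv_C_mul, pderiv_translate, _root_.map_mul, eval_C, hev0]
      have h1 := congrFun (congrFun hBc i) j
      rw [Matrix.mul_apply] at h1
      have h2 (s) : eval p (pderiv j (map (o : k →+* F) (Q s))) = c s j := by
        rw [pderiv_map]; rfl
      simp only [h2, h1, Matrix.one_apply, pderiv_X, Pi.single_apply]
      by_cases hij : i = j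
      · subst hij; simp
      · simp [hij])
  refine ⟨fun j ↦ y j + algebraMap F k (p j), fun j ↦ by simp [hy], fun s ↦ ?_⟩
  have htr (s) : eval y (tr s) = eval (fun j ↦ y j + algebraMap F k (p j)) (Q s) := by
    simp only [tr]
    generalize Q s = P
    induction P using MvPolynomial.induction_on with
    | C a => simp [algebraMap_eq]
    | add P Q hP hQ => simp only [map_add, hP, hQ]
    | mul_X P i hP => simp only [_root_.map_mul, hP, aeval_X, map_add, eval_X, eval_C]
  have h0 (i) : ∑ s, algebraMap F k (c⁻¹ i s) * eval y (tr s) = 0 := by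
    have := hy' i
    simp only [H, map_sub, map_sum, _root_.map_mul, eval_X, eval_C] at this
    simpa using this
  rw [← htr]
  have h1 : ∑ i, algebraMap F k (c s i) * ∑ s', algebraMap F k (c⁻¹ i s') * eval y (tr s') =
      eval y (tr s) := by
    simp only [Finset.mul_sum, ← mul_assoc, ← _root_.map_mul]
    rw [Finset.sum_comm]
    simp only [← Finset.sum_mul, ← map_sum]
    have h2 (s') : ∑ i, c s i * c⁻¹ i s' = if s = s' then 1 else 0 := by
      rw [← Matrix.mul_apply, hcB, Matrix.one_apply]
    simp [h2]
  rw [← h1]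
  simp [h0]

end FixedPoints

/-! ### Fixed points in formal power series. -/

section Formal
variable {F : Type u} [Field F] {l N : ℕ}

/-- The ideal of series of order at least `L`. -/
def orderIdeal (F : Type u) [Field F] (l L : ℕ) : Ideal (MvPowerSeries (Fin l) F) where
  carrier := {x | ∀ d : Fin l →₀ ℕ, d.degree < L → MvPowerSeries.coeff d x = 0}
  zero_mem' := by simp
  add_mem' hx hy d hd := by rw [map_add, hx d hd, hy d hd, add_zero]
  smul_mem' c x hx d hd := by
    classical
    rw [smul_eq_mul, MvPowerSeries.coeff_mul]
    refine Finset.sum_eq_zero fun e he ↦ ?_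
    rw [hx e.2, mul_zero]
    rw [← Finset.HasAntidiagonal.mem_antidiagonal.mp he, map_add] at hd
    omega

lemma mem_orderIdeal {L : ℕ} {x : MvPowerSeries (Fin l) F} : x ∈ orderIdeal F l L ↔
    ∀ d : Fin l →₀ ℕ, d.degree < L → MvPowerSeries.coeff d x = 0 := Iff.rfl

lemma mem_orderIdeal_one {x : MvPowerSeries (Fin l) F} : x ∈ orderIdeal F l 1 ↔
    MvPowerSeries.constantCoeff x = 0 := by
  rw [mem_orderIdeal, ← MvPowerSeries.coeff_zero_eq_constantCoeff_apply]
  refine ⟨fun h ↦ h 0 (by simp), fun h d hd ↦ ?_⟩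
  rw [(Finsupp.degree_eq_zero_iff d).mp (by omega), h]

lemma orderIdeal_mul_le (L : ℕ) :
    orderIdeal F l L * orderIdeal F l 1 ≤ orderIdeal F l (L + 1) := by
  classical
  rw [Ideal.mul_le]
  intro x hx y hy d hd
  rw [MvPowerSeries.coeff_mul]
  refine Finset.sum_eq_zero fun e he ↦ ?_
  rw [← Finset.HasAntidiagonal.mem_antidiagonal.mp he, map_add] at hd
  by_cases h : e.1.degree < L
  · rw [hx _ h, zero_mul]
  · rw [hy e.2 (by omega), mul_zero]

lemma orderIdeal_anti {L L' : ℕ} (h : L ≤ L') : orderIdeal F l L' ≤ orderIdeal F l L :=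
  fun _ hx d hd ↦ hx d (hd.trans_le h)

/-- The constant term, as an algebra homomorphism. -/
noncomputable def seriesConst (F : Type u) [Field F] (l : ℕ) : MvPowerSeries (Fin l) F →ₐ[F] F where
  __ := MvPowerSeries.constantCoeff (σ := Fin l) (R := F)
  commutes' c := by
    change MvPowerSeries.constantCoeff (algebraMap F (MvPowerSeries (Fin l) F) c) = c
    rw [MvPowerSeries.algebraMap_apply, MvPowerSeries.constantCoeff_C]
    rfl

/-- The iterates, starting from the origin, of a polynomial map. -/
noncomputable def iterates {k : Type*} [CommRing k] (H : Fin N → MvPolynomial (Fin N) k) :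
    ℕ → Fin N → k
  | 0 => 0
  | s + 1 => fun i ↦ eval (iterates H s) (H i)

variable {H : Fin N → MvPolynomial (Fin N) (MvPowerSeries (Fin l) F)}

/-- The iterates converge coefficientwise to a fixed point. -/
theorem exists_fixedPoint (h0 : ∀ i, eval 0 (map (seriesConst F l : _ →+* F) (H i)) = 0)
    (h1 : ∀ i, differentialAt (seriesConst F l) 0 (H i) = 0) :
    ∃ y : Fin N → MvPowerSeries (Fin l) F,
      (∀ i, MvPowerSeries.constantCoeff (y i) = 0) ∧ (∀ i, eval y (H i) = y i) ∧
      ∀ s i (d : Fin l →₀ ℕ), d.degree ≤ s →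
        MvPowerSeries.coeff d (y i) = MvPowerSeries.coeff d (iterates H s i) := by
  have hψ (x) (hx : seriesConst F l x = 0) :
    AlgHom.id F (MvPowerSeries (Fin l) F) x ∈ orderIdeal F l 1 := mem_orderIdeal_one.mpr hx
  have hval {y : Fin N → MvPowerSeries (Fin l) F} (hy : ∀ j, y j ∈ orderIdeal F l 1) (i) :
      eval y (H i) ∈ orderIdeal F l 1 := by
    have := eval₂_sub_algebraMap_mem hψ (p := 0) (h := y) (by simpa using hy) (H i)
    rw [h0, map_zero, sub_zero] at this
    exact this
  -- The linear term of Taylor's formula is zero, so `H` raises the order of a difference by one.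
  have hcontr {L : ℕ} {y y' : Fin N → MvPowerSeries (Fin l) F} (hy : ∀ j, y j ∈ orderIdeal F l 1)
      (hy' : ∀ j, y' j ∈ orderIdeal F l 1) (hyy : ∀ j, y j - y' j ∈ orderIdeal F l L) (i) :
      eval y (H i) - eval y' (H i) ∈ orderIdeal F l (L + 1) := by
    have := taylor_mem_mul hψ (p := 0) (h := y') (z := y) (by simpa using hy') (by simpa using hy)
      hyy (H i)
    simp only [h1, Pi.zero_apply, map_zero, zero_mul, Finset.sum_const_zero, sub_zero] at this
    exact orderIdeal_mul_le L this
  have hit (s) : ∀ j, iterates H s j ∈ orderIdeal F l 1 := by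
    induction s with
    | zero => exact fun j ↦ Ideal.zero_mem _
    | succ s ih => exact hval ih
  have hstep (s) : ∀ i, iterates H (s + 1) i - iterates H s i ∈ orderIdeal F l (s + 1) := by
    induction s with
    | zero => exact fun i ↦ Ideal.sub_mem _ (hit 1 i) (hit 0 i)
    | succ s ih => exact hcontr (hit _) (hit _) ih
  have hlim (s t) (hst : s ≤ t) (i) : iterates H t i - iterates H s i ∈ orderIdeal F l (s + 1) := by
    induction t, hst using Nat.le_induction with
    | base => rw [sub_self]; exact Ideal.zero_mem _
    | succ t hst ih =>
      rw [← sub_add_sub_cancel]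
      exact Ideal.add_mem _ (orderIdeal_anti (by omega) (hstep t i)) ih
  -- The coefficient of degree `s` is stationary from the `s`-th iterate on.
  let y : Fin N → MvPowerSeries (Fin l) F :=
    fun i d ↦ MvPowerSeries.coeff d (iterates H d.degree i)
  have hy (s i) (d : Fin l →₀ ℕ) (hd : d.degree ≤ s) :
      MvPowerSeries.coeff d (y i) = MvPowerSeries.coeff d (iterates H s i) := by
    have := hlim d.degree s hd i d (by omega)
    rw [map_sub, sub_eq_zero] at this
    exact this.symm
  have hys (s i) : y i - iterates H s i ∈ orderIdeal F l (s + 1) := fun d hd ↦ by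
    rw [map_sub, hy s i d (by omega), sub_self]
  have hy1 (i) : y i ∈ orderIdeal F l 1 := by
    have := Ideal.add_mem _ (hys 0 i) (hit 0 i)
    rwa [sub_add_cancel] at this
  refine ⟨y, fun i ↦ mem_orderIdeal_one.mp (hy1 i), fun i ↦ ?_, hy⟩
  ext d
  rw [← sub_eq_zero, ← map_sub]
  have e1 := hcontr hy1 (hit d.degree) (hys d.degree) i
  have e2 := hys (d.degree + 1) i
  have e3 := Ideal.sub_mem _ e1 e2
  have e4 : eval y (H i) - eval (iterates H d.degree) (H i) -
    (y i - iterates H (d.degree + 1) i) = eval y (H i) - y i := by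
    simp only [iterates]; ring
  rw [e4] at e3
  exact e3 d (by omega)

lemma eval_map_ringHom {k R : Type*} [CommRing k] [CommRing R] (ψ : k →+* R) (y : Fin N → k)
    (P : MvPolynomial (Fin N) k) : eval (fun j ↦ ψ (y j)) (map ψ P) = ψ (eval y P) := by
  rw [eval_map]
  exact (map_eval_eq_eval₂ ψ y P).symm

/-- The inclusion of `S` in the formal power series. -/
noncomputable def valHom (S : Subalgebra F (MvPowerSeries (Fin l) F)) :
    S →+* MvPowerSeries (Fin l) F := (S.val : S →+* MvPowerSeries (Fin l) F)

lemma valHom_apply {S : Subalgebra F (MvPowerSeries (Fin l) F)} (x : S) : valHom S x = x := rfl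

/-- Fixed points exist in `S` if the formal ones lie in `S`. -/
lemma hasFixedPoints_of_mem {S : Subalgebra F (MvPowerSeries (Fin l) F)}
    (hS : ∀ (N : ℕ) (H : Fin N → MvPolynomial (Fin N) S)
      (_ : ∀ i, eval 0 (map (constHom S : S →+* F) (H i)) = 0)
      (_ : ∀ i, differentialAt (constHom S) 0 (H i) = 0) (y : Fin N → MvPowerSeries (Fin l) F),
      (∀ i, MvPowerSeries.constantCoeff (y i) = 0) →
      (∀ i, eval y (map (valHom S) (H i)) = y i) →
      (∀ s i (d : Fin l →₀ ℕ), d.degree ≤ s → MvPowerSeries.coeff d (y i) =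
        MvPowerSeries.coeff d ((iterates H s i : S) : MvPowerSeries (Fin l) F)) → ∀ i, y i ∈ S) :
    HasFixedPoints (constHom S) := by
  intro N H h0 h1
  have hmap (P : MvPolynomial (Fin N) S) : map (seriesConst F l : _ →+* F)
      (map (valHom S) P) = map (constHom S : S →+* F) P := by
    rw [MvPolynomial.map_map]; rfl
  have hitr (s) : iterates (fun i ↦ map (valHom S) (H i)) s =
      fun j ↦ valHom S (iterates H s j) := by
    induction s with
    | zero => exact funext fun i ↦ (map_zero (valHom S)).symm
    | succ s ih =>
      funext i
      rw [iterates, iterates, ih]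
      exact eval_map_ringHom _ _ _
  obtain ⟨y, hy0, hy1, hy2⟩ := exists_fixedPoint (H := fun i ↦ map (valHom S) (H i))
    (fun i ↦ by rw [hmap, h0]) (fun i ↦ by
      refine Eq.trans ?_ (h1 i)
      funext j
      rw [differentialAt, differentialAt, pderiv_map, hmap])
  have hy := hS N H h0 h1 y hy0 hy1 fun s i d hd ↦ by rw [hy2 s i d hd, hitr]; rfl
  refine ⟨fun i ↦ ⟨y i, hy i⟩, hy0, fun i ↦ Subtype.ext ?_⟩
  rw [← valHom_apply, ← eval_map_ringHom]
  exact hy1 i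

lemma hasFixedPoints_top : HasFixedPoints (constHom (⊤ : Subalgebra F (MvPowerSeries (Fin l) F))) :=
  hasFixedPoints_of_mem fun _ _ _ _ _ _ _ _ _ ↦ trivial

end Formal
end GradedFamily

namespace GradedFamily
open MvPolynomial
open scoped ENNReal

/-! ### Weighted norms of power series and convergence. -/

section WeightedNorm
variable {F : Type u} [Field F] {l : ℕ} (a : AbsoluteValue F ℝ) (ω : (Fin l →₀ ℕ) → ℝ≥0∞)

/-- The weighted `ℓ¹`-norm of a power series. -/
noncomputable def wnorm (p : MvPowerSeries (Fin l) F) : ℝ≥0∞ :=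
  ∑' d, ENNReal.ofReal (a (MvPowerSeries.coeff d p)) * ω d

variable {a ω}

lemma wnorm_zero : wnorm a ω 0 = 0 := by simp [wnorm]

lemma wnorm_add_le (p q : MvPowerSeries (Fin l) F) :
    wnorm a ω (p + q) ≤ wnorm a ω p + wnorm a ω q := by
  rw [wnorm, wnorm, wnorm, ← ENNReal.tsum_add]
  refine ENNReal.tsum_le_tsum fun d ↦ ?_
  rw [← add_mul, ← ENNReal.ofReal_add (a.nonneg _) (a.nonneg _), map_add]
  gcongr
  exact a.add_le _ _

lemma wnorm_neg (p : MvPowerSeries (Fin l) F) : wnorm a ω (-p) = wnorm a ω p := by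
  simp only [wnorm, map_neg, a.map_neg]

lemma wnorm_sub_le (p q : MvPowerSeries (Fin l) F) :
    wnorm a ω (p - q) ≤ wnorm a ω p + wnorm a ω q := by
  rw [sub_eq_add_neg, ← wnorm_neg q]
  exact wnorm_add_le _ _

lemma wnorm_sum_le {ι : Type*} (s : Finset ι) (p : ι → MvPowerSeries (Fin l) F) :
    wnorm a ω (∑ i ∈ s, p i) ≤ ∑ i ∈ s, wnorm a ω (p i) := by
  classical
  induction s using Finset.induction_on with
  | empty => simp [wnorm_zero]
  | insert i s hi ih =>
    rw [Finset.sum_insert hi, Finset.sum_insert hi]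
    exact (wnorm_add_le _ _).trans (by gcongr)

lemma tsum_antidiagonal (f g : (Fin l →₀ ℕ) → ℝ≥0∞) :
    ∑' d, ∑ x ∈ Finset.HasAntidiagonal.antidiagonal d, f x.1 * g x.2 = (∑' d, f d) * ∑' d, g d := by
  have h1 (d : Fin l →₀ ℕ) : ∑ x ∈ Finset.HasAntidiagonal.antidiagonal d, f x.1 * g x.2 =
      ∑' x : Finset.HasAntidiagonal.antidiagonal d, f x.1.1 * g x.1.2 := by
    rw [tsum_fintype, Finset.sum_coe_sort _ fun x : (Fin l →₀ ℕ) × (Fin l →₀ ℕ) ↦ f x.1 * g x.2]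
  simp only [h1]
  rw [← ENNReal.tsum_sigma' (fun x : Σ d : Fin l →₀ ℕ, Finset.HasAntidiagonal.antidiagonal d ↦
      f x.2.1.1 * g x.2.1.2),
    ← (Finset.HasAntidiagonal.sigmaAntidiagonalEquivProd (A := Fin l →₀ ℕ)).symm.tsum_eq]
  change ∑' c : (Fin l →₀ ℕ) × (Fin l →₀ ℕ), f c.1 * g c.2 = _
  rw [ENNReal.tsum_prod']
  simp only [ENNReal.tsum_mul_left, ENNReal.tsum_mul_right]

lemma wnorm_mul_le (hω : ∀ d e, ω (d + e) = ω d * ω e) (p q : MvPowerSeries (Fin l) F) :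
    wnorm a ω (p * q) ≤ wnorm a ω p * wnorm a ω q := by
  classical
  rw [wnorm, wnorm, wnorm, ← tsum_antidiagonal]
  refine ENNReal.tsum_le_tsum fun d ↦ ?_
  rw [MvPowerSeries.coeff_mul]
  calc ENNReal.ofReal (a (∑ x ∈ Finset.HasAntidiagonal.antidiagonal d,
        MvPowerSeries.coeff x.1 p * MvPowerSeries.coeff x.2 q)) * ω d
      ≤ ENNReal.ofReal (∑ x ∈ Finset.HasAntidiagonal.antidiagonal d,
        a (MvPowerSeries.coeff x.1 p * MvPowerSeries.coeff x.2 q)) * ω d := by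
        gcongr
        exact a.sum_le _ _
    _ = _ := by
        rw [ENNReal.ofReal_sum_of_nonneg fun _ _ ↦ a.nonneg _, Finset.sum_mul]
        refine Finset.sum_congr rfl fun x hx ↦ ?_
        rw [← Finset.HasAntidiagonal.mem_antidiagonal.mp hx, hω, _root_.map_mul,
          ENNReal.ofReal_mul (a.nonneg _)]
        ring

lemma wnorm_one_le (h0 : ω 0 ≤ 1) : wnorm a ω 1 ≤ 1 := by
  classical
  rw [wnorm, tsum_eq_single 0]
  · simpa using h0
  · intro d hd
    rw [MvPowerSeries.coeff_one, if_neg hd]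
    simp

lemma wnorm_pow_le (hω : ∀ d e, ω (d + e) = ω d * ω e) (h0 : ω 0 ≤ 1)
    (p : MvPowerSeries (Fin l) F) (n : ℕ) : wnorm a ω (p ^ n) ≤ wnorm a ω p ^ n := by
  induction n with
  | zero => simpa using wnorm_one_le h0
  | succ n ih =>
    rw [pow_succ, pow_succ]
    exact (wnorm_mul_le hω _ _).trans (by gcongr)

lemma wnorm_prod_le (hω : ∀ d e, ω (d + e) = ω d * ω e) (h0 : ω 0 ≤ 1) {ι : Type*} (s : Finset ι)
    (p : ι → MvPowerSeries (Fin l) F) : wnorm a ω (∏ i ∈ s, p i) ≤ ∏ i ∈ s, wnorm a ω (p i) := by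
  classical
  induction s using Finset.induction_on with
  | empty => simpa using wnorm_one_le h0
  | insert i s hi ih =>
    rw [Finset.prod_insert hi, Finset.prod_insert hi]
    exact (wnorm_mul_le hω _ _).trans (by gcongr)

/-- Lower semicontinuity of the norm for coefficientwise convergence. -/
lemma wnorm_le_of_forall_finset {p : MvPowerSeries (Fin l) F} {B : ℝ≥0∞}
    (h : ∀ s : Finset (Fin l →₀ ℕ), ∃ q, wnorm a ω q ≤ B ∧
      ∀ d ∈ s, MvPowerSeries.coeff d p = MvPowerSeries.coeff d q) : wnorm a ω p ≤ B := by
  rw [wnorm, ENNReal.tsum_eq_iSup_sum]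
  refine iSup_le fun s ↦ ?_
  obtain ⟨q, hq, hqs⟩ := h s
  rw [Finset.sum_congr rfl fun d hd ↦ by rw [hqs d hd]]
  exact (ENNReal.sum_le_tsum s).trans hq

lemma wnorm_mono {ω' : (Fin l →₀ ℕ) → ℝ≥0∞} (h : ∀ d, ω d ≤ ω' d) (p : MvPowerSeries (Fin l) F) :
    wnorm a ω p ≤ wnorm a ω' p :=
  ENNReal.tsum_le_tsum fun d ↦ by gcongr; exact h d

lemma convergesAt_iff {r : ℝ} (hr : 0 ≤ r) {p : MvPowerSeries (Fin l) F} :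
    ConvergesAt a r p ↔ wnorm a (fun d ↦ ENNReal.ofReal r ^ d.degree) p ≠ ∞ := by
  have h (d : Fin l →₀ ℕ) : ENNReal.ofReal (a (MvPowerSeries.coeff d p)) *
      ENNReal.ofReal r ^ d.degree = ENNReal.ofReal (a (MvPowerSeries.coeff d p) * r ^ d.degree) := by
    rw [ENNReal.ofReal_mul (a.nonneg _), ENNReal.ofReal_pow hr]
  rw [wnorm, ConvergesAt]
  simp only [h]
  refine ⟨fun h ↦ h.tsum_ofReal_ne_top, fun h ↦ ?_⟩
  convert ENNReal.summable_toReal h using 2 with d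
  rw [ENNReal.toReal_ofReal (mul_nonneg (a.nonneg _) (pow_nonneg hr _))]

lemma mem_convergentSeries_iff {p : MvPowerSeries (Fin l) F} : p ∈ convergentSeries a l ↔
    ∃ ρ : ℝ≥0∞, ρ ≠ 0 ∧ ρ ≠ ∞ ∧ wnorm a (fun d ↦ ρ ^ d.degree) p ≠ ∞ := by
  constructor
  · rintro ⟨r, hr, h⟩
    exact ⟨ENNReal.ofReal r, by simpa using hr, ENNReal.ofReal_ne_top, (convergesAt_iff hr.le).mp h⟩
  · rintro ⟨ρ, h0, h1, h⟩
    refine ⟨ρ.toReal, ENNReal.toReal_pos h0 h1, (convergesAt_iff ENNReal.toReal_nonneg).mpr ?_⟩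
    rwa [ENNReal.ofReal_toReal h1]

/-- Finitely many convergent series converge in a common polydisc. -/
lemma exists_common_radius {ι : Type*} (s : Finset ι) (p : ι → MvPowerSeries (Fin l) F)
    (hp : ∀ i ∈ s, p i ∈ convergentSeries a l) : ∃ ρ : ℝ≥0∞, ρ ≠ 0 ∧ ρ ≠ ∞ ∧
      ∀ i ∈ s, wnorm a (fun d ↦ ρ ^ d.degree) (p i) ≠ ∞ := by
  classical
  induction s using Finset.induction_on with
  | empty => exact ⟨1, one_ne_zero, ENNReal.one_ne_top, by simp⟩
  | insert i s hi ih =>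
    obtain ⟨ρ, h0, h1, h⟩ := ih fun j hj ↦ hp j (Finset.mem_insert_of_mem hj)
    obtain ⟨ρ', h0', h1', h'⟩ := mem_convergentSeries_iff.mp (hp i (Finset.mem_insert_self i s))
    refine ⟨min ρ ρ', ?_, ne_top_of_le_ne_top h1 (min_le_left _ _), fun j hj ↦ ?_⟩
    · exact (lt_min (pos_iff_ne_zero.mpr h0) (pos_iff_ne_zero.mpr h0')).ne'
    · rcases Finset.mem_insert.mp hj with rfl | hj
      · exact ne_top_of_le_ne_top h' (wnorm_mono (fun d ↦ by gcongr; exact min_le_right _ _) _)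
      · exact ne_top_of_le_ne_top (h j hj) (wnorm_mono (fun d ↦ by gcongr; exact min_le_left _ _) _)

/-- All monomials that occur have degree at least 1, so shrinking the radius by `θ ≤ 1` gains at
least one factor `θ`. -/
lemma wnorm_le_mul_of_constantCoeff_eq_zero {p : MvPowerSeries (Fin l) F}
    (hp : MvPowerSeries.constantCoeff p = 0) {θ ρ : ℝ≥0∞} (hθ : θ ≤ 1) :
    wnorm a (fun d ↦ (θ * ρ) ^ d.degree) p ≤ θ * wnorm a (fun d ↦ ρ ^ d.degree) p := by
  rw [wnorm, wnorm, ← ENNReal.tsum_mul_left]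
  refine ENNReal.tsum_le_tsum fun d ↦ ?_
  by_cases hd : d = 0
  · subst hd
    rw [MvPowerSeries.coeff_zero_eq_constantCoeff_apply, hp]
    simp
  · have h1 : d.degree ≠ 0 := fun h ↦ hd ((Finsupp.degree_eq_zero_iff d).mp h)
    rw [mul_pow, mul_left_comm]
    gcongr
    exact pow_le_of_le_one (zero_le) hθ h1

end WeightedNorm

/-! ### Fixed points in convergent power series. -/

section ConvergentFixedPoints
variable {F : Type u} [Field F] {l N : ℕ}

lemma coeff_single_eq_eval_pderiv {R : Type*} [CommRing R] (P : MvPolynomial (Fin N) R)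
    (j : Fin N) : coeff (Finsupp.single j 1) P = eval 0 (pderiv j P) := by
  classical
  induction P using MvPolynomial.induction_on' with
  | monomial d c =>
    rw [pderiv_monomial, eval_zero, constantCoeff_eq, coeff_monomial, coeff_monomial]
    by_cases hd : d = Finsupp.single j 1
    · subst hd; simp
    · rw [if_neg hd]
      split_ifs with h
      · have hj : d j = 0 := by
          by_contra hj
          apply hd
          have : Finsupp.single j 1 ≤ d := by
            rw [Finsupp.single_le_iff]; omega
          rw [← tsub_add_cancel_of_le this, h, zero_add]
        simp [hj]
      · rfl
  | add P Q hP hQ => simp only [coeff_add, map_add, hP, hQ]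

lemma eq_zero_or_eq_single_of_degree_le_one {d : Fin N →₀ ℕ} (h : d.degree ≤ 1) :
    d = 0 ∨ ∃ j, d = Finsupp.single j 1 := by
  by_cases h0 : d = 0
  · exact Or.inl h0
  · obtain ⟨j, hj⟩ := Finsupp.ne_iff.mp h0
    have h1 : Finsupp.single j 1 ≤ d := by
      rw [Finsupp.single_le_iff]
      exact Nat.one_le_iff_ne_zero.mpr hj
    have h2 := tsub_add_cancel_of_le h1
    have h3 : (d - Finsupp.single j 1).degree = 0 := by
      have := congrArg Finsupp.degree h2
      rw [map_add, Finsupp.degree_single] at this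
      omega
    rw [Finsupp.degree_eq_zero_iff] at h3
    rw [h3, zero_add] at h2
    exact Or.inr ⟨j, h2.symm⟩

variable {a : AbsoluteValue F ℝ}

/-- The iterates stay in the ball of radius `δ` for the norm of polyradius `θ ρ`, and the norm is
lower semicontinuous for coefficientwise limits, so the formal fixed point converges. No
completeness argument is needed, since the limit already exists formally. -/
theorem hasFixedPoints_convergentSeries : HasFixedPoints (constHom (convergentSeries a l)) := by
  classical
  refine hasFixedPoints_of_mem fun N H h0 h1 y _ _ hy i ↦ ?_
  obtain ⟨ρ, hρ0, hρ1, hρ⟩ := exists_common_radius (a := a)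
    (Finset.univ.sigma fun i ↦ (H i).support)
    (fun x : Σ _ : Fin N, Fin N →₀ ℕ ↦ (coeff x.2 (H x.1) : convergentSeries a l).1)
    (fun x _ ↦ (coeff x.2 (H x.1)).2)
  let nrm (θ : ℝ≥0∞) (p : convergentSeries a l) : ℝ≥0∞ := wnorm a (fun d ↦ (θ * ρ) ^ d.degree) p.1
  -- The summand 1 ensures `C ≥ 1`, so that `δ = 1 / (2 C)` below is at most 1.
  let C : ℝ≥0∞ := 1 + ∑ x ∈ Finset.univ.sigma fun i ↦ (H i).support, nrm 1 (coeff x.2 (H x.1))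
  have hC1 : 1 ≤ C := le_self_add
  have hCtop : C ≠ ∞ := by
    refine ENNReal.add_ne_top.mpr ⟨ENNReal.one_ne_top, ?_⟩
    rw [ENNReal.sum_ne_top]
    intro x hx
    simpa only [nrm, one_mul] using hρ x hx
  have hC0 : C ≠ 0 := (zero_lt_one.trans_le hC1).ne'
  have hω (ρ : ℝ≥0∞) (d e : Fin l →₀ ℕ) : ρ ^ (d + e).degree = ρ ^ d.degree * ρ ^ e.degree := by
    rw [map_add, pow_add]
  have hω0 (ρ : ℝ≥0∞) : ρ ^ (0 : Fin l →₀ ℕ).degree ≤ 1 := by simp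
  have hcoeff (i) (d : Fin N →₀ ℕ) (hd : d.degree ≤ 1) :
      MvPowerSeries.constantCoeff (coeff d (H i)).1 = 0 := by
    change (constHom (convergentSeries a l) : _ →+* F) (coeff d (H i)) = 0
    rw [← coeff_map]
    rcases eq_zero_or_eq_single_of_degree_le_one hd with rfl | ⟨j, rfl⟩
    · rw [← constantCoeff_eq, ← eval_zero, h0]
    · rw [coeff_single_eq_eval_pderiv, pderiv_map]
      exact congrFun (h1 i) j
  have hbound (θ δ : ℝ≥0∞) (hθ : θ ≤ 1) (hδ : δ ≤ 1) (z : Fin N → convergentSeries a l)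
      (hz : ∀ j, nrm θ (z j) ≤ δ) (i) : nrm θ (eval z (H i)) ≤ C * (θ + δ ^ 2) := by
    have e1 : (eval z (H i)).1 = ∑ d ∈ (H i).support,
        ((coeff d (H i)).1 * ∏ j, (z j).1 ^ d j) := by
      have := congrArg (valHom (convergentSeries a l)) (eval_eq' z (H i))
      simp only [map_sum, _root_.map_mul, map_prod, map_pow] at this
      exact this
    simp only [nrm, e1]
    refine (wnorm_sum_le _ _).trans ?_
    have e2 (d) (hd : d ∈ (H i).support) : wnorm a (fun d ↦ (θ * ρ) ^ d.degree)
        ((coeff d (H i)).1 * ∏ j, (z j).1 ^ d j) ≤ nrm 1 (coeff d (H i)) * (θ + δ ^ 2) := by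
      have e3 : wnorm a (fun d ↦ (θ * ρ) ^ d.degree) (∏ j, (z j).1 ^ d j) ≤ δ ^ d.degree := by
        refine (wnorm_prod_le (hω _) (hω0 _) _ _).trans ?_
        rw [Finsupp.degree_eq_sum, ← Finset.prod_pow_eq_pow_sum]
        refine Finset.prod_le_prod' fun j _ ↦ (wnorm_pow_le (hω _) (hω0 _) _ _).trans ?_
        gcongr
        exact hz j
      refine (wnorm_mul_le (hω _) _ _).trans ?_
      -- Terms of degree at most 1 in `z` have coefficients that vanish at `t = 0`, which gives the
      -- factor `θ`; the others carry at least `δ ^ 2`.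
      by_cases hdeg : d.degree ≤ 1
      · have e4 := wnorm_le_mul_of_constantCoeff_eq_zero (a := a) (ρ := ρ) (hcoeff i d hdeg) hθ
        calc _ ≤ (θ * wnorm a (fun d ↦ ρ ^ d.degree) (coeff d (H i)).1) * δ ^ d.degree := by gcongr
          _ ≤ (θ * wnorm a (fun d ↦ ρ ^ d.degree) (coeff d (H i)).1) * 1 := by
              gcongr
              exact pow_le_one₀ zero_le hδ
          _ = nrm 1 (coeff d (H i)) * θ := by simp only [nrm, one_mul, mul_one]; rw [mul_comm]
          _ ≤ _ := by gcongr; exact le_self_add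
      · have e4 : wnorm a (fun d ↦ (θ * ρ) ^ d.degree) (coeff d (H i)).1 ≤
            nrm 1 (coeff d (H i)) := wnorm_mono (fun d ↦ by gcongr) _
        calc _ ≤ nrm 1 (coeff d (H i)) * δ ^ d.degree := by gcongr
          _ ≤ nrm 1 (coeff d (H i)) * δ ^ 2 := by
              gcongr nrm 1 (coeff d (H i)) * ?_
              exact pow_le_pow_of_le_one zero_le hδ (by omega)
          _ ≤ _ := by gcongr; exact le_add_self
    refine (Finset.sum_le_sum e2).trans ?_
    rw [← Finset.sum_mul]
    gcongr
    refine le_trans ?_ le_add_self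
    rw [Finset.sum_sigma]
    exact Finset.single_le_sum (f := fun i ↦ ∑ d ∈ (H i).support, nrm 1 (coeff d (H i)))
      (fun _ _ ↦ zero_le) (Finset.mem_univ i)
  -- Chosen with `θ = δ ^ 2` so that `C (θ + δ ^ 2) = 2 C δ ^ 2 = δ`: the ball is mapped into
  -- itself.
  let δ : ℝ≥0∞ := (2 * C)⁻¹
  let θ : ℝ≥0∞ := δ ^ 2
  have h2C : 1 ≤ 2 * C := by
    calc (1 : ℝ≥0∞) ≤ C := hC1
      _ ≤ 2 * C := le_mul_of_one_le_left zero_le one_le_two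
  have hδ1 : δ ≤ 1 := ENNReal.inv_le_one.mpr h2C
  have hθ1 : θ ≤ 1 := pow_le_one₀ zero_le hδ1
  have h2Ctop : 2 * C ≠ ∞ := ENNReal.mul_ne_top (by simp) hCtop
  have h2C0 : 2 * C ≠ 0 := (zero_lt_one.trans_le h2C).ne'
  have hfix : C * (θ + δ ^ 2) = δ := by
    calc C * (θ + δ ^ 2) = (2 * C) * (2 * C)⁻¹ * δ := by simp only [θ, δ]; ring
      _ = δ := by rw [ENNReal.mul_inv_cancel h2C0 h2Ctop, one_mul]
  have hit (s) : ∀ j, nrm θ (iterates H s j) ≤ δ := by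
    induction s with
    | zero =>
      intro j
      change wnorm a _ (0 : MvPowerSeries (Fin l) F) ≤ δ
      rw [wnorm_zero]
      exact zero_le
    | succ s ih =>
      intro j
      rw [iterates]
      exact (hbound θ δ hθ1 hδ1 _ ih j).trans hfix.le
  have hδtop : δ ≠ ∞ := ne_top_of_le_ne_top ENNReal.one_ne_top hδ1
  have hδ0 : δ ≠ 0 := ENNReal.inv_ne_zero.mpr h2Ctop
  refine mem_convergentSeries_iff.mpr ⟨θ * ρ, mul_ne_zero (pow_ne_zero _ hδ0) hρ0,
    ENNReal.mul_ne_top (ENNReal.pow_ne_top hδtop) hρ1, ne_top_of_le_ne_top hδtop ?_⟩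
  refine wnorm_le_of_forall_finset fun s ↦ ⟨_, hit (s.sup fun d ↦ d.degree) i, fun d hd ↦ ?_⟩
  exact hy _ i d (Finset.le_sup (f := fun d : Fin l →₀ ℕ ↦ d.degree) hd)

end ConvergentFixedPoints
end GradedFamily

namespace GradedFamily
open MvPolynomial
open scoped ENNReal

/-! ### A multiplicative monomial order and the weights adapted to it. -/

section ExpCode
variable {l : ℕ}

/-- The injective multiplicative code `∏ p_j ^ d_j` of exponents, `p_j` the `j`-th prime. It defines
a monomial order of type `ω`. -/
noncomputable def expCode (d : Fin l →₀ ℕ) : ℕ := ∏ j : Fin l, Nat.nth Nat.Prime j ^ d j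

lemma expCode_add (d e : Fin l →₀ ℕ) : expCode (d + e) = expCode d * expCode e := by
  simp only [expCode, Finsupp.add_apply, pow_add, Finset.prod_mul_distrib]

lemma expCode_pos (d : Fin l →₀ ℕ) : 0 < expCode d :=
  Finset.prod_pos fun j _ ↦ pow_pos (Nat.prime_nth_prime j).pos _

/-- Unique factorization recovers the exponents from the code. -/
lemma expCode_injective : Function.Injective (expCode (l := l)) := by
  have key (d : Fin l →₀ ℕ) (j : Fin l) :
      (expCode d).factorization (Nat.nth Nat.Prime j) = d j := by
    rw [expCode, Nat.factorization_prod fun (i : Fin l) _ ↦ (pow_pos (Nat.prime_nth_prime i).pos _).ne',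
      Finsupp.finsetSum_apply, Finset.sum_eq_single j]
    · simp
    · intro i _ hij
      have hne : Nat.nth Nat.Prime i ≠ Nat.nth Nat.Prime j := fun h ↦
        hij (Fin.ext (Nat.nth_injective Nat.infinite_setOfPred_prime h))
      simp [Finsupp.single_eq_of_ne' hne]
    · simp
  intro d e h
  ext j
  rw [← key d j, ← key e j, h]

lemma two_pow_degree_le_expCode (d : Fin l →₀ ℕ) : 2 ^ d.degree ≤ expCode d := by
  rw [Finsupp.degree_eq_sum, ← Finset.prod_pow_eq_pow_sum]
  exact Finset.prod_le_prod' fun j _ ↦ Nat.pow_le_pow_left (Nat.prime_nth_prime j).two_le _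

lemma degree_lt_expCode (d : Fin l →₀ ℕ) : d.degree < expCode d :=
  Nat.lt_two_pow_self.trans_le (two_pow_degree_le_expCode d)

lemma expCode_le_pow_degree (d : Fin l →₀ ℕ) : expCode d ≤ Nat.nth Nat.Prime l ^ d.degree := by
  rw [Finsupp.degree_eq_sum, ← Finset.prod_pow_eq_pow_sum]
  exact Finset.prod_le_prod' fun j _ ↦
    Nat.pow_le_pow_left (Nat.nth_monotone Nat.infinite_setOfPred_prime j.2.le) _

/-- The weight attached to the code of exponents. -/
noncomputable def codeWeight (s : ℕ) (d : Fin l →₀ ℕ) : ℝ≥0∞ := ((expCode d : ℝ≥0∞)⁻¹) ^ s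

lemma codeWeight_add (s : ℕ) (d e : Fin l →₀ ℕ) :
    codeWeight s (d + e) = codeWeight s d * codeWeight s e := by
  rw [codeWeight, codeWeight, codeWeight, expCode_add, Nat.cast_mul,
    ENNReal.mul_inv (Or.inr (ENNReal.natCast_ne_top _)) (Or.inl (ENNReal.natCast_ne_top _)), mul_pow]

lemma codeWeight_ne_zero (s : ℕ) (d : Fin l →₀ ℕ) : codeWeight s d ≠ 0 :=
  pow_ne_zero _ (ENNReal.inv_ne_zero.mpr (ENNReal.natCast_ne_top _))

lemma codeWeight_anti {s s' : ℕ} (h : s ≤ s') (d : Fin l →₀ ℕ) :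
    codeWeight s' d ≤ codeWeight s d :=
  pow_le_pow_of_le_one zero_le (ENNReal.inv_le_one.mpr (by exact_mod_cast expCode_pos d)) h

variable {F : Type u} [Field F] {a : AbsoluteValue F ℝ}

/-- The code lies between `2 ^ |d|` and a fixed prime to the power `|d|`, so the weights `code ^
(-s)` are cofinal with the polydiscs shrinking to the origin. -/
lemma mem_convergentSeries_iff_codeWeight {p : MvPowerSeries (Fin l) F} :
    p ∈ convergentSeries a l ↔ ∃ s : ℕ, wnorm a (codeWeight s) p ≠ ∞ := by
  rw [mem_convergentSeries_iff]
  constructor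
  · rintro ⟨ρ, h0, -, h⟩
    obtain ⟨s, hs⟩ := ENNReal.exists_inv_two_pow_lt h0
    refine ⟨s, ne_top_of_le_ne_top h (wnorm_mono (fun d ↦ ?_) _)⟩
    calc codeWeight s d ≤ (((2 : ℝ≥0∞) ^ d.degree)⁻¹) ^ s := by
          rw [codeWeight]
          gcongr
          exact_mod_cast two_pow_degree_le_expCode d
      _ = (2⁻¹ ^ s) ^ d.degree := by rw [ENNReal.inv_pow, ← pow_mul, ← pow_mul, mul_comm]
      _ ≤ ρ ^ d.degree := by gcongr
  · rintro ⟨s, h⟩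
    have hM : Nat.nth Nat.Prime l ≠ 0 := (Nat.prime_nth_prime l).ne_zero
    refine ⟨((Nat.nth Nat.Prime l : ℝ≥0∞)⁻¹) ^ s,
      pow_ne_zero _ (ENNReal.inv_ne_zero.mpr (ENNReal.natCast_ne_top _)),
      ENNReal.pow_ne_top (ENNReal.inv_ne_top.mpr (by exact_mod_cast hM)),
      ne_top_of_le_ne_top h (wnorm_mono (fun d ↦ ?_) _)⟩
    rw [codeWeight, ← pow_mul, mul_comm, pow_mul]
    gcongr
    rw [← ENNReal.inv_pow]
    gcongr
    exact_mod_cast expCode_le_pow_degree d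

/-- The terms of code bigger than that of `β` become negligible for the weights of high index. -/
lemma exists_wnorm_le_codeWeight_div_two {p : MvPowerSeries (Fin l) F}
    (hp : p ∈ convergentSeries a l) (β : Fin l →₀ ℕ)
    (hβ : ∀ d, MvPowerSeries.coeff d p ≠ 0 → expCode β < expCode d) :
    ∃ s₀ : ℕ, ∀ s, s₀ ≤ s → wnorm a (codeWeight s) p ≤ codeWeight s β / 2 := by
  obtain ⟨r, hr⟩ := mem_convergentSeries_iff_codeWeight.mp hp
  let A : ℝ≥0∞ := expCode β
  have hA0 : A ≠ 0 := Nat.cast_ne_zero.mpr (expCode_pos β).ne'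
  have hAtop : A ≠ ∞ := ENNReal.natCast_ne_top _
  have hA1top : A + 1 ≠ ∞ := ENNReal.add_ne_top.mpr ⟨hAtop, ENNReal.one_ne_top⟩
  have hA10 : A + 1 ≠ 0 := by simp
  -- A monomial of code greater than `A` has code at least `A + 1`; raising the index of the weight
  -- by one gains the factor `A / (A + 1) < 1` relative to `β`.
  let θ : ℝ≥0∞ := A / (A + 1)
  have hθ : θ < 1 := ENNReal.div_lt_of_lt_mul (by rw [one_mul]; exact ENNReal.lt_add_right hAtop one_ne_zero)
  let C : ℝ≥0∞ := wnorm a (codeWeight r) p * A ^ r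
  have hC : C ≠ ∞ := ENNReal.mul_ne_top hr (ENNReal.pow_ne_top hAtop)
  have hbound (k : ℕ) : wnorm a (codeWeight (r + k)) p ≤ codeWeight (r + k) β * (C * θ ^ k) := by
    have e1 : codeWeight (r + k) β * (C * θ ^ k) =
        (A⁻¹ * A) ^ r * (A⁻¹ * A) ^ k * (wnorm a (codeWeight r) p * (A + 1)⁻¹ ^ k) := by
      simp only [codeWeight, C, θ, div_eq_mul_inv, A]
      ring
    rw [e1, ENNReal.inv_mul_cancel hA0 hAtop, one_pow, one_pow, one_mul, one_mul, wnorm, wnorm,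
      ← ENNReal.tsum_mul_right]
    refine ENNReal.tsum_le_tsum fun d ↦ ?_
    by_cases hd : MvPowerSeries.coeff d p = 0
    · simp [hd]
    · have h1 : (expCode d : ℝ≥0∞)⁻¹ ≤ (A + 1)⁻¹ := by
        gcongr
        simp only [A]
        exact_mod_cast hβ d hd
      rw [codeWeight, pow_add, ← mul_assoc]
      simp only [codeWeight]
      gcongr
  have hlim := ENNReal.Tendsto.const_mul (ENNReal.tendsto_pow_atTop_nhds_zero_of_lt_one hθ)
    (Or.inr hC)
  rw [mul_zero] at hlim
  obtain ⟨k₀, hk₀⟩ := Filter.eventually_atTop.mp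
    (hlim.eventually (Iic_mem_nhds (show (0 : ℝ≥0∞) < 2⁻¹ by simp)))
  refine ⟨r + k₀, fun s hs ↦ ?_⟩
  obtain ⟨k, rfl⟩ := Nat.exists_eq_add_of_le (show r ≤ s by omega)
  refine (hbound k).trans ?_
  rw [div_eq_mul_inv]
  gcongr
  exact hk₀ k (by omega)

end ExpCode

/-! ### Division of convergent series, with norm estimates. -/

section Division
variable {F : Type u} [Field F] {l : ℕ} (E : Set (Fin l →₀ ℕ)) (sel : (Fin l →₀ ℕ) → (Fin l →₀ ℕ))

open Classical in
/-- The part of `c` with exponents `d ∈ E` for which `β = sel d`, divided by `t ^ β`. -/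
noncomputable def divPart (β : Fin l →₀ ℕ) (c : MvPowerSeries (Fin l) F) :
    MvPowerSeries (Fin l) F :=
  fun e ↦ if e + β ∈ E ∧ sel (e + β) = β then MvPowerSeries.coeff (e + β) c else 0

open Classical in
lemma coeff_divPart (β e : Fin l →₀ ℕ) (c : MvPowerSeries (Fin l) F) :
    MvPowerSeries.coeff e (divPart E sel β c) =
      if e + β ∈ E ∧ sel (e + β) = β then MvPowerSeries.coeff (e + β) c else 0 := rfl

variable (m : Finset (Fin l →₀ ℕ)) (R : (Fin l →₀ ℕ) → MvPowerSeries (Fin l) F)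

/-- The correction `∑ q_β R_β` in the division algorithm. -/
noncomputable def divStep (c : MvPowerSeries (Fin l) F) : MvPowerSeries (Fin l) F :=
  ∑ β ∈ m, divPart E sel β c * R β

/-- The successive approximations of the division algorithm. -/
noncomputable def divIterate (b : MvPowerSeries (Fin l) F) : ℕ → MvPowerSeries (Fin l) F
  | 0 => 0
  | n + 1 => b - divStep E sel m R (divIterate b n)

variable {E sel m R}

/-- Multiplication by `R β` strictly raises codes above that of `e + β`, so the step is contracting
for the filtration by codes. -/
lemma coeff_divStep_congr (hR : ∀ β d, MvPowerSeries.coeff d (R β) ≠ 0 → expCode β < expCode d)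
    {c c' : MvPowerSeries (Fin l) F} {n : ℕ}
    (h : ∀ d, expCode d < n → MvPowerSeries.coeff d c = MvPowerSeries.coeff d c')
    (d : Fin l →₀ ℕ) (hd : expCode d < n + 1) :
    MvPowerSeries.coeff d (divStep E sel m R c) = MvPowerSeries.coeff d (divStep E sel m R c') := by
  classical
  simp only [divStep, map_sum, MvPowerSeries.coeff_mul]
  refine Finset.sum_congr rfl fun β _ ↦ Finset.sum_congr rfl fun x hx ↦ ?_
  by_cases h0 : MvPowerSeries.coeff x.2 (R β) = 0
  · rw [h0, mul_zero, mul_zero]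
  · have h1 : expCode (x.1 + β) < n := by
      have h2 : expCode (x.1 + β) < expCode d := by
        rw [← Finset.HasAntidiagonal.mem_antidiagonal.mp hx, expCode_add, expCode_add]
        exact Nat.mul_lt_mul_of_pos_left (hR β x.2 h0) (expCode_pos x.1)
      omega
    rw [coeff_divPart, coeff_divPart, h _ h1]

lemma coeff_divIterate (hR : ∀ β d, MvPowerSeries.coeff d (R β) ≠ 0 → expCode β < expCode d)
    (b : MvPowerSeries (Fin l) F) (n k : ℕ) (d : Fin l →₀ ℕ) (hd : expCode d < n) :
    MvPowerSeries.coeff d (divIterate E sel m R b (n + k)) =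
      MvPowerSeries.coeff d (divIterate E sel m R b n) := by
  induction n generalizing d with
  | zero => omega
  | succ n ih =>
    rw [Nat.succ_add, divIterate, divIterate, map_sub, map_sub, coeff_divStep_congr hR ih d hd]

/-- The division algorithm terminates in the limit; the limit inherits the norm bounds of the
approximations. -/
lemma exists_divLimit (hR : ∀ β d, MvPowerSeries.coeff d (R β) ≠ 0 → expCode β < expCode d)
    (b : MvPowerSeries (Fin l) F) : ∃ c, c = b - divStep E sel m R c ∧
      ∀ n d, expCode d < n → MvPowerSeries.coeff d c =
        MvPowerSeries.coeff d (divIterate E sel m R b n) := by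
  obtain ⟨c, hc₀⟩ : ∃ c : MvPowerSeries (Fin l) F, ∀ d, MvPowerSeries.coeff d c =
      MvPowerSeries.coeff d (divIterate E sel m R b (expCode d + 1)) := ⟨fun d ↦ _, fun _ ↦ rfl⟩
  have hc (n d) (hd : expCode d < n) : MvPowerSeries.coeff d c =
      MvPowerSeries.coeff d (divIterate E sel m R b n) := by
    obtain ⟨k, rfl⟩ := Nat.exists_eq_add_of_le hd
    rw [hc₀]
    exact (coeff_divIterate hR b _ k d (Nat.lt_succ_self _)).symm
  refine ⟨c, ?_, hc⟩
  ext d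
  rw [hc (expCode d + 1) d (Nat.lt_succ_self _), divIterate, map_sub, map_sub,
    coeff_divStep_congr hR (fun e he ↦ (hc _ e he).symm) d (Nat.lt_succ_self _)]

variable {a : AbsoluteValue F ℝ} {ω : (Fin l →₀ ℕ) → ℝ≥0∞}

/-- Each exponent is assigned to a single `β` by `sel`, so the pieces of `c` are disjoint. -/
lemma sum_wnorm_divPart_le (hω : ∀ d e, ω (d + e) = ω d * ω e) (c : MvPowerSeries (Fin l) F) :
    ∑ β ∈ m, wnorm a ω (divPart E sel β c) * ω β ≤ wnorm a ω c := by
  classical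
  have h1 (β : Fin l →₀ ℕ) : wnorm a ω (divPart E sel β c) * ω β ≤
      ∑' d, if sel d = β then ENNReal.ofReal (a (MvPowerSeries.coeff d c)) * ω d else 0 := by
    refine le_trans ?_ (ENNReal.tsum_comp_le_tsum_of_injective (add_left_injective β) _)
    rw [wnorm, ← ENNReal.tsum_mul_right]
    refine ENNReal.tsum_le_tsum fun e ↦ ?_
    rw [coeff_divPart, mul_assoc, ← hω]
    by_cases h : e + β ∈ E ∧ sel (e + β) = β
    · rw [if_pos h, if_pos h.2]
    · rw [if_neg h, map_zero, ENNReal.ofReal_zero, zero_mul]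
      exact zero_le
  refine (Finset.sum_le_sum fun β _ ↦ h1 β).trans ?_
  rw [← Summable.tsum_finsetSum fun _ _ ↦ ENNReal.summable]
  refine ENNReal.tsum_le_tsum fun d ↦ ?_
  rw [Finset.sum_ite_eq]
  split_ifs
  · exact le_rfl
  · exact zero_le

lemma wnorm_divStep_le (hω : ∀ d e, ω (d + e) = ω d * ω e)
    (hR : ∀ β ∈ m, wnorm a ω (R β) ≤ ω β / 2) (c : MvPowerSeries (Fin l) F) :
    wnorm a ω (divStep E sel m R c) ≤ wnorm a ω c / 2 := by
  refine (wnorm_sum_le _ _).trans ?_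
  calc ∑ β ∈ m, wnorm a ω (divPart E sel β c * R β)
      ≤ ∑ β ∈ m, wnorm a ω (divPart E sel β c) * ω β * 2⁻¹ := by
        refine Finset.sum_le_sum fun β hβ ↦ (wnorm_mul_le hω _ _).trans ?_
        rw [mul_assoc, ← div_eq_mul_inv]
        gcongr
        exact hR β hβ
    _ ≤ _ := by
        rw [← Finset.sum_mul, div_eq_mul_inv]
        gcongr
        exact sum_wnorm_divPart_le hω c

/-- The correction at most halves the norm, so the bound `2 |b|` reproduces itself: `|b| + (2 |b|) /
2 = 2 |b|`. -/
lemma wnorm_divIterate_le (hω : ∀ d e, ω (d + e) = ω d * ω e)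
    (hR : ∀ β ∈ m, wnorm a ω (R β) ≤ ω β / 2) (b : MvPowerSeries (Fin l) F) (n : ℕ) :
    wnorm a ω (divIterate E sel m R b n) ≤ 2 * wnorm a ω b := by
  induction n with
  | zero => rw [divIterate, wnorm_zero]; exact zero_le
  | succ n ih =>
    rw [divIterate]
    refine (wnorm_sub_le _ _).trans ?_
    calc wnorm a ω b + wnorm a ω (divStep E sel m R (divIterate E sel m R b n))
        ≤ wnorm a ω b + 2 * wnorm a ω b / 2 := by
          gcongr
          exact (wnorm_divStep_le hω hR _).trans (by gcongr)
      _ = 2 * wnorm a ω b := by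
          rw [mul_div_assoc, ENNReal.mul_div_cancel (by simp) (by simp), two_mul]

/-- The division theorem: a convergent series is, modulo the series `t ^ β + R β`, congruent to
a series without exponents in `E`. -/
theorem exists_convergent_division (hR : ∀ β d, MvPowerSeries.coeff d (R β) ≠ 0 → expCode β < expCode d)
    (hRc : ∀ β ∈ m, R β ∈ convergentSeries a l) (hm : ∀ d ∈ E, sel d ∈ m ∧ sel d ≤ d)
    {b : MvPowerSeries (Fin l) F} (hb : b ∈ convergentSeries a l) :
    ∃ q : (Fin l →₀ ℕ) → MvPowerSeries (Fin l) F, (∀ β ∈ m, q β ∈ convergentSeries a l) ∧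
      ∀ d ∈ E, MvPowerSeries.coeff d
        (b - ∑ β ∈ m, q β * (MvPowerSeries.monomial β 1 + R β)) = 0 := by
  classical
  obtain ⟨c, hc, hlim⟩ := exists_divLimit (E := E) (sel := sel) (m := m) hR b
  -- Finitely many divisors, hence one weight for which every tail is at most half of its leading
  -- monomial.
  have hs₁ : ∃ s₁ : ℕ, ∀ s, s₁ ≤ s → ∀ β ∈ m, wnorm a (codeWeight s) (R β) ≤ codeWeight s β / 2 := by
    have h1 (β : Fin l →₀ ℕ) : ∃ s₀ : ℕ, β ∈ m → ∀ s, s₀ ≤ s →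
        wnorm a (codeWeight s) (R β) ≤ codeWeight s β / 2 := by
      by_cases hβ : β ∈ m
      · obtain ⟨s₀, h⟩ := exists_wnorm_le_codeWeight_div_two (hRc β hβ) β (hR β)
        exact ⟨s₀, fun _ ↦ h⟩
      · exact ⟨0, fun h ↦ absurd h hβ⟩
    choose s₀ hs₀ using h1
    exact ⟨m.sup s₀, fun s hs β hβ ↦ hs₀ β hβ s ((Finset.le_sup hβ).trans hs)⟩
  obtain ⟨s₁, hs₁⟩ := hs₁
  obtain ⟨s₂, hs₂⟩ := mem_convergentSeries_iff_codeWeight.mp hb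
  let s := max s₁ s₂
  have hbs : wnorm a (codeWeight s) b ≠ ∞ :=
    ne_top_of_le_ne_top hs₂ (wnorm_mono (codeWeight_anti (le_max_right _ _)) _)
  have hcs : wnorm a (codeWeight s) c ≠ ∞ := by
    refine ne_top_of_le_ne_top (ENNReal.mul_ne_top (by simp) hbs : 2 * _ ≠ ∞)
      (wnorm_le_of_forall_finset fun t ↦ ⟨_, wnorm_divIterate_le (codeWeight_add s)
        (hs₁ s (le_max_left _ _)) b (t.sup expCode + 1), fun d hd ↦ hlim _ d ?_⟩)
    exact Nat.lt_succ_of_le (Finset.le_sup hd)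
  refine ⟨fun β ↦ divPart E sel β c, fun β hβ ↦ mem_convergentSeries_iff_codeWeight.mpr ⟨s, fun h ↦ ?_⟩,
    fun d hd ↦ ?_⟩
  · have h1 := (Finset.single_le_sum (f := fun β ↦ wnorm a (codeWeight s) (divPart E sel β c) *
      codeWeight s β) (fun _ _ ↦ zero_le) hβ).trans (sum_wnorm_divPart_le (codeWeight_add s) c)
    simp only [h, ENNReal.top_mul (codeWeight_ne_zero s β)] at h1
    exact hcs (top_le_iff.mp h1)
  -- By the fixed point equation the remainder is `c` minus the sum of `q_β t^β`, that is, `c` with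
  -- its exponents in `E` removed.
  · have h1 : b - ∑ β ∈ m, divPart E sel β c * (MvPowerSeries.monomial β 1 + R β) =
        c - ∑ β ∈ m, divPart E sel β c * MvPowerSeries.monomial β 1 := by
      rw [divStep] at hc
      have h2 : b = c + ∑ β ∈ m, divPart E sel β c * R β := by
        conv_rhs => lhs; rw [hc]
        ring
      simp only [mul_add, Finset.sum_add_distrib]
      conv_lhs => lhs; rw [h2]
      ring
    rw [h1, map_sub, map_sum, Finset.sum_eq_single (sel d), MvPowerSeries.coeff_mul_monomial,
      if_pos (hm d hd).2, coeff_divPart, tsub_add_cancel_of_le (hm d hd).2, if_pos ⟨hd, rfl⟩, mul_one,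
      sub_self]
    · intro β _ hβ
      rw [MvPowerSeries.coeff_mul_monomial]
      split_ifs with h
      · rw [coeff_divPart, tsub_add_cancel_of_le h, if_neg fun h ↦ hβ h.2.symm, zero_mul]
      · rfl
    · intro h
      exact absurd (hm d hd).1 h

end Division

/-! ### Closedness of ideals by standard bases. -/

section Closed
variable {F : Type u} [Field F] {l : ℕ}

/-- `d` is the exponent of the initial term of `p`. -/
def IsInitial (p : MvPowerSeries (Fin l) F) (d : Fin l →₀ ℕ) : Prop :=
  MvPowerSeries.coeff d p ≠ 0 ∧ ∀ e, expCode e < expCode d → MvPowerSeries.coeff e p = 0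

lemma exists_isInitial {p : MvPowerSeries (Fin l) F} (hp : p ≠ 0) : ∃ d, IsInitial p d := by
  obtain ⟨d, hd⟩ : ∃ d, MvPowerSeries.coeff d p ≠ 0 := by
    by_contra! h
    exact hp (MvPowerSeries.ext fun d ↦ by rw [h d, map_zero])
  obtain ⟨e, he, hmin⟩ := (measure (expCode (l := l))).wf.has_min
    {d | MvPowerSeries.coeff d p ≠ 0} ⟨d, hd⟩
  exact ⟨e, he, fun e' he' ↦ by_contra fun h ↦ hmin e' h he'⟩

/-- Dickson's lemma: the minimal exponents form an antichain, hence a finite set. -/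
lemma exists_finset_minimal (E : Set (Fin l →₀ ℕ)) : ∃ (m : Finset (Fin l →₀ ℕ))
    (sel : (Fin l →₀ ℕ) → (Fin l →₀ ℕ)), (∀ β ∈ m, β ∈ E) ∧ ∀ d ∈ E, sel d ∈ m ∧ sel d ≤ d := by
  have hfin : {d | Minimal (· ∈ E) d}.Finite :=
    WellQuasiOrderedLE.finite_of_isAntichain (setOfPred_minimal_antichain _)
  have h1 (d : Fin l →₀ ℕ) : ∃ β, d ∈ E → β ∈ hfin.toFinset ∧ β ≤ d := by
    by_cases hd : d ∈ E
    · obtain ⟨β, hβ, hm⟩ := exists_minimal_le_of_wellFoundedLT (· ∈ E) d hd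
      exact ⟨β, fun _ ↦ ⟨hfin.mem_toFinset.mpr hm, hβ⟩⟩
    · exact ⟨d, fun h ↦ absurd h hd⟩
  choose sel hsel using h1
  exact ⟨hfin.toFinset, sel, fun β hβ ↦ (hfin.mem_toFinset.mp hβ).1, hsel⟩

/-- Divide `b` by elements of `I` whose initial exponents are the minimal ones of `I`. A nonzero
remainder would have its initial exponent outside the initial exponents of `I`; but the remainder is
approximated by elements of `I`, and a good approximation has the same initial exponent. -/
theorem hasClosedIdeals_convergentSeries (a : AbsoluteValue F ℝ) :
    HasClosedIdeals (convergentSeries a l) := by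
  classical
  intro I b hb
  let E : Set (Fin l →₀ ℕ) := {d | ∃ p ∈ I, IsInitial p.1 d}
  obtain ⟨m, sel, hmE, hm⟩ := exists_finset_minimal E
  have h1 (β : Fin l →₀ ℕ) : ∃ p ∈ I, β ∈ m → MvPowerSeries.coeff β p.1 = 1 ∧
      ∀ e, expCode e < expCode β → MvPowerSeries.coeff e p.1 = 0 := by
    by_cases hβ : β ∈ m
    · obtain ⟨p, hp, hp0, hpi⟩ := hmE β hβ
      refine ⟨(MvPowerSeries.coeff β p.1)⁻¹ • p, Submodule.smul_of_tower_mem I _ hp, fun _ ↦ ⟨?_, fun e he ↦ ?_⟩⟩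
      · change MvPowerSeries.coeff β ((MvPowerSeries.coeff β p.1)⁻¹ • p.1) = 1
        rw [MvPowerSeries.coeff_smul, inv_mul_cancel₀ hp0]
      · change MvPowerSeries.coeff e ((MvPowerSeries.coeff β p.1)⁻¹ • p.1) = 0
        rw [MvPowerSeries.coeff_smul, hpi e he, mul_zero]
    · exact ⟨0, I.zero_mem, fun h ↦ absurd h hβ⟩
  choose g hgI hg using h1
  let R (β : Fin l →₀ ℕ) : MvPowerSeries (Fin l) F :=
    if β ∈ m then (g β).1 - MvPowerSeries.monomial β 1 else 0
  have hRg (β) (hβ : β ∈ m) : MvPowerSeries.monomial β 1 + R β = (g β).1 := by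
    simp only [R, if_pos hβ, add_sub_cancel]
  have hR : ∀ β d, MvPowerSeries.coeff d (R β) ≠ 0 → expCode β < expCode d := by
    intro β d hd
    by_cases hβ : β ∈ m
    · simp only [R, if_pos hβ, map_sub, MvPowerSeries.coeff_monomial] at hd
      by_contra! hlt
      apply hd
      rcases hlt.lt_or_eq with hlt | heq
      · rw [(hg β hβ).2 d hlt, if_neg (by rintro rfl; exact lt_irrefl _ hlt), sub_zero]
      · obtain rfl := expCode_injective heq
        rw [(hg _ hβ).1, if_pos rfl, sub_self]
    · simp only [R, if_neg hβ, map_zero, ne_eq, not_true_eq_false] at hd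
  have hmon (β : Fin l →₀ ℕ) :
      (MvPowerSeries.monomial β 1 : MvPowerSeries (Fin l) F) ∈ convergentSeries a l := by
    rw [← MvPolynomial.coe_monomial]
    exact coe_mem_convergentSeries a _
  have hRc : ∀ β ∈ m, R β ∈ convergentSeries a l := by
    intro β hβ
    simp only [R, if_pos hβ]
    exact sub_mem (g β).2 (hmon β)
  obtain ⟨q, hq, hrem⟩ := exists_convergent_division hR hRc hm b.2
  let q' (β : Fin l →₀ ℕ) : convergentSeries a l := if h : β ∈ m then ⟨q β, hq β h⟩ else 0
  let z : convergentSeries a l := ∑ β ∈ m, q' β * g β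
  have hz : z ∈ I := Ideal.sum_mem _ fun β _ ↦ I.mul_mem_left _ (hgI β)
  have hz' : z.1 = ∑ β ∈ m, q β * (MvPowerSeries.monomial β 1 + R β) := by
    have h1 := map_sum (valHom (convergentSeries a l)) (fun β ↦ q' β * g β) m
    refine h1.trans (Finset.sum_congr rfl fun β hβ ↦ ?_)
    rw [_root_.map_mul, hRg β hβ]
    simp only [q', dif_pos hβ]
    rfl
  suffices h : b - z = 0 by rwa [sub_eq_zero.mp h]
  by_contra hne
  obtain ⟨d, hd0, hdi⟩ := exists_isInitial (p := (b - z).1) fun h ↦ hne (Subtype.ext h)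
  -- The degree is smaller than the code, so agreement below degree `expCode d + 1` covers all
  -- exponents of code at most `expCode d`.
  obtain ⟨p, hp, hpb⟩ := hb (expCode d + 1)
  have hagree (e) (he : expCode e ≤ expCode d) :
      MvPowerSeries.coeff e (p - z).1 = MvPowerSeries.coeff e (b - z).1 := by
    change MvPowerSeries.coeff e (p.1 - z.1) = MvPowerSeries.coeff e (b.1 - z.1)
    rw [map_sub, map_sub, hpb e ((degree_lt_expCode e).trans (Nat.lt_succ_of_le he))]
  have hdE : d ∈ E := ⟨p - z, I.sub_mem hp hz, by rwa [hagree d le_rfl], fun e he ↦ by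
    rw [hagree e he.le]; exact hdi e he⟩
  apply hd0
  change MvPowerSeries.coeff d (b.1 - z.1) = 0
  rw [hz']
  exact hrem d hdE

open Classical in
-- Coefficients have absolute value at most 1, and distinct exponents have distinct codes, so the
-- norm for the weight `code ^ (-2)` is bounded by the sum of the `n ^ (-2)`. Formal series are
-- thereby a special case of convergent ones.
lemma convergentSeries_trivial : convergentSeries (AbsoluteValue.trivial (R := F) (S := ℝ)) l = ⊤ := by
  refine eq_top_iff.mpr fun p _ ↦ mem_convergentSeries_iff_codeWeight.mpr ⟨2, ?_⟩
  have h1 : wnorm (AbsoluteValue.trivial (R := F) (S := ℝ)) (codeWeight 2) p ≤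
      ∑' n : ℕ, ENNReal.ofReal (((n : ℝ) ^ 2)⁻¹) := by
    refine le_trans (ENNReal.tsum_le_tsum fun d ↦ ?_)
      (ENNReal.tsum_comp_le_tsum_of_injective (expCode_injective (l := l)) _)
    have h2 : ENNReal.ofReal ((((expCode d : ℕ) : ℝ) ^ 2)⁻¹) = codeWeight 2 d := by
      have : (0 : ℝ) < expCode d := by exact_mod_cast expCode_pos d
      rw [ENNReal.ofReal_inv_of_pos (by positivity), ENNReal.ofReal_pow this.le,
        ENNReal.ofReal_natCast, codeWeight, ENNReal.inv_pow]
    rw [h2]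
    refine mul_le_of_le_one_left zero_le ?_
    rw [ENNReal.ofReal_le_one]
    by_cases h : MvPowerSeries.coeff d p = 0
    · rw [h, map_zero]; exact zero_le_one
    · rw [AbsoluteValue.trivial_apply h]
  refine ne_top_of_le_ne_top ?_ h1
  exact (Real.summable_nat_pow_inv.mpr one_lt_two).tsum_ofReal_ne_top

theorem hasClosedIdeals_top : HasClosedIdeals (⊤ : Subalgebra F (MvPowerSeries (Fin l) F)) := by
  classical
  rw [← convergentSeries_trivial]
  exact hasClosedIdeals_convergentSeries _

end Closed
end GradedFamily

namespace GradedFamily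
open MvPolynomial

/-! ### The Jacobian criterion for algebraicity. -/

section Jacobian
variable {N : ℕ}

lemma derivation_aeval {M A V : Type*} [CommRing M] [CommRing A] [Algebra M A] [AddCommGroup V]
    [Module M V] [Module A V] (D : Derivation M A V) (y : Fin N → A) (P : MvPolynomial (Fin N) M) :
    D (aeval y P) = ∑ j, aeval y (pderiv j P) • D (y j) := by
  classical
  induction P using MvPolynomial.induction_on with
  | C c => simp
  | add P Q hP hQ => simp only [map_add, hP, hQ, add_smul, Finset.sum_add_distrib]
  | mul_X P i hP =>
    rw [_root_.map_mul, aeval_X, D.leibniz, hP, Finset.smul_sum]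
    simp only [Derivation.leibniz, pderiv_X, map_add, smul_eq_mul, _root_.map_mul, aeval_X, add_smul,
      mul_smul, Finset.sum_add_distrib]
    congr 1
    rw [Finset.sum_eq_single i]
    · simp
    · intro j _ hj
      simp [Pi.single_eq_of_ne' hj]
    · simp

/-- Simple solutions of a square system of polynomial equations over a field are algebraic. -/
theorem isAlgebraic_of_jacobian_of_field {M L : Type*} [Field M] [Field L] [Algebra M L]
    (y : Fin N → L) (P : Fin N → MvPolynomial (Fin N) M) (hP : ∀ i, aeval y (P i) = 0)
    (hdet : (Matrix.of fun i j ↦ aeval y (pderiv j (P i))).det ≠ 0) (j : Fin N) :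
    IsAlgebraic M (y j) := by
  classical
  let K₁ := IntermediateField.adjoin M (Set.range y)
  have hfg : Algebra.EssFiniteType M K₁ := by
    rw [IntermediateField.essFiniteType_iff]
    exact IntermediateField.fg_adjoin_of_finite (Set.finite_range y)
  let y' (j : Fin N) : K₁ := ⟨y j, IntermediateField.subset_adjoin _ _ ⟨j, rfl⟩⟩
  have hval (Q : MvPolynomial (Fin N) M) : algebraMap K₁ L (aeval y' Q) = aeval y Q :=
    (aeval_algebraMap_apply L y' Q).symm
  let J : Matrix (Fin N) (Fin N) K₁ := Matrix.of fun i j ↦ aeval y' (pderiv j (P i))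
  have hJ : J.det ≠ 0 := by
    intro h
    apply hdet
    have h1 := congrArg (algebraMap K₁ L) h
    rw [RingHom.map_det, map_zero] at h1
    rw [← h1]
    congr 1
    ext i j
    exact (hval _).symm
  let D := KaehlerDifferential.D M K₁
  have hD1 (i : Fin N) : ∑ j, J i j • D (y' j) = 0 := by
    have h0 : aeval y' (P i) = 0 := by
      apply (algebraMap K₁ L).injective
      rw [hval, hP, map_zero]
    have h1 := derivation_aeval D y' (P i)
    rw [h0, map_zero] at h1
    exact h1.symm
  -- The chain rule gives a linear system for the differentials of the `y j` with invertible matrix;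
  -- Cramer's rule via the adjugate makes them zero.
  have hD2 (k : Fin N) : D (y' k) = 0 := by
    have h1 : ∑ i, J.adjugate k i • ∑ j, J i j • D (y' j) = 0 := by
      simp only [hD1, smul_zero, Finset.sum_const_zero]
    simp only [Finset.smul_sum, smul_smul] at h1
    rw [Finset.sum_comm] at h1
    simp only [← Finset.sum_smul] at h1
    have h2 (j : Fin N) : ∑ i, J.adjugate k i * J i j = if k = j then J.det else 0 := by
      have := congrFun (congrFun J.adjugate_mul k) j
      rw [Matrix.mul_apply] at this
      rw [this, Matrix.smul_apply, Matrix.one_apply]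
      simp
    simp only [h2, ite_smul, zero_smul, Finset.sum_ite_eq, Finset.mem_univ, if_true] at h1
    exact (smul_eq_zero.mp h1).resolve_left hJ
  have hD3 (x : L) (hx : x ∈ K₁) : D ⟨x, hx⟩ = 0 := by
    induction hx using IntermediateField.adjoin_induction with
    | mem x hx =>
      obtain ⟨k, rfl⟩ := hx
      exact hD2 k
    | algebraMap c => exact D.map_algebraMap c
    | add x z hx hz h1 h2 =>
      have := D.map_add ⟨x, hx⟩ ⟨z, hz⟩
      rw [h1, h2, add_zero] at this
      exact this
    | inv x hx h1 =>
      have := D.leibniz_inv (⟨x, hx⟩ : K₁)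
      rw [h1, smul_zero] at this
      exact this
    | mul x z hx hz h1 h2 =>
      have := D.leibniz ⟨x, hx⟩ ⟨z, hz⟩
      rw [h1, h2, smul_zero, smul_zero, add_zero] at this
      exact this
  -- All differentials of `M(y)` vanish; an unramified extension that is essentially of finite type
  -- is finite, hence algebraic.
  have hunr : Algebra.FormallyUnramified M K₁ := by
    constructor
    have h1 : (⊤ : Submodule K₁ (Ω[K₁⁄M])) = ⊥ := by
      rw [← KaehlerDifferential.span_range_derivation, Submodule.span_eq_bot]
      rintro _ ⟨x, rfl⟩
      exact hD3 x.1 x.2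
    exact (Submodule.subsingleton_iff K₁).mp (subsingleton_of_bot_eq_top h1.symm)
  have hfin : Module.Finite M K₁ := Algebra.FormallyUnramified.finite_of_free M K₁
  have halg : IsAlgebraic M (y' j) := IsAlgebraic.of_finite M (y' j)
  exact halg.algebraMap

/-- Simple solutions of a square system of polynomial equations over a domain are algebraic. -/
theorem isAlgebraic_of_jacobian {S A : Type*} [CommRing S] [IsDomain S] [CommRing A] [IsDomain A]
    [Algebra S A] [FaithfulSMul S A] (y : Fin N → A) (P : Fin N → MvPolynomial (Fin N) S)
    (hP : ∀ i, aeval y (P i) = 0)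
    (hdet : (Matrix.of fun i j ↦ aeval y (pderiv j (P i))).det ≠ 0) (j : Fin N) :
    IsAlgebraic S (y j) := by
  let L := FractionRing A
  let M := FractionRing S
  have : FaithfulSMul S L := FaithfulSMul.trans S A L
  let _ : Algebra M L := FractionRing.liftAlgebra S L
  have : IsScalarTower S M L := FractionRing.isScalarTower_liftAlgebra S L
  have hval (Q : MvPolynomial (Fin N) S) :
      aeval (fun j ↦ algebraMap A L (y j)) (map (algebraMap S M) Q) = algebraMap A L (aeval y Q) := by
    rw [aeval_def, eval₂_map, ← IsScalarTower.algebraMap_eq, ← aeval_def, ← aeval_algebraMap_apply]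
    rfl
  have h1 := isAlgebraic_of_jacobian_of_field (fun j ↦ algebraMap A L (y j))
    (fun i ↦ map (algebraMap S M) (P i)) (fun i ↦ by rw [hval, hP, map_zero]) (by
      simp only [pderiv_map, hval]
      intro h
      apply hdet
      apply IsFractionRing.injective A L
      rw [map_zero, RingHom.map_det, ← h]
      rfl) j
  have h2 := (IsFractionRing.isAlgebraic_iff S M L).mpr h1
  exact (isAlgebraic_algebraMap_iff (IsFractionRing.injective A L)).mp h2

end Jacobian

/-! ### Fixed points in Nash series. -/

section NashFixedPoints
variable {F : Type u} [Field F] {l : ℕ}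

lemma mem_nashSeries_of_isAlgebraic {p : MvPowerSeries (Fin l) F}
    (hp : IsAlgebraic (nashSeries F l) p) : p ∈ nashSeries F l := by
  by_contra h
  exact Transcendental.subalgebraAlgebraicClosure
    (R := MvPolynomial (Fin l) F) (S := MvPowerSeries (Fin l) F) h hp

/-- The Jacobian of the system `X - H` at the formal fixed point has the identity matrix as its
constant term, so its determinant is nonzero. The fixed point is algebraic over the Nash series,
hence a Nash series. -/
theorem hasFixedPoints_nashSeries : HasFixedPoints (constHom (nashSeries F l)) := by
  classical
  refine hasFixedPoints_of_mem fun N H h0 h1 y hy0 hy _ i ↦ mem_nashSeries_of_isAlgebraic ?_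
  have hval (P : MvPolynomial (Fin N) (nashSeries F l)) :
      aeval y P = eval y (map (valHom (nashSeries F l)) P) := by
    rw [eval_map]
    rfl
  have hconst (P : MvPolynomial (Fin N) (nashSeries F l)) :
      MvPowerSeries.constantCoeff (aeval y P) =
        eval 0 (map (constHom (nashSeries F l) : nashSeries F l →+* F) P) := by
    rw [hval, ← eval_map_ringHom, map_map]
    congr 2
    funext j
    exact hy0 j
  have hdom' : IsDomain (MvPowerSeries (Fin l) F) := NoZeroDivisors.to_isDomain _
  have hdom : IsDomain (nashSeries F l) := Function.Injective.isDomain (valHom (nashSeries F l))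
    Subtype.val_injective
  refine isAlgebraic_of_jacobian y (fun i ↦ X i - H i) (fun i ↦ ?_) (fun h ↦ ?_) i
  · rw [map_sub, aeval_X, hval, hy, sub_self]
  · have h2 := congrArg (MvPowerSeries.constantCoeff (σ := Fin l) (R := F)) h
    rw [RingHom.map_det, map_zero] at h2
    have h3 : (MvPowerSeries.constantCoeff (σ := Fin l) (R := F)).mapMatrix
        (Matrix.of fun i j ↦ aeval y (pderiv j (X i - H i))) = 1 := by
      ext i j
      have h4 : eval 0 (map (constHom (nashSeries F l) : nashSeries F l →+* F)
        (pderiv j (H i))) = 0 := congrFun (h1 i) j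
      rw [RingHom.mapMatrix_apply, Matrix.map_apply, Matrix.of_apply, map_sub, map_sub, map_sub,
        hconst (pderiv j (H i)), h4, pderiv_X, sub_zero, Matrix.one_apply]
      by_cases hij : i = j
      · subst hij; simp
      · simp [hij]
    rw [h3, Matrix.det_one] at h2
    exact one_ne_zero h2

end NashFixedPoints
end GradedFamily

namespace GradedFamily

/-! ### Algebraicity under specialization. -/

section SpecializeAlgebraic

/-- A nonzero algebraic equation can be chosen not to vanish modulo a given prime element. -/
lemma exists_aeval_eq_zero_not_dvd {R B : Type*} [CommRing R] [IsDomain R]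
    [UniqueFactorizationMonoid R] [CommRing B] [IsDomain B] [Algebra R B] [FaithfulSMul R B] {c : R}
    (hc : Prime c) {f : B} (hf : IsAlgebraic R f) :
    ∃ G : Polynomial R, Polynomial.aeval f G = 0 ∧ ∃ i, ¬ c ∣ G.coeff i := by
  obtain ⟨G, hG0, hG⟩ := hf
  have hCc : ¬ IsUnit (Polynomial.C c) := fun h ↦ hc.not_isUnit (Polynomial.isUnit_C.mp h)
  -- Divide the equation by the highest power of `c` that divides all its coefficients.
  obtain ⟨G', hG', hdvd⟩ :=
    (FiniteMultiplicity.of_not_isUnit hCc hG0).exists_eq_pow_mul_and_not_dvd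
  refine ⟨G', ?_, ?_⟩
  · rw [hG', _root_.map_mul, map_pow, Polynomial.aeval_C] at hG
    refine (mul_eq_zero.mp hG).resolve_left (pow_ne_zero _ fun h ↦ hc.ne_zero ?_)
    exact FaithfulSMul.algebraMap_injective R B (h.trans (map_zero _).symm)
  · by_contra! h
    exact hdvd (Polynomial.C_dvd_iff_dvd_coeff _ _ |>.mpr h)

/-- Specialization preserves algebraicity. -/
lemma isAlgebraic_specialization {R B k Ω : Type*} [CommRing R] [IsDomain R]
    [UniqueFactorizationMonoid R] [CommRing B] [IsDomain B] [Algebra R B] [FaithfulSMul R B]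
    [CommRing k] [IsDomain k] [Field Ω] [Algebra k Ω] (φ : B →+* Ω) {c : R} (hc : Prime c)
    (hker : ∀ g : R, φ (algebraMap R B g) = 0 → c ∣ g)
    (halg : ∀ g : R, IsAlgebraic k (φ (algebraMap R B g))) {f : B} (hf : IsAlgebraic R f) :
    IsAlgebraic k (φ f) := by
  obtain ⟨G, hG, i, hi⟩ := exists_aeval_eq_zero_not_dvd hc hf
  let M := Subalgebra.algebraicClosure k Ω
  let ψ : R →+* M := (φ.comp (algebraMap R B)).codRestrict M.toSubring halg
  have h1 : IsAlgebraic M (φ f) := by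
    refine ⟨G.map ψ, fun h ↦ hi (hker _ ?_), ?_⟩
    · have h2 := congrArg (fun P ↦ P.coeff i) h
      simp only [Polynomial.coeff_map, Polynomial.coeff_zero] at h2
      exact congrArg Subtype.val h2
    · rw [Polynomial.aeval_def, Polynomial.eval₂_map]
      have h2 : (algebraMap M Ω).comp ψ = φ.comp (algebraMap R B) := rfl
      rw [h2, ← Polynomial.hom_eval₂, ← Polynomial.aeval_def, hG, map_zero]
  by_contra h
  exact Transcendental.subalgebraAlgebraicClosure (R := k) h h1

end SpecializeAlgebraic

/-! ### Algebraicity by Lagrange interpolation. -/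

section Interpolation

/-- The coefficients of a polynomial are algebraic if its values at sufficiently many algebraic
points are algebraic. -/
lemma isAlgebraic_coeff_of_eval {k Ω : Type*} [Field k] [Field Ω] [Algebra k Ω]
    (s : Finset Ω) (hs : ∀ α ∈ s, IsAlgebraic k α) (r : Polynomial Ω) (hr : r.degree < s.card)
    (hval : ∀ α ∈ s, IsAlgebraic k (r.eval α)) (i : ℕ) : IsAlgebraic k (r.coeff i) := by
  classical
  let M := algebraicClosure k Ω
  have hmem (x : Ω) (hx : IsAlgebraic k x) : x ∈ (algebraMap M Ω).rangeS :=
    ⟨⟨x, mem_algebraicClosure_iff.mpr hx⟩, rfl⟩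
  have hC (x : Ω) (hx : IsAlgebraic k x) : Polynomial.C x ∈ Polynomial.lifts (algebraMap M Ω) :=
    Polynomial.C'_mem_lifts (hmem x hx)
  have h1 : r ∈ Polynomial.lifts (algebraMap M Ω) := by
    rw [Lagrange.eq_interpolate (s := s) (v := id) (Set.injOn_id _) hr, Lagrange.interpolate_apply]
    refine Subsemiring.sum_mem _ fun α hα ↦ Subsemiring.mul_mem _ (hC _ (hval α hα)) ?_
    rw [Lagrange.basis]
    refine Subsemiring.prod_mem _ fun β hβ ↦ ?_
    rw [Lagrange.basisDivisor, sub_eq_add_neg Polynomial.X, ← Polynomial.C_neg]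
    have hβ' := hs β (Finset.mem_of_mem_erase hβ)
    exact Subsemiring.mul_mem _ (hC _ ((hs α hα).sub hβ').inv)
      (Subsemiring.add_mem _ (Polynomial.X_mem_lifts _) (hC _ hβ'.neg))
  obtain ⟨x, hx⟩ := (Polynomial.lifts_iff_coeff_lifts _).mp h1 i
  rw [← hx]
  exact mem_algebraicClosure_iff.mp x.2

end Interpolation

/-! ### Weierstrass division and algebraicity. -/

section WeierstrassAlgebraic
open Polynomial in
/-- Weierstrass division by an irreducible polynomial over `k` preserves algebraicity. -/
theorem exists_algebraic_weierstrassDivision {k A : Type*} [CommRing k] [IsDomain k]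
    [UniqueFactorizationMonoid k] [CharZero k] [CommRing A] [IsDomain A] [IsLocalRing A]
    [IsAdicComplete (IsLocalRing.maximalIdeal A) A] [Algebra k A] [FaithfulSMul k A]
    {c : k[X]} (hc : Irreducible c)
    (hreg : PowerSeries.map (IsLocalRing.residue A) (c.map (algebraMap k A) : PowerSeries A) ≠ 0) :
    ∃ D : ℕ, ∀ f : PowerSeries A, IsAlgebraic k[X] f →
      ∃ (q : PowerSeries A) (r : A[X]), r.degree < D ∧ (∀ i, IsAlgebraic k (r.coeff i)) ∧
        f = (c.map (algebraMap k A) : PowerSeries A) * q + r := by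
  classical
  set g : PowerSeries A := (c.map (algebraMap k A) : PowerSeries A) with hg
  -- The remainder modulo `c` has degree less than that of the distinguished polynomial `P`, and it
  -- will be recovered from its values at the roots of `P`.
  obtain ⟨P, h, hP⟩ := PowerSeries.exists_isWeierstrassFactorization hreg
  have hPmonic : P.Monic := hP.isDistinguishedAt.monic
  have hequiv (p : A[X]) : hP.algEquivQuotient (Ideal.Quotient.mk _ p) =
      Ideal.Quotient.mk _ (p : PowerSeries A) := by
    rw [PowerSeries.IsWeierstrassFactorizationAt.algEquivQuotient_apply]
    simp
  have hPdvd : P ∣ c.map (algebraMap k A) := by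
    rw [← Ideal.Quotient.eq_zero_iff_dvd]
    apply hP.algEquivQuotient.injective
    rw [hequiv, map_zero]
    exact (Ideal.Quotient.eq_zero_iff_dvd _ _).mpr dvd_rfl
  have hc0 : c.map (algebraMap k A) ≠ 0 :=
    (Polynomial.map_ne_zero_iff (FaithfulSMul.algebraMap_injective k A)).mpr hc.ne_zero
  refine ⟨P.natDegree, fun f hf ↦ ?_⟩
  obtain ⟨q, r, hrdeg, hfr⟩ := PowerSeries.exists_isWeierstrassDivision f hreg
  have hdeg : r.degree < P.natDegree := by
    rwa [hP.natDegree_eq_toNat_order_map]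
  refine ⟨q, r, hdeg, ?_, hfr⟩
  -- If `c` is constant in the distinguished variable, then `P` has degree 0 and the remainder is
  -- zero.
  by_cases hcdeg : c.natDegree = 0
  · have h1 : P.natDegree = 0 := by
      have := natDegree_le_of_dvd hPdvd hc0
      rw [natDegree_map_eq_of_injective (FaithfulSMul.algebraMap_injective k A)] at this
      omega
    have h2 : r = 0 := by
      rw [h1] at hdeg
      exact degree_eq_bot.mp (Nat.WithBot.lt_zero_iff.mp hdeg)
    intro i
    rw [h2, coeff_zero]
    exact isAlgebraic_zero
  let K := FractionRing k
  let Ω := AlgebraicClosure (FractionRing A)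
  have : FaithfulSMul A Ω := FaithfulSMul.trans A (FractionRing A) Ω
  have : FaithfulSMul k Ω := FaithfulSMul.trans k A Ω
  let _ : Algebra K Ω := FractionRing.liftAlgebra k Ω
  have : IsScalarTower k K Ω := FractionRing.isScalarTower_liftAlgebra k Ω
  have hprim : c.IsPrimitive := hc.isPrimitive hcdeg
  have hcK : Irreducible (c.map (algebraMap k K)) :=
    hprim.irreducible_iff_irreducible_map_fraction_map.mp hc
  have hcΩ : (c.map (algebraMap k K)).map (algebraMap K Ω) =
      (c.map (algebraMap k A)).map (algebraMap A Ω) := by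
    rw [Polynomial.map_map, Polynomial.map_map, ← IsScalarTower.algebraMap_eq,
      ← IsScalarTower.algebraMap_eq]
  -- In characteristic 0 the irreducible polynomial `c` is separable over the fraction field, and
  -- `P` divides it; so `P` has as many distinct roots as its degree.
  have hsep : (P.map (algebraMap A Ω)).Separable := by
    refine Separable.of_dvd ?_ (Polynomial.map_dvd (algebraMap A Ω) hPdvd)
    rw [← hcΩ]
    exact hcK.separable.map
  let s : Finset Ω := (P.map (algebraMap A Ω)).roots.toFinset
  have hscard : s.card = P.natDegree := by
    rw [Multiset.toFinset_card_of_nodup (nodup_roots hsep),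
      splits_iff_card_roots.mp (IsAlgClosed.splits _), hPmonic.natDegree_map]
  have hroot (α) (hα : α ∈ s) : P.eval₂ (algebraMap A Ω) α = 0 := by
    have := isRoot_of_mem_roots (Multiset.mem_toFinset.mp hα)
    rwa [IsRoot, eval_map] at this
  have hrootc (α) (hα : α ∈ s) : aeval α (c.map (algebraMap k K)) = 0 := by
    rw [aeval_def, ← eval_map, hcΩ]
    obtain ⟨s', hs'⟩ := hPdvd
    rw [hs', Polynomial.map_mul, eval_mul, eval_map, hroot α hα, zero_mul]
  have hαalg (α) (hα : α ∈ s) : IsAlgebraic K α := ⟨_, hcK.ne_zero, hrootc α hα⟩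
  -- Evaluation at a root `α` extends to power series through `A[[X]] / (g) ≅ A[X] / (P)`, and there
  -- `f` takes the value `r(α)`. The polynomials over `k` that vanish at `α` are the multiples of
  -- `c`, because the minimal polynomial of `α` is associated to `c`; so this specialization
  -- preserves algebraicity.
  have hval (α) (hα : α ∈ s) : IsAlgebraic K ((r.map (algebraMap A Ω)).eval α) := by
    let ev : (A[X] ⧸ Ideal.span {P}) →+* Ω := Ideal.Quotient.lift (Ideal.span {P})
      (eval₂RingHom (algebraMap A Ω) α) (fun p hp ↦ by
        obtain ⟨p', rfl⟩ := Ideal.mem_span_singleton.mp hp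
        rw [_root_.map_mul, coe_eval₂RingHom, hroot α hα, zero_mul])
    let φ : PowerSeries A →+* Ω := (ev.comp
      (hP.algEquivQuotient.symm.toRingEquiv.toRingHom)).comp (Ideal.Quotient.mk _)
    have hφ (p : A[X]) : φ (p : PowerSeries A) = p.eval₂ (algebraMap A Ω) α := by
      have h1 : hP.algEquivQuotient.symm (Ideal.Quotient.mk _ (p : PowerSeries A)) =
          Ideal.Quotient.mk _ p := by
        rw [← hequiv, AlgEquiv.symm_apply_apply]
      exact congrArg ev h1
    have hφ0 : φ g = 0 := by
      change ev (hP.algEquivQuotient.symm (Ideal.Quotient.mk _ g)) = 0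
      rw [(Ideal.Quotient.eq_zero_iff_dvd g g).mpr dvd_rfl, map_zero, map_zero]
    have hφf : φ f = (r.map (algebraMap A Ω)).eval α := by
      rw [hfr, map_add, _root_.map_mul, hφ0, zero_mul, zero_add, hφ, eval_map]
    have hφk (p : k[X]) : φ (algebraMap k[X] (PowerSeries A) p) = aeval α (p.map (algebraMap k K)) := by
      rw [PowerSeries.algebraMap_apply', ← polynomial_map_coe, hφ, eval₂_map, Polynomial.aeval_map_algebraMap,
        aeval_def, ← IsScalarTower.algebraMap_eq]
    have : FaithfulSMul k[X] (PowerSeries A) := by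
      rw [faithfulSMul_iff_algebraMap_injective]
      intro p p' hpp
      rw [PowerSeries.algebraMap_apply', PowerSeries.algebraMap_apply', ← polynomial_map_coe,
        ← polynomial_map_coe, Polynomial.coe_inj] at hpp
      exact Polynomial.map_injective _ (FaithfulSMul.algebraMap_injective k A) hpp
    rw [← hφf]
    refine isAlgebraic_specialization φ hc.prime (fun p hp ↦ ?_) (fun p ↦ ?_) hf
    · rw [hφk] at hp
      rw [hprim.dvd_iff_fraction_map_dvd_fraction_map K]
      have h1 := minpoly.dvd K α hp
      have h2 := minpoly.dvd K α (hrootc α hα)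
      have h3 : Associated (minpoly K α) (c.map (algebraMap k K)) :=
        (minpoly.irreducible (hαalg α hα).isIntegral).associated_of_dvd hcK h2
      exact h3.symm.dvd.trans h1
    · rw [hφk]
      exact Algebra.isAlgebraic_adjoin_singleton_iff.mpr (hαalg α hα) _
        (aeval_mem_adjoin_singleton K α)
  intro i
  have h1 := isAlgebraic_coeff_of_eval s hαalg (r.map (algebraMap A Ω))
    (degree_map_le.trans_lt (by rwa [hscard])) hval i
  rw [coeff_map] at h1
  have h2 := (IsFractionRing.isAlgebraic_iff k K Ω).mpr h1
  exact (isAlgebraic_algebraMap_iff (FaithfulSMul.algebraMap_injective A Ω)).mp h2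

end WeierstrassAlgebraic
end GradedFamily

namespace GradedFamily
open MvPolynomial

/-! ### Separating the first variable of a power series. -/

section FirstVariable
variable {F : Type u} [Field F] {l : ℕ}

/-- Power series in `t₂, …, t_{l+1}` as power series in `t₁, …, t_{l+1}`. -/
noncomputable def succHom (F : Type u) [Field F] (l : ℕ) :
    MvPowerSeries (Fin l) F →+* MvPowerSeries (Fin (l + 1)) F :=
  ((MvPowerSeries.finSuccEquiv F l).symm.toRingEquiv.toRingHom).comp PowerSeries.C

lemma finSuccEquiv_succHom (p : MvPowerSeries (Fin l) F) :
    MvPowerSeries.finSuccEquiv F l (succHom F l p) = PowerSeries.C p :=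
  (MvPowerSeries.finSuccEquiv F l).apply_symm_apply _

lemma succHom_X (j : Fin l) : succHom F l (MvPowerSeries.X j) = MvPowerSeries.X j.succ := by
  apply (MvPowerSeries.finSuccEquiv F l).injective
  rw [finSuccEquiv_succHom, MvPowerSeries.finSuccEquiv_X_succ]

lemma finSuccEquiv_coe (p : MvPolynomial (Fin (l + 1)) F) :
    MvPowerSeries.finSuccEquiv F l (p : MvPowerSeries (Fin (l + 1)) F) =
      algebraMap (Polynomial (MvPolynomial (Fin l) F)) (PowerSeries (MvPowerSeries (Fin l) F))
        (finSuccEquiv F l p) := by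
  ext k x
  rw [MvPowerSeries.coeff_coeff_finSuccEquiv, PowerSeries.algebraMap_apply', PowerSeries.coeff_map,
    Polynomial.coeff_coe, MvPowerSeries.algebraMap_apply', Algebra.algebraMap_self]
  simp [finSuccEquiv_coeff_coeff]

lemma succHom_coe (p : MvPolynomial (Fin l) F) :
    succHom F l (p : MvPowerSeries (Fin l) F) = (rename Fin.succ p : MvPolynomial _ F) := by
  have h : finSuccEquiv F l (rename Fin.succ p) = Polynomial.C p := by
    induction p using MvPolynomial.induction_on with
    | C a => simp [finSuccEquiv_apply]
    | add p q hp hq => rw [map_add, map_add, hp, hq, map_add]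
    | mul_X p j hp =>
      rw [_root_.map_mul, _root_.map_mul, hp, rename_X, finSuccEquiv_X_succ, _root_.map_mul]
  apply (MvPowerSeries.finSuccEquiv F l).injective
  rw [finSuccEquiv_succHom, finSuccEquiv_coe, h,
    PowerSeries.algebraMap_apply', Polynomial.coe_C, PowerSeries.map_C,
    MvPowerSeries.algebraMap_apply', Algebra.algebraMap_self]
  simp

lemma degree_cons (k : ℕ) (x : Fin l →₀ ℕ) : (x.cons k).degree = k + x.degree := by
  rw [Finsupp.degree_eq_sum, Finsupp.degree_eq_sum, Fin.sum_univ_succ]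
  simp

/-- A family of subalgebras of power series, compatible with adding and removing variables. -/
structure IsVariableStable (S : ∀ l, Subalgebra F (MvPowerSeries (Fin l) F)) : Prop where
  succHom_mem : ∀ l, ∀ p ∈ S l, succHom F l p ∈ S (l + 1)
  constantCoeff_mem : ∀ l, ∀ p ∈ S (l + 1),
    PowerSeries.constantCoeff (MvPowerSeries.finSuccEquiv F l p) ∈ S l
  of_X_mul_mem : ∀ l p, MvPowerSeries.X 0 * p ∈ S (l + 1) → p ∈ S (l + 1)

/-- Hadamard's lemma inside `S`, with control of the order: split off the part divisible by the
first variable and apply induction to the restriction to `t₁ = 0`. -/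
lemma IsVariableStable.exists_eq_sum {S : ∀ l, Subalgebra F (MvPowerSeries (Fin l) F)}
    (hS : IsVariableStable S) (l : ℕ) (L : ℕ) (p : MvPowerSeries (Fin l) F) (hp : p ∈ S l)
    (hL : ∀ d : Fin l →₀ ℕ, d.degree < L + 1 → MvPowerSeries.coeff d p = 0) :
    ∃ g : Fin l → MvPowerSeries (Fin l) F, (∀ j, g j ∈ S l ∧
      ∀ d : Fin l →₀ ℕ, d.degree < L → MvPowerSeries.coeff d (g j) = 0) ∧
      p = ∑ j, MvPowerSeries.X j * g j := by
  induction l generalizing L with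
  | zero =>
    refine ⟨0, fun j ↦ j.elim0, ?_⟩
    ext d
    rw [hL d (by rw [Subsingleton.elim d 0, map_zero]; omega)]
    simp
  | succ l ih =>
    let Φ := MvPowerSeries.finSuccEquiv F l
    let p₀ := PowerSeries.constantCoeff (Φ p)
    have hp₀ : p₀ ∈ S l := hS.constantCoeff_mem l p hp
    obtain ⟨g, hg, hpg⟩ := ih L p₀ hp₀ fun d hd ↦ by
      have := MvPowerSeries.coeff_coeff_finSuccEquiv p (k := 0) (x := d)
      rw [hL _ (by rwa [degree_cons, zero_add]), PowerSeries.coeff_zero_eq_constantCoeff_apply] at this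
      exact this
    let q := Φ.symm (PowerSeries.mk fun k ↦ PowerSeries.coeff (k + 1) (Φ p))
    have hpq : p = MvPowerSeries.X 0 * q + succHom F l p₀ := by
      apply Φ.injective
      rw [map_add, _root_.map_mul, Φ.apply_symm_apply]
      refine (PowerSeries.eq_X_mul_shift_add_const (Φ p)).trans ?_
      rw [← MvPowerSeries.finSuccEquiv_X_zero, ← finSuccEquiv_succHom]
    refine ⟨Fin.cons q fun j ↦ succHom F l (g j), fun j ↦ ?_, ?_⟩
    · cases j using Fin.cases with
      | zero =>
        refine ⟨hS.of_X_mul_mem l q ?_, fun d hd ↦ ?_⟩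
        · rw [eq_sub_of_add_eq hpq.symm]
          exact sub_mem hp (hS.succHom_mem l _ hp₀)
        · rw [Fin.cons_zero, ← Finsupp.cons_tail d, ← MvPowerSeries.coeff_coeff_finSuccEquiv]
          have h1 : MvPowerSeries.finSuccEquiv F l q =
              PowerSeries.mk fun k ↦ PowerSeries.coeff (k + 1) (Φ p) := Φ.apply_symm_apply _
          rw [h1, PowerSeries.coeff_mk, MvPowerSeries.coeff_coeff_finSuccEquiv]
          refine hL _ ?_
          rw [← Finsupp.cons_tail d, degree_cons] at hd
          rw [degree_cons]
          omega
      | succ j =>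
        refine ⟨hS.succHom_mem l _ (hg j).1, fun d hd ↦ ?_⟩
        rw [Fin.cons_succ, ← Finsupp.cons_tail d, ← MvPowerSeries.coeff_coeff_finSuccEquiv,
          finSuccEquiv_succHom, PowerSeries.coeff_C]
        rw [← Finsupp.cons_tail d, degree_cons] at hd
        split_ifs with h0
        · exact (hg j).2 _ (by omega)
        · exact map_zero _
    · rw [Fin.sum_univ_succ, Fin.cons_zero, hpq, hpg, map_sum]
      simp only [Fin.cons_succ, _root_.map_mul, succHom_X]

lemma isVariableStable_top :
    IsVariableStable fun l ↦ (⊤ : Subalgebra F (MvPowerSeries (Fin l) F)) where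
  succHom_mem _ _ _ := trivial
  constantCoeff_mem _ _ _ := trivial
  of_X_mul_mem _ _ _ := trivial

lemma maximalIdeal_eq_span_range_X :
    IsLocalRing.maximalIdeal (MvPowerSeries (Fin l) F) = Ideal.span (Set.range MvPowerSeries.X) := by
  apply le_antisymm
  · intro p hp
    have h0 : MvPowerSeries.constantCoeff p = 0 := by
      by_contra h
      exact (IsLocalRing.mem_maximalIdeal p).mp hp
        (MvPowerSeries.isUnit_iff_constantCoeff.mpr (isUnit_iff_ne_zero.mpr h))
    obtain ⟨g, -, hg⟩ := isVariableStable_top.exists_eq_sum l 0 p trivial fun d hd ↦ by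
      rw [(Finsupp.degree_eq_zero_iff d).mp (by omega)]
      exact h0
    rw [hg]
    exact Ideal.sum_mem _ fun j _ ↦ Ideal.mul_mem_right _ _ (Ideal.subset_span ⟨j, rfl⟩)
  · rw [Ideal.span_le]
    rintro _ ⟨j, rfl⟩
    refine (IsLocalRing.mem_maximalIdeal _).mpr fun h ↦ ?_
    have := MvPowerSeries.isUnit_iff_constantCoeff.mp h
    simp at this

/-- Completeness of the coefficient ring is what Weierstrass preparation needs. -/
instance : IsAdicComplete (IsLocalRing.maximalIdeal (MvPowerSeries (Fin l) F))
    (MvPowerSeries (Fin l) F) := by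
  rw [maximalIdeal_eq_span_range_X]
  infer_instance

lemma residue_coe_ne_zero {p : MvPolynomial (Fin l) F} (hp : coeff 0 p ≠ 0) :
    IsLocalRing.residue (MvPowerSeries (Fin l) F) (algebraMap _ _ p) ≠ 0 := by
  rw [IsLocalRing.residue_ne_zero_iff_isUnit, MvPowerSeries.isUnit_iff_constantCoeff,
    isUnit_iff_ne_zero, MvPowerSeries.algebraMap_apply', Algebra.algebraMap_self,
    ← MvPowerSeries.coeff_zero_eq_constantCoeff_apply]
  simpa using hp

end FirstVariable

/-! ### Nash series: Weierstrass division and stability under change of variables. -/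

section NashStable
variable {F : Type u} [Field F] {l : ℕ}

instance : IsDomain (MvPowerSeries (Fin l) F) := NoZeroDivisors.to_isDomain _

instance : FaithfulSMul (MvPolynomial (Fin l) F) (MvPowerSeries (Fin l) F) := by
  rw [faithfulSMul_iff_algebraMap_injective]
  intro p q h
  rw [MvPowerSeries.algebraMap_apply', MvPowerSeries.algebraMap_apply', Algebra.algebraMap_self] at h
  simpa using h

lemma isAlgebraic_finSuccEquiv {p : MvPowerSeries (Fin (l + 1)) F} (hp : p ∈ nashSeries F (l + 1)) :
    IsAlgebraic (Polynomial (MvPolynomial (Fin l) F)) (MvPowerSeries.finSuccEquiv F l p) := by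
  have hp' : IsAlgebraic (MvPolynomial (Fin (l + 1)) F) p := hp
  refine hp'.ringHom_of_comp_eq (finSuccEquiv F l) (MvPowerSeries.finSuccEquiv F l)
    (finSuccEquiv F l).injective (RingHom.ext fun q ↦ ?_)
  have h := finSuccEquiv_coe q
  rw [RingHom.comp_apply, RingHom.comp_apply, MvPowerSeries.algebraMap_apply',
    Algebra.algebraMap_self]
  simpa using h.symm

/-- Weierstrass division of Nash series by an irreducible polynomial that is regular in the first
variable. -/
theorem exists_nash_division [CharZero F] {c : MvPolynomial (Fin (l + 1)) F} (hc : Irreducible c)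
    (hreg : ∃ i : ℕ, coeff (Finsupp.cons i 0) c ≠ 0) :
    ∃ D : ℕ, ∀ f ∈ nashSeries F (l + 1), ∃ q : MvPowerSeries (Fin (l + 1)) F,
      ∃ r : Polynomial (MvPowerSeries (Fin l) F), r.degree < D ∧ (∀ i, r.coeff i ∈ nashSeries F l) ∧
        MvPowerSeries.finSuccEquiv F l f =
          MvPowerSeries.finSuccEquiv F l (c : MvPowerSeries (Fin (l + 1)) F) *
            MvPowerSeries.finSuccEquiv F l q + r := by
  have hmap : MvPowerSeries.finSuccEquiv F l (c : MvPowerSeries (Fin (l + 1)) F) =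
      ((finSuccEquiv F l c).map (algebraMap (MvPolynomial (Fin l) F) (MvPowerSeries (Fin l) F)) :
        PowerSeries (MvPowerSeries (Fin l) F)) := by
    rw [finSuccEquiv_coe, PowerSeries.algebraMap_apply', Polynomial.polynomial_map_coe]
  obtain ⟨D, hD⟩ := exists_algebraic_weierstrassDivision (k := MvPolynomial (Fin l) F)
    (A := MvPowerSeries (Fin l) F) (c := finSuccEquiv F l c)
    ((MulEquiv.irreducible_iff (finSuccEquiv F l)).mpr hc) (by
      obtain ⟨i, hi⟩ := hreg
      intro h
      have h1 := congrArg (PowerSeries.coeff i) h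
      rw [PowerSeries.coeff_map, Polynomial.coeff_coe, Polynomial.coeff_map, map_zero] at h1
      refine residue_coe_ne_zero ?_ h1
      rwa [finSuccEquiv_coeff_coeff])
  refine ⟨D, fun f hf ↦ ?_⟩
  obtain ⟨q, r, hr, hralg, hfr⟩ := hD _ (isAlgebraic_finSuccEquiv hf)
  refine ⟨(MvPowerSeries.finSuccEquiv F l).symm q, r, hr, hralg, ?_⟩
  rw [hmap, AlgEquiv.apply_symm_apply]
  exact hfr

lemma succHom_mem_nashSeries {p : MvPowerSeries (Fin l) F} (hp : p ∈ nashSeries F l) :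
    succHom F l p ∈ nashSeries F (l + 1) := by
  have hp' : IsAlgebraic (MvPolynomial (Fin l) F) p := hp
  refine hp'.ringHom_of_comp_eq (rename (R := F) (Fin.succ (n := l))) (succHom F l)
    (rename_injective _ (Fin.succ_injective l)) (RingHom.ext fun q ↦ ?_)
  have h := succHom_coe q
  rw [RingHom.comp_apply, RingHom.comp_apply, MvPowerSeries.algebraMap_apply',
    MvPowerSeries.algebraMap_apply', Algebra.algebraMap_self]
  simpa using h.symm

lemma mem_nashSeries_of_mul_mem {c p : MvPowerSeries (Fin l) F} (hc0 : c ≠ 0)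
    (hc : c ∈ nashSeries F l) (hp : c * p ∈ nashSeries F l) : p ∈ nashSeries F l :=
  IsAlgebraic.of_mul (R := MvPolynomial (Fin l) F) (mem_nonZeroDivisors_of_ne_zero hc0) hc hp

lemma X_mem_nashSeries (j : Fin l) : (MvPowerSeries.X j : MvPowerSeries (Fin l) F) ∈ nashSeries F l := by
  rw [← coe_X]
  exact coe_mem_nashSeries _

lemma isVariableStable_nashSeries [CharZero F] : IsVariableStable (nashSeries F) where
  succHom_mem _ _ hp := succHom_mem_nashSeries hp
  constantCoeff_mem l p hp := by
    -- Restriction to `t₁ = 0` is read off from division by the polynomial `t₁`, whose remainder has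
    -- Nash coefficients.
    obtain ⟨D, hD⟩ := exists_nash_division (F := F) (l := l) (c := X 0) X_prime.irreducible
      ⟨1, by rw [coeff_X, if_pos]; exact one_ne_zero; ext j; cases j using Fin.cases <;> simp⟩
    obtain ⟨q, r, -, hr, h⟩ := hD p hp
    rw [h, coe_X, MvPowerSeries.finSuccEquiv_X_zero, map_add, _root_.map_mul,
      PowerSeries.constantCoeff_X, zero_mul, zero_add, Polynomial.constantCoeff_coe]
    exact hr 0
  of_X_mul_mem l p hp := mem_nashSeries_of_mul_mem (by
    rw [← coe_X, Ne, coe_eq_zero_iff]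
    exact X_ne_zero 0) (X_mem_nashSeries 0) hp

end NashStable
end GradedFamily

namespace GradedFamily
open MvPolynomial

/-! ### Finite generation by division, and Krull's intersection theorem. -/

/-- An ideal containing `c` is finitely generated if modulo `c` the ring is generated by the powers
`1, x, …, x ^ (D - 1)` over a Noetherian ring. -/
lemma ideal_fg_of_division {R S : Type*} [CommRing R] [CommRing S] [IsNoetherianRing R] (ι : R →+* S)
    (c x : S) (D : ℕ) (h : ∀ f : S, ∃ (q : S) (r : ℕ → R),
      f = c * q + ∑ k ∈ Finset.range D, ι (r k) * x ^ k) (I : Ideal S) (hc : c ∈ I) : I.FG := by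
  let _ : Algebra R S := ι.toAlgebra
  let N : Submodule R S := Submodule.span R ((fun k ↦ x ^ k) '' (Finset.range D : Set ℕ))
  have hN : N.FG := Submodule.fg_span ((Finset.range D).finite_toSet.image _)
  -- The remainders that lie in `I` form a submodule of a finitely generated module over a
  -- Noetherian ring; its generators together with `c` generate `I`.
  obtain ⟨T, hT⟩ := hN.of_le (inf_le_right : I.restrictScalars R ⊓ N ≤ N)
  have hTI : (T : Set S) ⊆ I := fun t ht ↦ by
    have : t ∈ I.restrictScalars R ⊓ N := hT ▸ Submodule.subset_span ht
    exact this.1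
  classical
  refine ⟨insert c T, le_antisymm (Ideal.span_le.mpr ?_) fun f hf ↦ ?_⟩
  · rw [Finset.coe_insert]
    exact Set.insert_subset hc hTI
  · obtain ⟨q, r, hfr⟩ := h f
    have hc' : c * q ∈ Ideal.span ((insert c T : Finset S) : Set S) :=
      Ideal.mul_mem_right _ _ (Ideal.subset_span (Finset.mem_insert_self c T))
    have hrem : ∑ k ∈ Finset.range D, ι (r k) * x ^ k ∈ I.restrictScalars R ⊓ N := by
      refine ⟨?_, Submodule.sum_mem _ fun k hk ↦ ?_⟩
      · change _ ∈ I
        rw [eq_sub_of_add_eq' hfr.symm]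
        exact I.sub_mem hf (I.mul_mem_right _ hc)
      · have h1 : ι (r k) * x ^ k = r k • x ^ k := rfl
        rw [h1]
        exact Submodule.smul_mem _ _ (Submodule.subset_span ⟨k, hk, rfl⟩)
    rw [← hT] at hrem
    rw [hfr]
    refine Ideal.add_mem _ hc' ?_
    have h2 : Submodule.span R (T : Set S) ≤
        (Ideal.span ((insert c T : Finset S) : Set S)).restrictScalars R :=
      Submodule.span_le.mpr fun t ht ↦ Ideal.subset_span (Finset.mem_insert_of_mem ht)
    exact h2 hrem

/-- Krull's intersection theorem: ideals of a Noetherian ring are closed for the adic topologies of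
ideals in the Jacobson radical. -/
lemma mem_of_forall_sub_mem_pow {R : Type*} [CommRing R] [IsNoetherianRing R] {I J : Ideal R}
    (hJ : J ≤ Ideal.jacobson ⊥) {b : R} (h : ∀ L : ℕ, ∃ a ∈ I, b - a ∈ J ^ L) : b ∈ I := by
  have hbot := Ideal.iInf_pow_smul_eq_bot_of_le_jacobson (M := R ⧸ I) J hJ
  rw [← Ideal.Quotient.eq_zero_iff_mem, ← Submodule.mem_bot (R := R), ← hbot, Submodule.mem_iInf]
  intro L
  obtain ⟨a, ha, hab⟩ := h L
  have h1 : Ideal.Quotient.mk I b = (b - a) • (1 : R ⧸ I) := by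
    rw [Algebra.smul_def, mul_one, Ideal.Quotient.algebraMap_eq, map_sub,
      Ideal.Quotient.eq_zero_iff_mem.mpr ha, sub_zero]
  rw [h1]
  exact Submodule.smul_mem_smul hab trivial

/-! ### Linear changes of coordinates and regularity in the first variable. -/

section LinearChange
variable {F : Type u} [Field F] {l : ℕ}

/-- The linear change of coordinates `t_j ↦ t_j + v_j t₁`, `j ≥ 2`. -/
noncomputable def shear (v : Fin l → F) : Fin (l + 1) → MvPolynomial (Fin (l + 1)) F :=
  Fin.cons (X 0) fun j ↦ X j.succ + C (v j) * X 0

lemma aeval_shear_shear_neg (v : Fin l → F) (j : Fin (l + 1)) :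
    aeval (shear v) (shear (-v) j) = X j := by
  cases j using Fin.cases with
  | zero => simp [shear]
  | succ j =>
    simp only [shear, Fin.cons_succ, Pi.neg_apply, map_neg, map_add, aeval_X, _root_.map_mul,
      algHom_C, algebraMap_eq, Fin.cons_zero]
    ring

lemma hasSubst_shear (v : Fin l → F) :
    MvPowerSeries.HasSubst fun j ↦ (shear v j : MvPowerSeries (Fin (l + 1)) F) := by
  refine MvPowerSeries.hasSubst_of_constantCoeff_zero fun j ↦ ?_
  cases j using Fin.cases <;> simp [shear]

/-- The linear change of coordinates on power series. -/
noncomputable def shearHom (v : Fin l → F) :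
    MvPowerSeries (Fin (l + 1)) F →ₐ[F] MvPowerSeries (Fin (l + 1)) F :=
  MvPowerSeries.substAlgHom (hasSubst_shear v)

lemma shearHom_coe (v : Fin l → F) (p : MvPolynomial (Fin (l + 1)) F) :
    shearHom v (p : MvPowerSeries (Fin (l + 1)) F) = (aeval (shear v) p : MvPolynomial _ F) := by
  rw [shearHom, MvPowerSeries.substAlgHom_coe]
  have h := (comp_aeval_apply (shear v) (coeToMvPowerSeries.algHom F) p).symm
  simpa using h

lemma shearHom_shearHom_neg (v : Fin l → F) (p : MvPowerSeries (Fin (l + 1)) F) :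
    shearHom v (shearHom (-v) p) = p := by
  have h1 := MvPowerSeries.subst_comp_subst_apply (hasSubst_shear (-v)) (hasSubst_shear v) p
  have h2 : (fun j ↦ MvPowerSeries.subst (fun j ↦ (shear v j : MvPowerSeries (Fin (l + 1)) F))
      (shear (-v) j : MvPowerSeries (Fin (l + 1)) F)) = MvPowerSeries.X := by
    funext j
    have h3 := shearHom_coe v (shear (-v) j)
    rw [aeval_shear_shear_neg, coe_X, shearHom, MvPowerSeries.substAlgHom_apply] at h3
    exact h3
  rw [shearHom, shearHom, MvPowerSeries.substAlgHom_apply, MvPowerSeries.substAlgHom_apply, h1, h2,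
    MvPowerSeries.subst_self, id]

/-- After a linear change of coordinates a nonzero polynomial is regular in the first variable. -/
lemma exists_shear_regular [Infinite F] {c : MvPolynomial (Fin (l + 1)) F} (hc : c ≠ 0) :
    ∃ v : Fin l → F, ∃ i : ℕ, coeff (Finsupp.cons i 0) (aeval (shear v) c) ≠ 0 := by
  -- A point where `c` does not vanish and whose first coordinate is nonzero. The shear with slopes
  -- `x j / x 0` carries the first axis to the line through it, so `c` is nonzero on that line.
  obtain ⟨x, hx⟩ : ∃ x, eval x (X 0 * c) ≠ 0 := by
    by_contra! h
    exact mul_ne_zero (X_ne_zero 0) hc (MvPolynomial.funext fun x ↦ by rw [h x, map_zero])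
  rw [_root_.map_mul, eval_X] at hx
  refine ⟨fun j ↦ x j.succ / x 0, ?_⟩
  by_contra! h
  apply right_ne_zero_of_mul hx
  have h1 : eval x c = eval (Fin.cons (x 0) 0) (aeval (shear fun j ↦ x j.succ / x 0) c) := by
    have h2 := comp_aeval_apply (shear fun j ↦ x j.succ / x 0)
      (aeval (R := F) (Fin.cons (x 0) 0 : Fin (l + 1) → F)) c
    have h3 (y : Fin (l + 1) → F) (p : MvPolynomial (Fin (l + 1)) F) : aeval y p = eval y p :=
      RingHom.congr_fun (coe_aeval_eq_eval y) p
    rw [h3, h3] at h2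
    rw [h2]
    congr 2
    funext j
    cases j using Fin.cases with
    | zero => simp [shear]
    | succ j => simp [shear, div_mul_cancel₀ _ (left_ne_zero_of_mul hx)]
  rw [h1, eval_eq_eval_mv_eval', Polynomial.eval_eq_sum, Polynomial.sum]
  refine Finset.sum_eq_zero fun i _ ↦ ?_
  rw [Polynomial.coeff_map, eval_zero, constantCoeff_eq, finSuccEquiv_coeff_coeff, h i, zero_mul]

lemma shearHom_mem_nashSeries (v : Fin l → F) {p : MvPowerSeries (Fin (l + 1)) F}
    (hp : p ∈ nashSeries F (l + 1)) : shearHom v p ∈ nashSeries F (l + 1) := by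
  have hp' : IsAlgebraic (MvPolynomial (Fin (l + 1)) F) p := hp
  have hinj : Function.Injective (aeval (R := F) (shear v)) := by
    refine Function.LeftInverse.injective (g := aeval (R := F) (shear (-v))) fun q ↦ ?_
    have h := comp_aeval_apply (shear v) (aeval (R := F) (shear (-v))) q
    rw [h]
    have h2 : (fun j ↦ aeval (shear (-v)) (shear v j)) = X := by
      funext j
      have := aeval_shear_shear_neg (-v) j
      rwa [neg_neg] at this
    rw [h2, aeval_X_left, AlgHom.id_apply]
  refine hp'.ringHom_of_comp_eq (aeval (R := F) (shear v)) (shearHom v) hinj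
    (RingHom.ext fun q ↦ ?_)
  have h := shearHom_coe v q
  rw [RingHom.comp_apply, RingHom.comp_apply, MvPowerSeries.algebraMap_apply',
    MvPowerSeries.algebraMap_apply', Algebra.algebraMap_self]
  simpa using h.symm

end LinearChange

/-! ### Nash series are Noetherian, and their ideals are closed. -/

section NashNoetherian
variable {F : Type u} [Field F]

/-- The restriction of a ring homomorphism to subalgebras. -/
def restrictHom {A B : Type*} [CommRing A] [CommRing B] [Algebra F A] [Algebra F B] (φ : A →+* B)
    (S : Subalgebra F A) (T : Subalgebra F B) (h : ∀ p ∈ S, φ p ∈ T) : S →+* T where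
  toFun p := ⟨φ p.1, h p.1 p.2⟩
  map_one' := Subtype.ext (map_one φ)
  map_mul' p q := Subtype.ext (_root_.map_mul φ p.1 q.1)
  map_zero' := Subtype.ext (map_zero φ)
  map_add' p q := Subtype.ext (map_add φ p.1 q.1)

/-- Polynomials as Nash series. -/
noncomputable def polyHom (F : Type u) [Field F] (l : ℕ) :
    MvPolynomial (Fin l) F →+* nashSeries F l where
  toFun p := ⟨p, coe_mem_nashSeries p⟩
  map_one' := Subtype.ext coe_one
  map_mul' p q := Subtype.ext (coe_mul p q)
  map_zero' := Subtype.ext coe_zero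
  map_add' p q := Subtype.ext (coe_add p q)

variable {l : ℕ}

instance : IsDomain (nashSeries F l) :=
  Function.Injective.isDomain (valHom (nashSeries F l)) Subtype.val_injective

/-- An algebraic equation of a nonzero element of `I` forces a nonzero polynomial into `I`, and one
of the prime factors of this polynomial lies in the prime ideal `I`. -/
lemma exists_prime_polyHom_mem (I : Ideal (nashSeries F l)) (hI : I.IsPrime) (h0 : I ≠ ⊥) :
    ∃ c : MvPolynomial (Fin l) F, Prime c ∧ polyHom F l c ∈ I := by
  obtain ⟨x, hx, hx0⟩ := Submodule.exists_mem_ne_zero_of_ne_bot h0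
  obtain ⟨G, hG0, hG⟩ : IsAlgebraic (MvPolynomial (Fin l) F) x.1 := x.2
  have h1 : G.eval₂ (polyHom F l) x = 0 := by
    apply Subtype.val_injective (p := (· ∈ nashSeries F l))
    have h2 := Polynomial.hom_eval₂ G (polyHom F l) (valHom (nashSeries F l)) x
    refine h2.trans (Eq.trans ?_ hG)
    rw [Polynomial.aeval_def]
    congr 1
  have h2 : I.comap (polyHom F l) ≠ ⊥ := Ideal.comap_ne_bot_of_root_mem hx0 hx hG0 h1
  obtain ⟨c, hc, hcp⟩ := (hI.comap (polyHom F l)).exists_mem_prime_of_ne_bot h2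
  exact ⟨c, hcp, hc⟩

lemma ideal_fg_of_regular_mem [CharZero F] [IsNoetherianRing (nashSeries F l)]
    {c : MvPolynomial (Fin (l + 1)) F} (hc : Irreducible c)
    (hreg : ∃ i : ℕ, coeff (Finsupp.cons i 0) c ≠ 0) (I : Ideal (nashSeries F (l + 1)))
    (hI : polyHom F (l + 1) c ∈ I) : I.FG := by
  obtain ⟨D, hD⟩ := exists_nash_division hc hreg
  refine ideal_fg_of_division
    (restrictHom (succHom F l) (nashSeries F l) (nashSeries F (l + 1)) fun _ ↦ succHom_mem_nashSeries)
    -- The remainder has degree less than `D`; one more power is allowed so that the weaker bound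
    -- `natDegree ≤ D` suffices.
    (polyHom F (l + 1) c) (polyHom F (l + 1) (X 0)) (D + 1) (fun f ↦ ?_) I hI
  obtain ⟨q, r, hr, hrmem, hfr⟩ := hD f.1 f.2
  have hsum : (f : MvPowerSeries (Fin (l + 1)) F) = c * q +
      ∑ k ∈ Finset.range (D + 1), succHom F l (r.coeff k) * MvPowerSeries.X 0 ^ k := by
    apply (MvPowerSeries.finSuccEquiv F l).injective
    rw [hfr, map_add, _root_.map_mul, map_sum]
    congr 1
    have h1 := r.as_sum_range_C_mul_X_pow' (n := D + 1)
      (Nat.lt_succ_of_le (Polynomial.natDegree_le_of_degree_le hr.le))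
    have h2 := congrArg (Polynomial.coeToPowerSeries.ringHom (R := MvPowerSeries (Fin l) F)) h1
    rw [map_sum] at h2
    refine h2.trans (Finset.sum_congr rfl fun k _ ↦ ?_)
    rw [_root_.map_mul, _root_.map_mul, map_pow, map_pow, finSuccEquiv_succHom,
      MvPowerSeries.finSuccEquiv_X_zero]
    simp
  have hsmem : ∑ k ∈ Finset.range (D + 1), succHom F l (r.coeff k) * MvPowerSeries.X 0 ^ k ∈
      nashSeries F (l + 1) :=
    sum_mem fun k _ ↦ mul_mem (succHom_mem_nashSeries (hrmem k)) (pow_mem (X_mem_nashSeries 0) k)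
  have hq : q ∈ nashSeries F (l + 1) := by
    refine mem_nashSeries_of_mul_mem (c := c) ?_ (coe_mem_nashSeries c) ?_
    · rw [Ne, coe_eq_zero_iff]
      exact hc.ne_zero
    · rw [eq_sub_of_add_eq hsum.symm]
      exact sub_mem f.2 hsmem
  refine ⟨⟨q, hq⟩, fun k ↦ ⟨r.coeff k, hrmem k⟩, ?_⟩
  apply Subtype.val_injective (p := (· ∈ nashSeries F (l + 1)))
  refine hsum.trans ?_
  rw [← valHom_apply, map_add, _root_.map_mul, map_sum]
  congr 1
  refine Finset.sum_congr rfl fun k _ ↦ ?_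
  rw [_root_.map_mul, map_pow]
  exact congrArg (succHom F l (r.coeff k) * · ^ k) (coe_X (R := F) (0 : Fin (l + 1))).symm

/-- Induction on the number of variables. It suffices that nonzero prime ideals are finitely
generated; such an ideal contains a prime polynomial, which a shear makes regular in the first
variable, and then division reduces finite generation to one variable less. -/
theorem isNoetherianRing_nashSeries [CharZero F] (l : ℕ) : IsNoetherianRing (nashSeries F l) := by
  induction l with
  | zero =>
    refine IsNoetherianRing.of_prime_ne_bot fun I _ h0 ↦ ?_
    obtain ⟨x, hx, hx0⟩ := Submodule.exists_mem_ne_zero_of_ne_bot h0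
    have hcst : x = algebraMap F _ (MvPowerSeries.constantCoeff x.1) := by
      apply Subtype.val_injective (p := (· ∈ nashSeries F 0))
      change x.1 = MvPowerSeries.C _
      ext d
      rw [Subsingleton.elim d 0]
      simp
    have hne : MvPowerSeries.constantCoeff x.1 ≠ 0 := fun h ↦ hx0 (by rw [hcst, h, map_zero])
    rw [Ideal.eq_top_of_isUnit_mem I hx (hcst ▸ (isUnit_iff_ne_zero.mpr hne).map (algebraMap F _))]
    exact ⟨{1}, by simp⟩
  | succ l ih =>
    refine IsNoetherianRing.of_prime_ne_bot fun I hI h0 ↦ ?_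
    obtain ⟨c, hc, hcI⟩ := exists_prime_polyHom_mem I hI h0
    obtain ⟨v, hv⟩ := exists_shear_regular hc.ne_zero
    let e : MvPolynomial (Fin (l + 1)) F ≃ₐ[F] MvPolynomial (Fin (l + 1)) F :=
      AlgEquiv.ofAlgHom (aeval (shear v)) (aeval (shear (-v)))
        (algHom_ext fun j ↦ by simpa using aeval_shear_shear_neg v j)
        (algHom_ext fun j ↦ by simpa using aeval_shear_shear_neg (-v) j)
    have hirr : Irreducible (aeval (shear v) c) := (MulEquiv.irreducible_iff e).mpr hc.irreducible
    let τ : nashSeries F (l + 1) →+* nashSeries F (l + 1) :=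
      restrictHom (shearHom (-v) : _ →+* _) _ _ fun _ ↦ shearHom_mem_nashSeries (-v)
    have hτ : Function.Surjective τ := fun p ↦ by
      refine ⟨⟨shearHom v p.1, shearHom_mem_nashSeries v p.2⟩, Subtype.ext ?_⟩
      have := shearHom_shearHom_neg (-v) p.1
      rwa [neg_neg] at this
    have hτc : τ (polyHom F (l + 1) (aeval (shear v) c)) = polyHom F (l + 1) c := by
      refine Subtype.ext ((shearHom_coe (-v) _).trans ?_)
      exact congrArg _ (e.symm_apply_apply c)
    have h1 : (I.comap τ).FG := ideal_fg_of_regular_mem hirr hv _ (by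
      rw [Ideal.mem_comap, hτc]
      exact hcI)
    rw [← Ideal.map_comap_of_surjective τ hτ I]
    exact h1.map τ

/-- Hadamard's lemma, iterated: a Nash series of order at least `L` lies in the `L`-th power of the
ideal of `t = 0`, which turns coefficientwise approximation into adic approximation. -/
lemma mem_pow_ker_constHom [CharZero F] (L : ℕ) (p : nashSeries F l)
    (hp : ∀ d : Fin l →₀ ℕ, d.degree < L → MvPowerSeries.coeff d p.1 = 0) :
    p ∈ RingHom.ker (constHom (nashSeries F l)) ^ L := by
  induction L generalizing p with
  | zero => simp
  | succ L ih =>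
    obtain ⟨g, hg, hpg⟩ := isVariableStable_nashSeries.exists_eq_sum l L p.1 p.2 hp
    have h1 : p = ∑ j, polyHom F l (X j) * ⟨g j, (hg j).1⟩ := by
      apply Subtype.val_injective (p := (· ∈ nashSeries F l))
      refine hpg.trans ?_
      change _ = valHom (nashSeries F l) _
      rw [map_sum]
      refine Finset.sum_congr rfl fun j _ ↦ ?_
      rw [_root_.map_mul]
      congr 1
      exact (coe_X (R := F) j).symm
    rw [h1, pow_succ']
    refine Ideal.sum_mem _ fun j _ ↦ Ideal.mul_mem_mul ?_ (ih _ (hg j).2)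
    change MvPowerSeries.constantCoeff ((X j : MvPolynomial (Fin l) F) : MvPowerSeries (Fin l) F) = 0
    rw [coe_X, MvPowerSeries.constantCoeff_X]

theorem hasClosedIdeals_nashSeries [CharZero F] : HasClosedIdeals (nashSeries F l) := by
  intro I b hb
  have hN := isNoetherianRing_nashSeries (F := F) l
  have hJ := (hasFixedPoints_nashSeries (F := F) (l := l)).hasImplicitSolutions.ker_le_jacobson
  refine mem_of_forall_sub_mem_pow hJ fun L ↦ ?_
  obtain ⟨a, ha, hab⟩ := hb L
  refine ⟨a, ha, mem_pow_ker_constHom L _ fun d hd ↦ ?_⟩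
  change MvPowerSeries.coeff d (b.1 - a.1) = 0
  rw [map_sub, hab d hd, sub_self]

end NashNoetherian
end GradedFamily

theorem mainTheorem5 {F : Type*} {E : Type*} [Field F] [CharZero F] [Field E] [Algebra F E]
    {l : ℕ} (SF : Subalgebra F (MvPowerSeries (Fin l) F))
    (SE : Subalgebra E (MvPowerSeries (Fin l) E)) (hS : GradedFamily.IsSeriesPair SF SE)
    (I : Ideal SF)
    (hI : ∀ p ∈ I, MvPowerSeries.constantCoeff (p : MvPowerSeries (Fin l) F) = 0)
    {n m : ℕ} (w : Fin n → ℕ) (v : Fin m → ℕ) (hw : ∀ i, 0 < w i) (hv : ∀ j, 0 < v j)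
    (JX : GradedFamily.GradedIdeal F w) (JY : GradedFamily.GradedIdeal F v)
    (f : GradedFamily.GradedMorphism JX JY (SF ⧸ I)) (𝒢 : GradedFamily.EquivGroup)
    (hK : GradedFamily.GloballyTrivial (R := SE ⧸ I.map hS.map) 𝒢 f (GradedFamily.valueAtZero I hI)
      (hS.quotientMap I)) :
    GradedFamily.GloballyTrivial (R := SF ⧸ I) 𝒢 f (GradedFamily.valueAtZero I hI)
      (AlgHom.id F (SF ⧸ I)) := by
  refine hS.globallyTrivial_descent I hI ?_ ?_ hw hv f hK
  · cases hS with
    | formal => exact GradedFamily.hasFixedPoints_top.hasImplicitSolutions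
    | nash => exact GradedFamily.hasFixedPoints_nashSeries.hasImplicitSolutions
    | analytic => exact GradedFamily.hasFixedPoints_convergentSeries.hasImplicitSolutions
  · cases hS with
    | formal => exact GradedFamily.hasClosedIdeals_top
    | nash => exact GradedFamily.hasClosedIdeals_nashSeries
    | analytic a => exact GradedFamily.hasClosedIdeals_convergentSeries a
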